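/- **Notation.** Let $n,d,l\in\mathbb N=\{1,2,\dots\}$ and $p,r\in(0,\infty)$. A weight is a measurable function with values in $(0,\infty)$; cubes are open with sides parallel to the coordinate axes, and $r(Q)$ is the side length of $Q$. For $k\in\mathbb N_0$, $m\in\mathbb Z^n$ put $Q_{k,m}=\prod_{i=1}^n\bigl(\tfrac{m_i}{2^k},\tfrac{m_i+1}{2^k}\bigr)$. * A weight $w$ on $\mathbb R^N$ belongs to $A^{loc}_\infty(\mathbb R^N)$ if, for some $a>0$ and some $\alpha\in(0,1)$, the ratio $\int_Q w/\int_F w$ is bounded uniformly over all cubes $Q$ with $r(Q)\le a$ and all measurable $F\subset Q$ with $|F|\ge\alpha|Q|$. * A sequence of weights $\{s_k\}_{k\ge0}$ on $\mathbb R^n$ belongs to ${}^{loc}Y^{\alpha_3}_{\alpha_1,\alpha_2}$ with constant $C_1>0$ if $\frac1{C_1}2^{\alpha_1(k-j)}\le \frac{s_k(x)}{s_j(x)}\le C_12^{\alpha_2(k-j)}$ for all $0\le j\le k$, $x\in\mathbb R^n$, and $s_k(x)\le2^{\alpha_3}s_k(y)$ for all $k\ge 0$ and $|x-y|\le2^{-k}$.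 Put $s_{k,m}=\|s_k|L_p(Q_{k,m})\|$. * For a weight $\gamma$ on $\mathbb R^{n+d}$ put $\widehat\gamma_{k,m}=\|\gamma|L_p(\Xi_{k,m})\|$, $\Xi_{k,m}=Q_{k,m}\times(2^{-k}B^d\setminus2^{-k-1}B^d)$, where $B^d$ is the Euclidean unit ball of $\mathbb R^d$. * $\delta_1=\delta_1(\gamma,n,d)$ is the supremum of all $\delta>0$ for which there is $C$ with $\sum_{Q_{j,m'}\subset Q_{k,m}}\widehat\gamma_{j,m'}^{\,p}\le C2^{(k-j)d\delta}\,\widehat\gamma_{k,m}^{\,p}$ for all $0\le k\le j$ and $m\in\mathbb Z^n$. * $\delta_2=\delta_2(\gamma,n,d)$ is the supremum of all $\delta>0$ for which there is $C$ with $\sum_{Q_{j,m'}\in G}\widehat\gamma_{j,m'}^{\,p}\le C\bigl(|\bigcup_{Q\in G}Q|/|Q_{k,m}|\bigr)^{\delta}\sum_{Q_{j,m'}\subset Q_{k,m}}\widehat\gamma_{j,m'}^{\,p}$ for all $0\le k\le j$, $m\in\mathbb Z^n$ and all sets $G$ of cubes $Q_{j,m'}\subset Q_{k,m}$. * $\Delta^l(h)\varphi(x)=\sum_{i=0}^l(-1)^{l+i}\binom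 li\varphi(x+ih)$ and $\delta^l_r(Q)\varphi=\Bigl(r(Q)^{-2n}\int_{(-r(Q),r(Q))^n}\int_Q|\Delta^l(h)\varphi(x)|^r\,dx\,dh\Bigr)^{1/r}$. * $N^{l-1}$ is the $B$-spline of degree $l-1$ with knots $0,1,\dots,l$, $N^{l-1}_{k,m}(x)=\prod_{i=1}^nN^{l-1}(2^kx_i-m_i)$, and $\Sigma^{l-1}_k$ is the set of all $S=\sum_{m\in\mathbb Z^n}\beta_mN^{l-1}_{k,m}$ with real $\beta_m$. * For $\{t_{k,m}\}$ and $\varphi\in L_r^{loc}(\mathbb R^n)$ put, for $k\ge0$, $$s^l_k(\varphi)=\inf_{S\in\Sigma^{l-1}_k}\Bigl(\sum_{m\in\mathbb Z^n}t_{k,m}^p\,2^{knp/r}\|\varphi-S|L_r(Q_{k,m})\|^p\Bigr)^{1/p},\qquad s^l_{-1}(\varphi)=\Bigl(\sum_{m\in\mathbb Z^n}t_{0,m}^p\|\varphi|L_r(Q_{0,m})\|^p\Bigr)^{1/p}.$$ **Theorem.** Let $0<\alpha_1\le\alpha_2$, $\alpha_3\ge0$, $C_1>0$, $\varepsilon>0$,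 and let $\gamma$ be a weight on $\mathbb R^{n+d}$ with $\gamma^p\in A^{loc}_\infty(\mathbb R^{n+d})$. Put $\widetilde\lambda=\min\{l,\;l-1+\frac{\delta_2-\varepsilon}{p}\}$ and $\beta=\widetilde\lambda+\frac{d(\delta_1-\varepsilon)}{p}-\alpha_2$. Then there is a constant $C>0$, depending only on $n,d,l,p,r,\alpha_1,\alpha_2,\alpha_3,C_1,\varepsilon$ and $\gamma$, such that for every $\{s_k\}\in{}^{loc}Y^{\alpha_3}_{\alpha_1,\alpha_2}$ with constant $C_1$, every $0<\mu\le\min\{1,r,p\}$, every $\varphi\in L_r^{loc}(\mathbb R^n)$ and every $k\in\mathbb N_0$, with $t_{k,m}=2^{kn/p}s_{k,m}\widehat\gamma_{k,m}$, $$\Bigl(\sum_{m\in\mathbb Z^n}t_{k,m}^p\,[\delta^l_r(Q_{k,m})\varphi]^p\Bigr)^{1/p}\le C\,2^{-k\beta}\Bigl(\sum_{j=-1}^k2^{j\mu\beta}\bigl(s^l_j(\varphi)\bigr)^\mu\Bigr)^{1/\mu},$$ where both sides may be $+\infty$. -/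

import Mathlib

open MeasureTheory
open scoped ENNReal NNReal

noncomputable section

namespace VarSmooth

/-- The open cube with sides parallel to the axes, lower corner `c` and side length `s`. -/
def openCube {ι : Type*} (c : ι → ℝ) (s : ℝ) : Set (ι → ℝ) :=
  {x | ∀ i, c i < x i ∧ x i < c i + s}

/-- The dyadic cube `∏ (mᵢ / 2ᵏ, (mᵢ + 1) / 2ᵏ)`. -/
def dyadicCube {n : ℕ} (k : ℕ) (m : Fin n → ℤ) : Set (Fin n → ℝ) :=
  openCube (fun i => (m i : ℝ) / 2 ^ k) (1 / 2 ^ k)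

/-- A weight: a measurable function with values in `(0, ∞)`. -/
def IsWeight {ι : Type*} (w : (ι → ℝ) → ℝ) : Prop :=
  Measurable w ∧ ∀ x, 0 < w x

/-- `w(E) = ∫_E w`. -/
def weightMass {ι : Type*} [Fintype ι] (w : (ι → ℝ) → ℝ) (E : Set (ι → ℝ)) : ℝ≥0∞ :=
  ∫⁻ x in E, ENNReal.ofReal (w x)

/-- The local Muckenhoupt class `A_∞^loc`: for some bound `a > 0` on the side length and some
`α ∈ (0, 1)`, the ratio `w(Q) / w(F)` is bounded over all cubes `Q` of side length at most `a` and
all measurable `F ⊆ Q` with `|F| ≥ α |Q|`. Local integrability of `w` is a consequence: take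
`F = Q ∩ {w ≤ M}` with `M` large. -/
def ALocInfty {ι : Type*} [Fintype ι] (w : (ι → ℝ) → ℝ) : Prop :=
  IsWeight w ∧ ∃ a : ℝ, 0 < a ∧ ∃ α : ℝ, 0 < α ∧ α < 1 ∧ ∃ C : ℝ≥0,
    ∀ (c : ι → ℝ) (s : ℝ), 0 < s → s ≤ a → ∀ F : Set (ι → ℝ), MeasurableSet F →
      F ⊆ openCube c s → ENNReal.ofReal α * volume (openCube c s) ≤ volume F →
      weightMass w (openCube c s) ≤ C * weightMass w F

/-- The class `^loc Y^{α₃}_{α₁, α₂}` of weight sequences, with the constant `C₁` of the two-sided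
growth condition made explicit. The distance in the last condition is the Euclidean one. -/
structure LocY {n : ℕ} (α₁ α₂ α₃ C₁ : ℝ) (s : ℕ → (Fin n → ℝ) → ℝ) : Prop where
  isWeight : ∀ k, IsWeight (s k)
  lower : ∀ (j k : ℕ), j ≤ k → ∀ x,
    1 / C₁ * (2 : ℝ) ^ (α₁ * ((k : ℝ) - j)) ≤ s k x / s j x
  upper : ∀ (j k : ℕ), j ≤ k → ∀ x,
    s k x / s j x ≤ C₁ * (2 : ℝ) ^ (α₂ * ((k : ℝ) - j))
  compare : ∀ (k : ℕ) (x y : Fin n → ℝ),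
    dist (WithLp.toLp 2 x) (WithLp.toLp 2 y) ≤ 1 / 2 ^ k →
      s k x ≤ (2 : ℝ) ^ α₃ * s k y

/-- The quasi-norm `‖f | L_p(E)‖`, for `p ∈ (0, ∞)`. -/
def lpNormOn {ι : Type*} [Fintype ι] (f : (ι → ℝ) → ℝ) (p : ℝ) (E : Set (ι → ℝ)) : ℝ≥0∞ :=
  eLpNorm f (ENNReal.ofReal p) (volume.restrict E)

/-- `φ ∈ L_r^loc(ℝⁿ)`. -/
def MemLpLoc {n : ℕ} (φ : (Fin n → ℝ) → ℝ) (r : ℝ) : Prop :=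
  ∀ K : Set (Fin n → ℝ), IsCompact K → MemLp φ (ENNReal.ofReal r) (volume.restrict K)

/-- The set `Ξ_{k,m} = Q_{k,m} × (2^{-k} B^d \ 2^{-k-1} B^d)`, where `B^d` is the Euclidean unit
ball. Points of `ℝ^{n+d}` have coordinates indexed by `Fin n ⊕ Fin d`. -/
def shellBox {n : ℕ} (d k : ℕ) (m : Fin n → ℤ) : Set (Fin n ⊕ Fin d → ℝ) :=
  {z | (fun i => z (Sum.inl i)) ∈ dyadicCube k m ∧
    1 / 2 ^ (k + 1) ≤ ‖WithLp.toLp 2 (fun i : Fin d => z (Sum.inr i))‖ ∧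
    ‖WithLp.toLp 2 (fun i : Fin d => z (Sum.inr i))‖ < 1 / 2 ^ k}

/-- The multiple sequence generated by the weight `γ`: `‖γ | L_p(Ξ_{k,m})‖`. -/
def gammaHat {n d : ℕ} (γ : (Fin n ⊕ Fin d → ℝ) → ℝ) (p : ℝ) (k : ℕ) (m : Fin n → ℤ) : ℝ≥0∞ :=
  lpNormOn γ p (shellBox d k m)

/-- Indices of the dyadic cubes of generation `j` that lie in `Q_{k,m}`. -/
def subcubes {n : ℕ} (k : ℕ) (m : Fin n → ℤ) (j : ℕ) : Set (Fin n → ℤ) :=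
  {m' | dyadicCube j m' ⊆ dyadicCube k m}

/-- `δ₁(γ, n, d)`: the supremum of the `δ > 0` for which, with a constant `C`,
`∑_{Q_{j,m'} ⊆ Q_{k,m}} γ̂_{j,m'}^p ≤ C 2^{(k-j) d δ} γ̂_{k,m}^p` for all `k ≤ j` and `m`. -/
def delta1 {n d : ℕ} (γ : (Fin n ⊕ Fin d → ℝ) → ℝ) (p : ℝ) : ℝ :=
  sSup {δ : ℝ | 0 < δ ∧ ∃ C : ℝ≥0, ∀ (k j : ℕ), k ≤ j → ∀ m : Fin n → ℤ,
    ∑' m' : subcubes k m j, gammaHat γ p j m' ^ p ≤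
      C * (2 : ℝ≥0∞) ^ (((k : ℝ) - j) * d * δ) * gammaHat γ p k m ^ p}

/-- `δ₂(γ, n, d)`: the supremum of the `δ > 0` for which, with a constant `C`,
`∑_{Q ∈ G} γ̂_Q^p ≤ C (|⋃ G| / |Q_{k,m}|)^δ ∑_{Q_{j,m'} ⊆ Q_{k,m}} γ̂_{j,m'}^p` for all `k ≤ j`, all
`m` and all sets `G` of dyadic cubes of generation `j` contained in `Q_{k,m}`. -/
def delta2 {n d : ℕ} (γ : (Fin n ⊕ Fin d → ℝ) → ℝ) (p : ℝ) : ℝ :=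
  sSup {δ : ℝ | 0 < δ ∧ ∃ C : ℝ≥0, ∀ (k j : ℕ), k ≤ j → ∀ m : Fin n → ℤ,
    ∀ G : Set (Fin n → ℤ), G ⊆ subcubes k m j →
      ∑' m' : G, gammaHat γ p j m' ^ p ≤
        C * (volume (⋃ m' ∈ G, dyadicCube j m') / volume (dyadicCube k m)) ^ δ *
          ∑' m' : subcubes k m j, gammaHat γ p j m' ^ p}

/-- `t_{k,m} = 2^{kn/p} s_{k,m} γ̂_{k,m}` with `s_{k,m} = ‖s_k | L_p(Q_{k,m})‖`. -/
def tSeq {n d : ℕ} (s : ℕ → (Fin n → ℝ) → ℝ) (γ : (Fin n ⊕ Fin d → ℝ) → ℝ) (p : ℝ)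
    (k : ℕ) (m : Fin n → ℤ) : ℝ≥0∞ :=
  (2 : ℝ≥0∞) ^ ((k : ℝ) * n / p) * lpNormOn (s k) p (dyadicCube k m) * gammaHat γ p k m

/-- The averaged difference
`δ^l_r(Q) φ = (r(Q)^{-2n} ∫_{r(Q) Iⁿ} ∫_Q |Δ^l(h) φ(x)|^r dx dh)^{1/r}`, `Iⁿ = (-1, 1)ⁿ`,
for the cube `Q` with lower corner `c` and side length `r(Q) = s`. -/
def localDiff {n : ℕ} (l : ℕ) (r : ℝ) (c : Fin n → ℝ) (s : ℝ) (φ : (Fin n → ℝ) → ℝ) : ℝ≥0∞ :=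
  ((ENNReal.ofReal (s ^ (2 * n)))⁻¹ *
    ∫⁻ h in openCube (fun _ : Fin n => -s) (2 * s), ∫⁻ x in openCube c s,
      ‖(fwdDiff h)^[l] φ x‖ₑ ^ r) ^ (1 / r)

/-- `δ^l_r(Q_{k,m}) φ`. -/
def dyadicDiff {n : ℕ} (l : ℕ) (r : ℝ) (k : ℕ) (m : Fin n → ℤ) (φ : (Fin n → ℝ) → ℝ) : ℝ≥0∞ :=
  localDiff l r (fun i => (m i : ℝ) / 2 ^ k) (1 / 2 ^ k) φ

/-- The `B`-spline `N^{l-1}` of degree `l - 1` (for `l ≥ 1`) with knots `0, 1, …, l`: the divided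
difference of order `l` at the knots of the truncated power `(t - ·)_+^{l-1}`, normalized so that
the integer translates form a partition of unity. For `l = 1` it is the indicator of `[0, 1)`. -/
def bSpline (l : ℕ) (t : ℝ) : ℝ :=
  ((l - 1).factorial : ℝ)⁻¹ * ∑ i ∈ Finset.range (l + 1),
    (-1 : ℝ) ^ i * (l.choose i : ℝ) * (if (i : ℝ) ≤ t then (t - i) ^ (l - 1) else 0)

/-- `N^{l-1}_{k,m}(x) = ∏ᵢ N^{l-1}(2ᵏ (xᵢ - mᵢ / 2ᵏ))`. -/
def bSplineN {n : ℕ} (l k : ℕ) (m : Fin n → ℤ) (x : Fin n → ℝ) : ℝ :=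
  ∏ i, bSpline l (2 ^ k * (x i - (m i : ℝ) / 2 ^ k))

/-- `Σ^{l-1}_k`: all splines `∑_m β_m N^{l-1}_{k,m}`. At each point only finitely many terms are
nonzero. -/
def splineSpace (n l k : ℕ) : Set ((Fin n → ℝ) → ℝ) :=
  {S | ∃ β : (Fin n → ℤ) → ℝ, ∀ x, S x = ∑ᶠ m, β m * bSplineN l k m x}

/-- The weighted best spline approximation error
`s^l_k = inf_{S ∈ Σ^{l-1}_k} (∑_m t_{k,m}^p (2^{kn/r} ‖φ - S | L_r(Q_{k,m})‖)^p)^{1/p}`. -/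
def splineError {n : ℕ} (l : ℕ) (r p : ℝ) (t : ℕ → (Fin n → ℤ) → ℝ≥0∞)
    (φ : (Fin n → ℝ) → ℝ) (k : ℕ) : ℝ≥0∞ :=
  ⨅ S ∈ splineSpace n l k,
    (∑' m, t k m ^ p *
      ((2 : ℝ≥0∞) ^ ((k : ℝ) * n / r) * lpNormOn (φ - S) r (dyadicCube k m)) ^ p) ^ (1 / p)

/-- `s^l_{-1} = (∑_m t_{0,m}^p ‖φ | L_r(Q_{0,m})‖^p)^{1/p}`. -/
def splineErrorInit {n : ℕ} (r p : ℝ) (t : ℕ → (Fin n → ℤ) → ℝ≥0∞)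
    (φ : (Fin n → ℝ) → ℝ) : ℝ≥0∞ :=
  (∑' m, t 0 m ^ p * lpNormOn φ r (dyadicCube 0 m) ^ p) ^ (1 / p)

/-- The exponent `λ̃ + d (δ₁ - ε) / p - α₂`, with `λ̃ = min {l, l - 1 + (δ₂ - ε) / p}`. -/
def rate {n d : ℕ} (l : ℕ) (p α₂ ε : ℝ) (γ : (Fin n ⊕ Fin d → ℝ) → ℝ) : ℝ :=
  min (l : ℝ) ((l : ℝ) - 1 + (delta2 γ p - ε) / p) + d * (delta1 γ p - ε) / p - α₂

end VarSmooth

end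

open MeasureTheory
open scoped ENNReal NNReal

namespace VarSmooth

/-! ### Finite differences of products of sequences -/

/-! Choose splines `S j` of generation `j` whose errors nearly attain `s^l_j(φ)`, and write `φ = (φ
- S_k) + S_0 + ∑_{j=1}^k (S_j - S_{j-1})`. Since `μ ≤ min {1, r, p}`, the `μ`-th power of the left
side is subadditive in `φ` (`dyadicDiff_add_rpow_le`, `diffSum_add_rpow_le`), so the pieces can be
estimated separately. The remainder `φ - S_k` is bounded crudely by its `L_r` quasi-norms over
neighbouring cubes (`diffSum_le_cellSum`). The piece `U_j = S_j - S_{j-1}` belongs to the spline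
space of generation `j` by refinement (`splineSpace_mono_succ`), gains the factor `2^{(j-k)β}` when
differenced at scale `2^{-k}` (`diffSum_spline_le`), and has size at scale `j` controlled by the
errors of `S_j` and `S_{j-1}` (`cellSum_add_le`, `cellSum_succ_le`).

The exponent `β` combines three effects (`tsum_layerRate_tSeq_le`). Smoothness: where all sample
points stay in one cell of generation `j`, the spline is a polynomial and its `l`-th difference with
step at most `2^{-k}` is `O(2^{(j-k)l})`; a crossed knot costs one order (`abs_fwdDiff_spline_le`).
Crossings concern only the cubes in a boundary layer of relative volume `O(2^{j-k})`, whose weight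
is smaller by `2^{(j-k)(δ₂-ε)}`; the worse of the two regimes gives `λ̃`. The weight `γ`: summing
over the subcubes of `Q_{j,m'}` gains `d(δ₁-ε)/p`. The weights `s_k`: their growth from generation
`j` to `k` costs `α₂`.

The differences of `U_j` are first bounded by B-spline coefficients. These return to local
quasi-norms by stability of the B-spline basis (`enorm_coeff_le`), and sums over neighbouring cells
are absorbed by the doubling that `A_∞^loc` provides (`weightMass_shellHull_le`).

The constant does not depend on `μ`: the estimate is proved for the largest admissible exponent, and
`ℓ_μ` quasi-norms decrease in `μ` (`add_sum_rpow_root_anti`). -/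

/-- The finite differences of order `a` of `u` on `{0, …, l}` are bounded by `B * w a`. -/
def DiffBound (l : ℕ) (w : ℕ → ℝ) (B : ℝ) (u : ℕ → ℝ) : Prop :=
  ∀ a i : ℕ, i + a ≤ l → |(fwdDiff 1)^[a] u i| ≤ B * w a

/-- Induction on the Leibniz rule `Δ(uv) = Δu · v(· + 1) + u · Δv`, each step doubling the number of
terms. The bounds `U`, `V` are arbitrary sequences so that the hypothesis can be applied to `Δu` or
`Δv` with a shifted bound; each step also shortens the window by one. -/
theorem abs_fwdDiff_iter_mul_le (a : ℕ) : ∀ (u v : ℕ → ℝ) (U V : ℕ → ℝ) (W : ℝ) (i l : ℕ),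
    i + a ≤ l →
    (∀ b j, j + b ≤ l → |(fwdDiff 1)^[b] u j| ≤ U b) →
    (∀ b j, j + b ≤ l → |(fwdDiff 1)^[b] v j| ≤ V b) →
    (∀ b c, b + c = a → U b * V c ≤ W) →
    |(fwdDiff 1)^[a] (u * v) i| ≤ 2 ^ a * W := by
  induction a with
  | zero =>
    intro u v U V W i l hi hu hv hW
    simp only [Function.iterate_zero, id, Pi.mul_apply, pow_zero, one_mul, abs_mul]
    have h1 := hu 0 i hi
    have h2 := hv 0 i hi
    simp only [Function.iterate_zero, id] at h1 h2
    exact (mul_le_mul h1 h2 (abs_nonneg _) ((abs_nonneg _).trans h1)).trans (hW 0 0 rfl)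
  | succ a ih =>
    intro u v U V W i l hi hu hv hW
    have hprod : fwdDiff 1 (u * v) = fwdDiff 1 u * (fun j => v (j + 1)) + u * fwdDiff 1 v := by
      funext j
      simp only [fwdDiff, Pi.mul_apply, Pi.add_apply]
      ring
    have hl : 1 ≤ l := by omega
    rw [Function.iterate_succ_apply, hprod, fwdDiff_iter_add, Pi.add_apply]
    have hu' : ∀ b j, j + b ≤ l - 1 → |(fwdDiff 1)^[b] u j| ≤ U b :=
      fun b j h => hu b j (by omega)
    have hdu : ∀ b j, j + b ≤ l - 1 → |(fwdDiff 1)^[b] (fwdDiff 1 u) j| ≤ U (b + 1) := by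
      intro b j h
      rw [← Function.iterate_succ_apply]
      exact hu (b + 1) j (by omega)
    have hdv : ∀ b j, j + b ≤ l - 1 → |(fwdDiff 1)^[b] (fwdDiff 1 v) j| ≤ V (b + 1) := by
      intro b j h
      rw [← Function.iterate_succ_apply]
      exact hv (b + 1) j (by omega)
    have hsv : ∀ b j, j + b ≤ l - 1 → |(fwdDiff 1)^[b] (fun j => v (j + 1)) j| ≤ V b := by
      intro b j h
      rw [fwdDiff_iter_comp_add]
      exact hv b (j + 1) (by omega)
    have e1 := ih (fwdDiff 1 u) (fun j => v (j + 1)) (fun b => U (b + 1)) V W i (l - 1) (by omega)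
      hdu hsv (fun b c h => hW (b + 1) c (by omega))
    have e2 := ih u (fwdDiff 1 v) U (fun b => V (b + 1)) W i (l - 1) (by omega)
      hu' hdv (fun b c h => hW b (c + 1) (by omega))
    calc _ ≤ _ := abs_add_le _ _
      _ ≤ 2 ^ a * W + 2 ^ a * W := add_le_add e1 e2
      _ = 2 ^ (a + 1) * W := by ring

/-- The two weights used later are `θ ^ a` and `θ ^ min a (l - 1)` with `θ ≤ 1`; both satisfy `hw`.
Hence a product of one-dimensional factors keeps the decay of a single factor. -/
theorem DiffBound.mul {l : ℕ} {w : ℕ → ℝ} {B B' : ℝ} {u v : ℕ → ℝ}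
    (hw : ∀ a b, w a * w b ≤ w (a + b)) (hw0 : ∀ a, 0 ≤ w a) (hB : 0 ≤ B) (hB' : 0 ≤ B')
    (hu : DiffBound l w B u) (hv : DiffBound l w B' v) :
    DiffBound l w (2 ^ l * (B * B')) (u * v) := by
  intro a i hi
  refine (abs_fwdDiff_iter_mul_le a u v (fun b => B * w b) (fun b => B' * w b) (B * B' * w a)
    i l hi hu hv ?_).trans ?_
  · rintro b c rfl
    calc B * w b * (B' * w c) = B * B' * (w b * w c) := by ring
      _ ≤ B * B' * w (b + c) := by gcongr; exact hw b c
  · calc (2 : ℝ) ^ a * (B * B' * w a) = 2 ^ a * (B * B') * w a := by ring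
      _ ≤ 2 ^ l * (B * B') * w a := by
        have : 0 ≤ w a := hw0 a
        gcongr
        · norm_num
        · omega

theorem DiffBound.mono {l : ℕ} {w w' : ℕ → ℝ} {B B' : ℝ} {u : ℕ → ℝ} (hu : DiffBound l w B u)
    (h : ∀ a ≤ l, B * w a ≤ B' * w' a) : DiffBound l w' B' u :=
  fun a i hi => (hu a i hi).trans (h a (by omega))

theorem DiffBound.sum {ι : Type*} {l : ℕ} {w : ℕ → ℝ} {B : ι → ℝ} {u : ι → ℕ → ℝ} (s : Finset ι)
    (c : ι → ℝ) (hu : ∀ i ∈ s, DiffBound l w (B i) (u i)) :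
    DiffBound l w (∑ i ∈ s, |c i| * B i) (∑ i ∈ s, c i • u i) := by
  intro a j hj
  rw [fwdDiff_iter_finsetSum, Finset.sum_apply, Finset.sum_mul]
  refine (Finset.abs_sum_le_sum_abs _ _).trans (Finset.sum_le_sum fun i hi => ?_)
  rw [fwdDiff_iter_const_smul, Pi.smul_apply, smul_eq_mul, abs_mul, mul_assoc]
  exact mul_le_mul_of_nonneg_left (hu i hi a j hj) (abs_nonneg _)

theorem diffBound_one {l : ℕ} {w : ℕ → ℝ} (hw0 : ∀ a, 0 ≤ w a) (hw1 : w 0 = 1) :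
    DiffBound l w 1 1 := by
  intro a i _
  rcases a with _ | a
  · simp [hw1]
  · have h1 : fwdDiff 1 (1 : ℕ → ℝ) = 0 := by funext j; simp [fwdDiff]
    have : (fwdDiff 1)^[a + 1] (1 : ℕ → ℝ) = 0 := by
      rw [Function.iterate_succ_apply, h1]
      exact Function.iterate_fixed (by funext j; simp [fwdDiff]) a
    rw [this]
    simpa using hw0 (a + 1)

theorem diffBound_prod {ι : Type*} {l : ℕ} {w : ℕ → ℝ} {B : ℝ} (hB : 0 ≤ B)
    (hw : ∀ a b, w a * w b ≤ w (a + b)) (hw0 : ∀ a, 0 ≤ w a) (hw1 : w 0 = 1)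
    (s : Finset ι) (u : ι → ℕ → ℝ) (hu : ∀ i ∈ s, DiffBound l w B (u i)) :
    DiffBound l w ((2 ^ l * B) ^ s.card) (∏ i ∈ s, u i) := by
  classical
  induction s using Finset.induction_on with
  | empty => simpa using diffBound_one hw0 hw1
  | insert i s hi ih =>
    rw [Finset.prod_insert hi, Finset.card_insert_of_notMem hi, pow_succ']
    refine (DiffBound.mul hw hw0 hB (by positivity) (hu i (by simp))
      (ih fun j hj => hu j (by simp [hj]))).mono fun a _ => le_of_eq ?_
    ring

/-- Restriction to the sample points `x + i • h` turns differences in `ℝⁿ` along `h` into unit-step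
differences of a sequence, where the product estimates apply. -/
theorem fwdDiff_iter_eq_seq {M : Type*} [AddCommMonoid M] (h : M) (f : M → ℝ) (x : M) (a : ℕ) :
    (fwdDiff h)^[a] f x = (fwdDiff 1)^[a] (fun i : ℕ => f (x + i • h)) 0 := by
  simp [fwdDiff_iter_eq_sum_shift]

theorem abs_fwdDiff_iter_le_of_bound (u : ℕ → ℝ) (B : ℝ) (l : ℕ) (hu : ∀ i ≤ l, |u i| ≤ B) :
    ∀ a i : ℕ, i + a ≤ l → |(fwdDiff 1)^[a] u i| ≤ 2 ^ a * B := by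
  intro a
  induction a with
  | zero => intro i hi; simpa using hu i hi
  | succ a ih =>
    intro i hi
    rw [Function.iterate_succ_apply']
    calc _ ≤ |(fwdDiff 1)^[a] u (i + 1)| + |(fwdDiff 1)^[a] u i| := abs_sub _ _
      _ ≤ 2 ^ a * B + 2 ^ a * B := add_le_add (ih _ (by omega)) (ih _ (by omega))
      _ = 2 ^ (a + 1) * B := by ring

/-! ### Truncated powers -/

/-- The truncated power `t₊^q`. -/
noncomputable def truncPow (q : ℕ) (t : ℝ) : ℝ := if 0 ≤ t then t ^ q else 0

theorem diffBound_affine (l : ℕ) {t η θ R : ℝ} (hθ : |η| ≤ θ) (hθ1 : θ ≤ 1) (ht : |t| ≤ R)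
    (hR : 1 ≤ R) :
    DiffBound l (fun a => θ ^ a) (R + l) (fun i => t + i * η) := by
  have hθ0 : 0 ≤ θ := (abs_nonneg _).trans hθ
  intro a i hi
  have h1 : fwdDiff 1 (fun i : ℕ => t + i * η) = fun _ => η := by
    funext j; simp [fwdDiff]; ring
  rcases a with _ | _ | a
  · simp only [Function.iterate_zero, id, pow_zero, mul_one]
    have : |(i : ℝ) * η| ≤ l := by
      rw [abs_mul, Nat.abs_cast]
      calc (i : ℝ) * |η| ≤ l * 1 := by
            gcongr
            · omega
            · exact hθ.trans hθ1
        _ = l := mul_one _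
    exact (abs_add_le _ _).trans (by linarith)
  · simp only [zero_add, Function.iterate_one, h1, pow_one]
    have : 1 ≤ R + l := by linarith [Nat.cast_nonneg (α := ℝ) l]
    nlinarith
  · have : (fwdDiff 1)^[a + 1 + 1] (fun i : ℕ => t + i * η) = 0 := by
      rw [Function.iterate_succ_apply, h1, Function.iterate_succ_apply, fwdDiff_const]
      exact Function.iterate_fixed (by funext j; simp [fwdDiff]) a
    rw [this]
    simp only [Pi.zero_apply, abs_zero]
    have : 0 ≤ R + l := by linarith [Nat.cast_nonneg (α := ℝ) l]
    positivity

theorem diffBound_pow (l q : ℕ) {t η θ R : ℝ} (hθ : |η| ≤ θ) (hθ1 : θ ≤ 1) (ht : |t| ≤ R)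
    (hR : 1 ≤ R) :
    DiffBound l (fun a => θ ^ a) ((2 ^ l * (R + l)) ^ q) (fun i => (t + i * η) ^ q) := by
  have hθ0 : 0 ≤ θ := (abs_nonneg _).trans hθ
  have := diffBound_prod (l := l) (w := fun a => θ ^ a) (B := R + l)
    (by linarith [Nat.cast_nonneg (α := ℝ) l])
    (fun a b => (pow_add θ a b).ge) (fun a => by positivity) (pow_zero θ)
    (Finset.range q) (fun _ i => t + i * η) (fun _ _ => diffBound_affine l hθ hθ1 ht hR)
  simpa [funext_iff, Pi.pow_def] using this

/-- If the sample points stay on one side of the knot, the differences of a truncated power are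
those of a polynomial. -/
theorem diffBound_truncPow_of_sameSide (l q : ℕ) {t η θ R : ℝ} (hθ : |η| ≤ θ) (hθ1 : θ ≤ 1)
    (ht : |t| ≤ R) (hR : 1 ≤ R)
    (hside : (∀ i : ℕ, i ≤ l → 0 ≤ t + i * η) ∨ (∀ i : ℕ, i ≤ l → t + i * η < 0)) :
    DiffBound l (fun a => θ ^ a) ((2 ^ l * (R + l)) ^ q) (fun i => truncPow q (t + i * η)) := by
  have hθ0 : 0 ≤ θ := (abs_nonneg _).trans hθ
  have hcongr : ∀ (u v : ℕ → ℝ), (∀ i ≤ l, u i = v i) → ∀ a i : ℕ, i + a ≤ l →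
      (fwdDiff 1)^[a] u i = (fwdDiff 1)^[a] v i := by
    intro u v h a i hi
    rw [fwdDiff_iter_eq_sum_shift, fwdDiff_iter_eq_sum_shift]
    refine Finset.sum_congr rfl fun j hj => ?_
    rw [h]
    simp at hj ⊢
    omega
  rcases hside with h | h
  · intro a i hi
    rw [hcongr _ (fun i => (t + i * η) ^ q) (fun i hi => by simp [truncPow, h i hi]) a i hi]
    exact diffBound_pow l q hθ hθ1 ht hR a i hi
  · intro a i hi
    rw [hcongr _ (fun i => 0) (fun i hi => by simp [truncPow, not_le.2 (h i hi)]) a i hi]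
    have h0 : (fwdDiff 1)^[a] (fun _ : ℕ => (0 : ℝ)) = fun _ => 0 :=
      Function.iterate_fixed (by funext j; simp [fwdDiff]) a
    rw [h0]
    have : 0 ≤ R + l := by linarith [Nat.cast_nonneg (α := ℝ) l]
    simp only [abs_zero]
    positivity

/-- If the samples lie on one side of the knot, the function is a polynomial there. If they straddle
it, every positive sample is within `l θ` of the knot, so all values are at most `(l θ) ^ q` and no
cancellation is needed; this is why the order of decay is capped at `q`. -/
theorem diffBound_truncPow (l q : ℕ) {t η θ R : ℝ} (hθ : |η| ≤ θ) (hθ1 : θ ≤ 1)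
    (ht : |t| ≤ R) (hR : 1 ≤ R) :
    DiffBound l (fun a => θ ^ min a q) ((2 ^ l * (R + l)) ^ q + 2 ^ l * l ^ q)
      (fun i => truncPow q (t + i * η)) := by
  have hθ0 : 0 ≤ θ := (abs_nonneg _).trans hθ
  have hRl : 0 ≤ R + l := by linarith [Nat.cast_nonneg (α := ℝ) l]
  by_cases hside :
      (∀ i : ℕ, i ≤ l → 0 ≤ t + i * η) ∨ (∀ i : ℕ, i ≤ l → t + i * η < 0)
  · refine (diffBound_truncPow_of_sameSide l q hθ hθ1 ht hR hside).mono fun a ha => ?_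
    refine mul_le_mul ?_ (pow_le_pow_of_le_one hθ0 hθ1 (min_le_left _ _)) (by positivity)
      (by positivity)
    have : 0 ≤ (2 : ℝ) ^ l * l ^ q := by positivity
    linarith
  · push Not at hside
    obtain ⟨⟨i₀, hi₀, h₀⟩, ⟨i₁, hi₁, h₁⟩⟩ := hside
    have hsmall : ∀ i ≤ l, |truncPow q (t + i * η)| ≤ (l * θ) ^ q := by
      intro i hi
      unfold truncPow
      split_ifs with h
      · rw [abs_of_nonneg (by positivity)]
        refine pow_le_pow_left₀ h ?_ q
        have : t + i * η ≤ |((i : ℝ) - i₀) * η| := by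
          refine le_trans ?_ (le_abs_self _)
          linarith
        refine this.trans ?_
        rw [abs_mul]
        refine mul_le_mul ?_ hθ (abs_nonneg _) (Nat.cast_nonneg _)
        have a1 : (i : ℝ) ≤ l := by exact_mod_cast hi
        have a2 : (i₀ : ℝ) ≤ l := by exact_mod_cast hi₀
        rw [abs_le]
        constructor <;> linarith [Nat.cast_nonneg (α := ℝ) i, Nat.cast_nonneg (α := ℝ) i₀]
      · simp only [abs_zero]; positivity
    intro a i hi
    refine (abs_fwdDiff_iter_le_of_bound _ _ l hsmall a i hi).trans ?_
    calc (2 : ℝ) ^ a * (l * θ) ^ q = 2 ^ a * l ^ q * θ ^ q := by rw [mul_pow]; ring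
      _ ≤ (2 ^ l * l ^ q) * θ ^ min a q := by
        refine mul_le_mul ?_ (pow_le_pow_of_le_one hθ0 hθ1 (min_le_right _ _)) (by positivity)
          (by positivity)
        gcongr
        · norm_num
        · omega
      _ ≤ _ := by
        gcongr
        have : 0 ≤ (2 ^ l * (R + l)) ^ q := by positivity
        linarith

/-! ### The B-spline -/

theorem bSpline_eq_truncPow (l : ℕ) (t : ℝ) :
    bSpline l t = ∑ i ∈ Finset.range (l + 1),
      (((l - 1).factorial : ℝ)⁻¹ * ((-1 : ℝ) ^ i * (l.choose i : ℝ))) *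
        truncPow (l - 1) (t - i) := by
  simp only [bSpline, truncPow, Finset.mul_sum, sub_nonneg]
  refine Finset.sum_congr rfl fun i _ => ?_
  ring

theorem bSpline_of_neg (l : ℕ) {t : ℝ} (ht : t < 0) : bSpline l t = 0 := by
  rw [bSpline_eq_truncPow]
  refine Finset.sum_eq_zero fun i _ => ?_
  have : ¬ 0 ≤ t - i := by
    have := Nat.cast_nonneg (α := ℝ) i
    linarith
  simp [truncPow, this]

/-- Beyond the last knot every truncation is inactive, and what remains is an `l`-th difference of a
polynomial of degree `l - 1`. -/
theorem bSpline_of_ge {l : ℕ} (hl : 0 < l) {t : ℝ} (ht : l ≤ t) : bSpline l t = 0 := by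
  have h0 : (fwdDiff (-1 : ℝ))^[l] (fun x : ℝ => x ^ (l - 1)) t = 0 := by
    rw [fwdDiff_iter_eq_seq]
    have h1 := fwdDiff_iter_pow_eq_zero_of_lt (R := ℝ) (j := l - 1) (n := l) (by omega)
    have h2 := congrFun h1 (-t)
    rw [fwdDiff_iter_eq_seq] at h2
    have : (fun i : ℕ => (t + i • (-1 : ℝ)) ^ (l - 1)) =
        ((-1 : ℝ) ^ (l - 1)) • (fun i : ℕ => (-t + i • (1 : ℝ)) ^ (l - 1)) := by
      funext i
      simp only [Pi.smul_apply, smul_eq_mul, ← mul_pow]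
      congr 1
      simp
      ring
    rw [this, fwdDiff_iter_const_smul, Pi.smul_apply, h2]
    simp
  rw [fwdDiff_iter_eq_sum_shift] at h0
  have h3 : bSpline l t = ((l - 1).factorial : ℝ)⁻¹ * ((-1) ^ l *
      ∑ i ∈ Finset.range (l + 1), ((-1 : ℤ) ^ (l - i) * (l.choose i : ℤ)) •
        (t + i • (-1 : ℝ)) ^ (l - 1)) := by
    rw [bSpline]
    congr 1
    rw [Finset.mul_sum]
    refine Finset.sum_congr rfl fun i hi => ?_
    have hil : i ≤ l := by simp at hi; omega
    have : (i : ℝ) ≤ t := le_trans (by exact_mod_cast hil) ht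
    rw [if_pos this]
    have hs : (-1 : ℝ) ^ l * (-1) ^ (l - i) = (-1) ^ i := by
      rw [← pow_add, show l + (l - i) = i + 2 * (l - i) by omega, pow_add, pow_mul]
      simp
    rw [zsmul_eq_mul]
    push_cast
    rw [← hs]
    simp only [nsmul_eq_mul, mul_neg, mul_one, ← sub_eq_add_neg]
    ring
  rw [h3, h0]
  simp

/-- All knots are integers, so samples within one interval `[z, z + 1)` lie on one side of each
knot, and the decay is not capped at order `l - 1`. -/
theorem diffBound_bSpline (l : ℕ) (R : ℝ) (hR : 0 ≤ R) : ∃ B : ℝ, 0 ≤ B ∧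
    ∀ t η θ : ℝ, |η| ≤ θ → θ ≤ 1 → |t| ≤ R →
      DiffBound l (fun a => θ ^ min a (l - 1)) B (fun i => bSpline l (t + i * η)) ∧
      ((∃ z : ℤ, ∀ i : ℕ, i ≤ l → (z : ℝ) ≤ t + i * η ∧ t + i * η < z + 1) →
        DiffBound l (fun a => θ ^ a) B (fun i => bSpline l (t + i * η))) := by
  set B₀ : ℝ := (2 ^ l * ((R + l + 1) + l)) ^ (l - 1) + 2 ^ l * l ^ (l - 1) with hB₀
  set c : ℕ → ℝ := fun s => ((l - 1).factorial : ℝ)⁻¹ * ((-1 : ℝ) ^ s * (l.choose s : ℝ)) with hc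
  have hB₀0 : 0 ≤ B₀ := by positivity
  refine ⟨∑ s ∈ Finset.range (l + 1), |c s| * B₀, by positivity, ?_⟩
  intro t η θ hη hθ ht
  have hθ0 : 0 ≤ θ := (abs_nonneg _).trans hη
  have hfun : (fun i : ℕ => bSpline l (t + i * η)) = ∑ s ∈ Finset.range (l + 1),
      c s • (fun i : ℕ => truncPow (l - 1) ((t - s) + i * η)) := by
    funext i
    rw [bSpline_eq_truncPow, Finset.sum_apply]
    refine Finset.sum_congr rfl fun s _ => ?_
    simp only [Pi.smul_apply, smul_eq_mul, hc]
    congr 2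
    ring
  have hts : ∀ s ∈ Finset.range (l + 1), |t - s| ≤ R + l + 1 := by
    intro s hs
    have : (s : ℝ) ≤ l := by
      have : s ≤ l := by simp at hs; omega
      exact_mod_cast this
    calc |t - s| ≤ |t| + |(s : ℝ)| := abs_sub _ _
      _ ≤ R + l + 1 := by rw [Nat.abs_cast]; linarith
  have h1 : 1 ≤ R + l + 1 := by linarith [Nat.cast_nonneg (α := ℝ) l]
  rw [hfun]
  refine ⟨DiffBound.sum _ _ fun s hs => diffBound_truncPow l (l - 1) hη hθ (hts s hs) h1, ?_⟩
  rintro ⟨z, hz⟩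
  refine DiffBound.sum _ _ fun s hs => ?_
  have hside : (∀ i : ℕ, i ≤ l → 0 ≤ (t - s) + i * η) ∨ (∀ i : ℕ, i ≤ l → (t - s) + i * η < 0) := by
    rcases le_or_gt (s : ℤ) z with h | h
    · left
      intro i hi
      have : (s : ℝ) ≤ z := by exact_mod_cast h
      linarith [(hz i hi).1]
    · right
      intro i hi
      have : (z : ℝ) + 1 ≤ s := by exact_mod_cast h
      linarith [(hz i hi).2]
  refine (diffBound_truncPow_of_sameSide l (l - 1) hη hθ (hts s hs) h1 hside).mono fun a _ => ?_
  refine mul_le_mul_of_nonneg_right ?_ (by positivity)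
  have : 0 ≤ (2 : ℝ) ^ l * l ^ (l - 1) := by positivity
  linarith

theorem bSplineN_eq (n l k : ℕ) (m : Fin n → ℤ) (x : Fin n → ℝ) :
    bSplineN l k m x = ∏ q, bSpline l (2 ^ k * x q - m q) := by
  unfold bSplineN
  refine Finset.prod_congr rfl fun q _ => ?_
  congr 1
  field_simp

/-- Difference bounds for a tensor product B-spline; the second one applies when the sample points
stay in one cell. -/
theorem abs_fwdDiff_bSplineN_le (n l : ℕ) (R : ℝ) (hR : 0 ≤ R) : ∃ B : ℝ, 0 ≤ B ∧
    ∀ (j : ℕ) (m : Fin n → ℤ) (x h : Fin n → ℝ) (θ : ℝ), 0 ≤ θ → θ ≤ 1 →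
      (∀ q, |2 ^ j * h q| ≤ θ) → (∀ q, |2 ^ j * x q - m q| ≤ R) →
      |(fwdDiff h)^[l] (bSplineN l j m) x| ≤ B * θ ^ (l - 1) ∧
      ((∀ q, ∃ z : ℤ, ∀ i : ℕ, i ≤ l →
          (z : ℝ) ≤ 2 ^ j * (x q + i * h q) ∧ 2 ^ j * (x q + i * h q) < z + 1) →
        |(fwdDiff h)^[l] (bSplineN l j m) x| ≤ B * θ ^ l) := by
  obtain ⟨B, hB, H⟩ := diffBound_bSpline l R hR
  refine ⟨(2 ^ l * B) ^ n, by positivity, ?_⟩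
  intro j m x h θ hθ0 hθ1 hh hx
  have hfun : (fun i : ℕ => bSplineN l j m (x + i • h)) =
      ∏ q, (fun i : ℕ => bSpline l ((2 ^ j * x q - m q) + i * (2 ^ j * h q))) := by
    funext i
    rw [bSplineN_eq, Finset.prod_apply]
    refine Finset.prod_congr rfl fun q _ => ?_
    congr 1
    simp
    ring
  rw [fwdDiff_iter_eq_seq, hfun]
  constructor
  · have := diffBound_prod (l := l) (w := fun a => θ ^ min a (l - 1)) hB
      (fun a b => by
        rw [← pow_add]
        exact pow_le_pow_of_le_one hθ0 hθ1 (by omega))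
      (fun a => by positivity) (by simp) Finset.univ
      (fun q => (fun i : ℕ => bSpline l ((2 ^ j * x q - m q) + i * (2 ^ j * h q))))
      (fun q _ => (H _ _ θ (hh q) hθ1 (hx q)).1) l 0 (by omega)
    simpa using this
  · intro hz
    have := diffBound_prod (l := l) (w := fun a => θ ^ a) hB
      (fun a b => (pow_add θ a b).ge)
      (fun a => by positivity) (by simp) Finset.univ
      (fun q => (fun i : ℕ => bSpline l ((2 ^ j * x q - m q) + i * (2 ^ j * h q))))
      (fun q _ => (H _ _ θ (hh q) hθ1 (hx q)).2 ?_) l 0 (by omega)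
    · simpa using this
    · obtain ⟨z, hz⟩ := hz q
      refine ⟨z - m q, fun i hi => ?_⟩
      have := hz i hi
      push_cast
      constructor <;> linarith [this.1, this.2]

/-- The offsets `e` with `|e|_∞ ≤ L`. -/
noncomputable def offsets (n L : ℕ) : Finset (Fin n → ℤ) := Fintype.piFinset fun _ => Finset.Icc (-(L : ℤ)) L

theorem mem_offsets {n L : ℕ} {e : Fin n → ℤ} : e ∈ offsets n L ↔ ∀ i, |e i| ≤ L := by
  simp [offsets, abs_le]

theorem bSplineN_eq_zero {n l : ℕ} (hl : 0 < l) {k : ℕ} {m : Fin n → ℤ} {x : Fin n → ℝ} (q : Fin n)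
    (h : 2 ^ k * x q < m q ∨ (m q : ℝ) + l ≤ 2 ^ k * x q) : bSplineN l k m x = 0 := by
  rw [bSplineN_eq]
  refine Finset.prod_eq_zero (Finset.mem_univ q) ?_
  rcases h with h | h
  · exact bSpline_of_neg l (by linarith)
  · exact bSpline_of_ge hl (by linarith)

/-- Near the cell with index `m`, a spline is a finite sum. -/
theorem spline_eq_sum {n l : ℕ} (hl : 0 < l) (j : ℕ) (β : (Fin n → ℤ) → ℝ) (m : Fin n → ℤ)
    (x : Fin n → ℝ) (hx : ∀ q, (m q : ℝ) - l ≤ 2 ^ j * x q ∧ 2 ^ j * x q ≤ m q + 1 + l) :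
    ∑ᶠ m', β m' * bSplineN l j m' x =
      ∑ e ∈ offsets n (2 * l), β (m + e) * bSplineN l j (m + e) x := by
  rw [← finsum_comp_equiv (Equiv.addLeft m)]
  simp only [Equiv.coe_addLeft]
  refine finsum_eq_sum_of_support_subset _ fun e he => ?_
  simp only [Finset.mem_coe, mem_offsets]
  by_contra hcon
  push Not at hcon
  obtain ⟨q, hq⟩ := hcon
  apply he
  have hl1 : (1 : ℝ) ≤ l := by exact_mod_cast hl
  have hz : bSplineN l j (m + e) x = 0 := by
    refine bSplineN_eq_zero hl q ?_
    rcases lt_abs.1 hq with h | h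
    · left
      have h' : (2 * l : ℝ) + 1 ≤ e q := by exact_mod_cast h
      have := (hx q).2
      simp only [Pi.add_apply]
      push_cast
      linarith
    · right
      have h' : (2 * l : ℝ) + 1 ≤ -e q := by exact_mod_cast h
      have := (hx q).1
      simp only [Pi.add_apply]
      push_cast
      linarith
  simp [hz]

theorem abs_fwdDiff_spline_le (n l : ℕ) (hl : 0 < l) : ∃ B : ℝ, 0 ≤ B ∧
    ∀ (j : ℕ) (β : (Fin n → ℤ) → ℝ) (m : Fin n → ℤ) (x h : Fin n → ℝ) (θ : ℝ), 0 ≤ θ → θ ≤ 1 →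
      (∀ q, |2 ^ j * h q| ≤ θ) → (∀ q, (m q : ℝ) ≤ 2 ^ j * x q ∧ 2 ^ j * x q ≤ m q + 1) →
      |(fwdDiff h)^[l] (fun y => ∑ᶠ m', β m' * bSplineN l j m' y) x| ≤
        B * θ ^ (l - 1) * ∑ e ∈ offsets n (2 * l), |β (m + e)| ∧
      ((∀ q, ∃ z : ℤ, ∀ i : ℕ, i ≤ l →
          (z : ℝ) ≤ 2 ^ j * (x q + i * h q) ∧ 2 ^ j * (x q + i * h q) < z + 1) →
        |(fwdDiff h)^[l] (fun y => ∑ᶠ m', β m' * bSplineN l j m' y) x| ≤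
          B * θ ^ l * ∑ e ∈ offsets n (2 * l), |β (m + e)|) := by
  -- The radius adds the offset of a relevant coefficient, at most `2 * l`, to the distance of `2 ^
  -- j * x q` from `m q`, at most `1`.
  obtain ⟨B, hB, H⟩ := abs_fwdDiff_bSplineN_le n l (2 * l + 1) (by positivity)
  refine ⟨B, hB, ?_⟩
  intro j β m x h θ hθ0 hθ1 hh hx
  have hexp : (fwdDiff h)^[l] (fun y => ∑ᶠ m', β m' * bSplineN l j m' y) x =
      ∑ e ∈ offsets n (2 * l), β (m + e) * (fwdDiff h)^[l] (bSplineN l j (m + e)) x := by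
    have : (fwdDiff h)^[l] (fun y => ∑ᶠ m', β m' * bSplineN l j m' y) x =
        (fwdDiff h)^[l] (∑ e ∈ offsets n (2 * l), β (m + e) • bSplineN l j (m + e)) x := by
      rw [fwdDiff_iter_eq_sum_shift, fwdDiff_iter_eq_sum_shift]
      refine Finset.sum_congr rfl fun i hi => ?_
      have hil : (i : ℝ) ≤ l := by
        have : i ≤ l := by simp at hi; omega
        exact_mod_cast this
      rw [spline_eq_sum hl j β m]
      · simp [Finset.sum_apply]
      · intro q
        have hb : |(i : ℝ) * (2 ^ j * h q)| ≤ l := by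
          rw [abs_mul, Nat.abs_cast]
          calc (i : ℝ) * |2 ^ j * h q| ≤ l * 1 := by
                gcongr
                exact (hh q).trans hθ1
            _ = l := mul_one _
        rw [abs_le] at hb
        have e1 : (2 : ℝ) ^ j * (x + i • h) q = 2 ^ j * x q + i * (2 ^ j * h q) := by
          simp; ring
        rw [e1]
        constructor <;> linarith [hx q, hb.1, hb.2]
    rw [this, fwdDiff_iter_finsetSum, Finset.sum_apply]
    refine Finset.sum_congr rfl fun e _ => ?_
    rw [fwdDiff_iter_const_smul, Pi.smul_apply, smul_eq_mul]
  have hR : ∀ e ∈ offsets n (2 * l), ∀ q, |2 ^ j * x q - ((m + e) q : ℤ)| ≤ 2 * (l : ℝ) + 1 := by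
    intro e he q
    have h1 : |(e q : ℝ)| ≤ 2 * l := by exact_mod_cast mem_offsets.1 he q
    have := hx q
    rw [abs_le] at h1 ⊢
    simp only [Pi.add_apply]
    push_cast
    constructor <;> linarith [h1.1, h1.2]
  have hsum : ∀ D : ℝ, (∀ e ∈ offsets n (2 * l),
      |(fwdDiff h)^[l] (bSplineN l j (m + e)) x| ≤ D) →
      |(fwdDiff h)^[l] (fun y => ∑ᶠ m', β m' * bSplineN l j m' y) x| ≤
        D * ∑ e ∈ offsets n (2 * l), |β (m + e)| := by
    intro D hD
    rw [hexp, Finset.mul_sum]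
    refine (Finset.abs_sum_le_sum_abs _ _).trans (Finset.sum_le_sum fun e he => ?_)
    rw [abs_mul, mul_comm]
    exact mul_le_mul_of_nonneg_right (hD e he) (abs_nonneg _)
  exact ⟨hsum _ fun e he => (H j (m + e) x h θ hθ0 hθ1 hh (hR e he)).1,
    fun hz => hsum _ fun e he => (H j (m + e) x h θ hθ0 hθ1 hh (hR e he)).2 hz⟩

/-! ### Refinement -/

theorem truncPow_two_mul (q : ℕ) (t : ℝ) : truncPow q (2 * t) = 2 ^ q * truncPow q t := by
  unfold truncPow
  have : 0 ≤ 2 * t ↔ 0 ≤ t := by constructor <;> intro h <;> linarith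
  simp only [this]
  split_ifs
  · ring
  · simp

/-- Two-scale relation. With `E` the shift by half a unit, it is `(1 + E)^l (1 - E)^l = (1 - E²)^l`
applied to the truncated power, together with the homogeneity of the latter. -/
theorem bSpline_refine (l : ℕ) (t : ℝ) :
    bSpline l t = ∑ i ∈ Finset.range (l + 1),
      ((2 : ℝ) ^ (l - 1))⁻¹ * (l.choose i : ℝ) * bSpline l (2 * t - i) := by
  obtain ⟨q, hq⟩ : ∃ q, q = l - 1 := ⟨_, rfl⟩
  set E := fwdDiff_aux.shiftₗ ℝ ℝ (-1 / 2) with hE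
  have hpow : ∀ a : ℕ, (E ^ a) (truncPow q) t = truncPow q (t - a / 2) := by
    intro a
    rw [hE, fwdDiff_aux.shiftₗ_pow_apply]
    congr 1
    simp
    ring
  have h1 : (1 + E) ^ l * (1 - E) ^ l = (1 - E ^ 2) ^ l := by
    have : Commute (1 + E) (1 - E) := by
      simp only [commute_iff_eq]; noncomm_ring
    rw [← this.mul_pow]
    congr 1
    noncomm_ring
  have e1 : (1 + E) ^ l = ∑ i ∈ Finset.range (l + 1), (l.choose i) • E ^ i := by
    rw [add_comm, (Commute.one_right E).add_pow]
    simp [nsmul_eq_mul, (Nat.cast_commute _ _).eq]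
  have e2 : ∀ F : Module.End ℤ (ℝ → ℝ), (1 - F) ^ l =
      ∑ i ∈ Finset.range (l + 1), ((-1 : ℤ) ^ i * l.choose i) • F ^ i := by
    intro F
    rw [sub_eq_add_neg, add_comm, (Commute.one_right (-F)).add_pow]
    refine Finset.sum_congr rfl fun i _ => ?_
    rw [neg_pow, one_pow, mul_one, zsmul_eq_mul]
    push_cast
    rw [mul_assoc, mul_assoc, (Nat.cast_commute (l.choose i) (F ^ i)).eq]
  have h2 := congrArg (fun F : Module.End ℤ (ℝ → ℝ) => F (truncPow q) t) h1
  simp only [e1, e2, Finset.sum_mul_sum, LinearMap.sum_apply, Finset.sum_apply] at h2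
  have hl2 : ∀ i s : ℕ, (((l.choose i) • E ^ i) * (((-1 : ℤ) ^ s * l.choose s) • E ^ s))
      (truncPow q) t = (l.choose i : ℝ) * ((-1) ^ s * l.choose s) * truncPow q (t - (i + s) / 2) := by
    intro i s
    have hE2 : (E ^ i) ((E ^ s) (truncPow q)) t = truncPow q (t - ((i + s : ℕ) : ℝ) / 2) := by
      rw [← hpow, pow_add]
      rfl
    simp only [Module.End.mul_apply, LinearMap.smul_apply, map_smul, Pi.smul_apply, hE2]
    simp [zsmul_eq_mul, nsmul_eq_mul]
    ring
  have hr2 : ∀ i : ℕ, (((-1 : ℤ) ^ i * l.choose i) • (E ^ 2) ^ i) (truncPow q) t =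
      ((-1) ^ i * l.choose i) * truncPow q (t - i) := by
    intro i
    rw [← pow_mul]
    simp only [LinearMap.smul_apply, Pi.smul_apply, hpow]
    simp [zsmul_eq_mul]
  simp only [hl2, hr2] at h2
  have hlhs : bSpline l t = (q.factorial : ℝ)⁻¹ * ∑ i ∈ Finset.range (l + 1),
      ((-1) ^ i * l.choose i) * truncPow q (t - i) := by
    rw [bSpline_eq_truncPow, Finset.mul_sum, ← hq]
    exact Finset.sum_congr rfl fun i _ => by ring
  rw [hlhs, ← h2, Finset.mul_sum]
  refine Finset.sum_congr rfl fun i _ => ?_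
  rw [bSpline_eq_truncPow, Finset.mul_sum, Finset.mul_sum, ← hq]
  refine Finset.sum_congr rfl fun s _ => ?_
  have : truncPow q (2 * t - i - s) = 2 ^ q * truncPow q (t - (i + s) / 2) := by
    rw [← truncPow_two_mul]
    congr 1
    ring
  rw [this]
  have h2q : (2 : ℝ) ^ q ≠ 0 := by positivity
  field_simp

/-- Tensorize the two-scale relation: `N_{j,m}` is a combination of `N_{j+1, 2m+i}` with `0 ≤ i_q ≤
l`. `Function.extend` places `β m` at index `2m + i` and zero elsewhere; local finiteness of the
supports justifies interchanging the sums. -/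
theorem splineSpace_mono_succ {n l : ℕ} (hl : 0 < l) (j : ℕ) :
    splineSpace n l j ⊆ splineSpace n l (j + 1) := by
  classical
  rintro S ⟨β, hS⟩
  set I : Finset (Fin n → ℕ) := Fintype.piFinset fun _ => Finset.range (l + 1) with hI
  set c : (Fin n → ℕ) → ℝ := fun i => ∏ q, (((2 : ℝ) ^ (l - 1))⁻¹ * (l.choose (i q) : ℝ)) with hc
  let emb : (Fin n → ℕ) → (Fin n → ℤ) → (Fin n → ℤ) := fun i m q => 2 * m q + i q
  have hemb : ∀ i, Function.Injective (emb i) := by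
    intro i m m' h
    funext q
    have := congrFun h q
    simp only [emb] at this
    omega
  let β' : (Fin n → ℤ) → ℝ := fun m' => ∑ i ∈ I, c i * Function.extend (emb i) β 0 m'
  refine ⟨β', fun x => ?_⟩
  have hN : ∀ m, bSplineN l j m x = ∑ i ∈ I, c i * bSplineN l (j + 1) (emb i m) x := by
    intro m
    simp only [bSplineN_eq]
    have : ∀ q, bSpline l (2 ^ j * x q - m q) = ∑ i ∈ Finset.range (l + 1),
        (((2 : ℝ) ^ (l - 1))⁻¹ * (l.choose i : ℝ)) *
          bSpline l (2 ^ (j + 1) * x q - ((2 * m q + i : ℤ))) := by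
      intro q
      rw [bSpline_refine]
      refine Finset.sum_congr rfl fun i _ => ?_
      congr 2
      push_cast
      ring
    simp only [this]
    rw [Finset.prod_univ_sum]
    refine Finset.sum_congr rfl fun i _ => ?_
    rw [Finset.prod_mul_distrib]
  have hfin : ∀ (k : ℕ) (g : (Fin n → ℤ) → ℝ),
      (Function.support fun m => g m * bSplineN l k m x).Finite := by
    intro k g
    have hsub : (Function.support fun m => g m * bSplineN l k m x) ⊆
        Set.Icc (fun q => ⌊2 ^ k * x q⌋ - l) (fun q => ⌊2 ^ k * x q⌋ + l) := by
      intro m hm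
      by_contra hcon
      apply hm
      have : ∃ q, m q < ⌊2 ^ k * x q⌋ - l ∨ ⌊2 ^ k * x q⌋ + l < m q := by
        by_contra hcon2
        push Not at hcon2
        exact hcon ⟨fun q => (hcon2 q).1, fun q => (hcon2 q).2⟩
      obtain ⟨q, hq⟩ := this
      have hz : bSplineN l k m x = 0 := by
        refine bSplineN_eq_zero hl q ?_
        have f1 := Int.floor_le (2 ^ k * x q)
        have f2 := Int.lt_floor_add_one (2 ^ k * x q)
        rcases hq with h | h
        · right
          have : (m q : ℝ) < ⌊2 ^ k * x q⌋ - l := by exact_mod_cast h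
          linarith
        · left
          have : (⌊2 ^ k * x q⌋ : ℝ) + l < m q := by exact_mod_cast h
          have h3 : (⌊2 ^ k * x q⌋ : ℝ) + l + 1 ≤ m q := by exact_mod_cast h
          linarith [Nat.cast_nonneg (α := ℝ) l]
      simp [hz]
    exact (Set.finite_Icc _ _).subset hsub
  rw [hS x]
  calc ∑ᶠ m, β m * bSplineN l j m x
      = ∑ᶠ m, ∑ i ∈ I, c i * (β m * bSplineN l (j + 1) (emb i m) x) := by
        refine finsum_congr fun m => ?_
        rw [hN, Finset.mul_sum]
        exact Finset.sum_congr rfl fun i _ => by ring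
    _ = ∑ i ∈ I, ∑ᶠ m, c i * (β m * bSplineN l (j + 1) (emb i m) x) := by
        refine finsum_sum_comm _ _ fun i _ => ?_
        have h0 := (hfin (j + 1) (fun m' => c i * Function.extend (emb i) β 0 m')).preimage
          ((hemb i).injOn (s := (emb i) ⁻¹' _))
        refine h0.subset fun m hm => ?_
        simp only [Set.mem_preimage, Function.mem_support, (hemb i).extend_apply] at hm ⊢
        rwa [mul_assoc]
    _ = ∑ i ∈ I, ∑ᶠ m', c i * (Function.extend (emb i) β 0 m' * bSplineN l (j + 1) m' x) := by
        refine Finset.sum_congr rfl fun i _ => ?_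
        have h1 := finsum_mem_range (hemb i)
          (f := fun m' => c i * (Function.extend (emb i) β 0 m' * bSplineN l (j + 1) m' x))
        simp only [(hemb i).extend_apply] at h1
        rw [← h1, ← finsum_mem_univ (fun m' =>
          c i * (Function.extend (emb i) β 0 m' * bSplineN l (j + 1) m' x))]
        refine finsum_mem_inter_support_eq' _ _ _ fun m' hm' => ⟨fun _ => trivial, fun _ => ?_⟩
        by_contra hcon
        apply hm'
        beta_reduce
        rw [Function.extend_apply' _ _ _ (by simpa using hcon)]
        simp
    _ = ∑ᶠ m', ∑ i ∈ I, c i * (Function.extend (emb i) β 0 m' * bSplineN l (j + 1) m' x) := by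
        refine (finsum_sum_comm _ _ fun i _ => ?_).symm
        refine (hfin (j + 1) (fun m' => c i * Function.extend (emb i) β 0 m')).subset
          fun m hm => ?_
        simp only [Function.mem_support] at hm ⊢
        rwa [mul_assoc]
    _ = ∑ᶠ m', β' m' * bSplineN l (j + 1) m' x := by
        refine finsum_congr fun m' => ?_
        simp only [β', Finset.sum_mul]
        exact Finset.sum_congr rfl fun i _ => by ring

/-! ### Polynomial pieces of splines and stability of the B-spline basis -/

/-- The polynomial that coincides with `N^{l-1}(· + i)` on `[0, 1)`. -/
noncomputable def cellPoly (l i : ℕ) (t : ℝ) : ℝ :=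
  ∑ a ∈ Finset.range (i + 1),
    (((l - 1).factorial : ℝ)⁻¹ * ((-1 : ℝ) ^ (i - a) * (l.choose (i - a) : ℝ))) *
      (t + a) ^ (l - 1)

theorem bSpline_add_eq_cellPoly {l i : ℕ} (hi : i < l) {t : ℝ} (h0 : 0 ≤ t) (h1 : t < 1) :
    bSpline l (t + i) = cellPoly l i t := by
  rw [bSpline_eq_truncPow, cellPoly]
  rw [← Finset.sum_subset (s₁ := Finset.range (i + 1)) (Finset.range_mono (by omega))]
  · rw [← Finset.sum_flip]
    refine Finset.sum_congr rfl fun a ha => ?_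
    have hai : a ≤ i := by simp at ha; omega
    congr 1
    have e : t + i - ((i - a : ℕ) : ℝ) = t + a := by
      rw [Nat.cast_sub hai]; ring
    rw [e, truncPow, if_pos (by positivity)]
  · intro s _ hs
    have : (i : ℝ) + 1 ≤ s := by
      have : i + 1 ≤ s := by simpa using hs
      exact_mod_cast this
    have hneg : ¬ 0 ≤ t + i - (s : ℝ) := by linarith
    simp [truncPow, hneg]

theorem continuous_cellPoly (l i : ℕ) : Continuous (cellPoly l i) := by
  unfold cellPoly
  fun_prop

/-- The pieces are obtained from the powers `(t + a)^(l-1)`, `a < l`, by a triangular matrix with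
diagonal entry `1 / (l-1)!`. The powers are independent because the coefficients of a vanishing
combination form a Vandermonde system. -/
theorem cellPoly_linearIndependent {l : ℕ} (hl : 0 < l) (b : Fin l → ℝ)
    (hb : ∀ t ∈ Set.Ioo (0 : ℝ) 1, ∑ i, b i * cellPoly l i t = 0) : b = 0 := by
  set c : ℕ → ℝ := fun s => ((l - 1).factorial : ℝ)⁻¹ * ((-1 : ℝ) ^ s * (l.choose s : ℝ)) with hc
  set dd : Fin l → ℝ := fun a => ∑ i : Fin l, if (a : ℕ) ≤ i then b i * c (i - a) else 0 with hdd
  have hcell : ∀ (i : Fin l) (t : ℝ), cellPoly l i t =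
      ∑ a : Fin l, if (a : ℕ) ≤ i then c (i - a) * (t + a) ^ (l - 1) else 0 := by
    intro i t
    rw [Fin.sum_univ_eq_sum_range
      (fun a => if a ≤ (i : ℕ) then c (i - a) * (t + a) ^ (l - 1) else 0) l, cellPoly]
    rw [← Finset.sum_subset (s₁ := Finset.range (i + 1)) (Finset.range_mono i.2)]
    · refine Finset.sum_congr rfl fun a ha => ?_
      rw [if_pos (by simp at ha; omega)]
    · intro a _ ha
      rw [if_neg (by simpa using ha)]
  have hpoly : ∀ t ∈ Set.Ioo (0 : ℝ) 1, ∑ a : Fin l, dd a * (t + (a : ℕ)) ^ (l - 1) = 0 := by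
    intro t ht
    rw [← hb t ht]
    simp only [hcell, hdd, Finset.sum_mul, Finset.mul_sum]
    rw [Finset.sum_comm]
    refine Finset.sum_congr rfl fun i _ => Finset.sum_congr rfl fun a _ => ?_
    split_ifs <;> ring
  have hP : (∑ a : Fin l, Polynomial.C (dd a) *
      (Polynomial.X + Polynomial.C ((a : ℕ) : ℝ)) ^ (l - 1)) = 0 := by
    refine Polynomial.eq_zero_of_infinite_isRoot _
      ((Set.Ioo_infinite (zero_lt_one' ℝ)).mono fun t ht => ?_)
    simp only [Set.mem_ofPred_eq, Polynomial.IsRoot.def, Polynomial.eval_finsetSum,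
      Polynomial.eval_mul, Polynomial.eval_C, Polynomial.eval_pow, Polynomial.eval_add,
      Polynomial.eval_X]
    exact hpoly t ht
  have hd0 : dd = 0 := by
    refine Matrix.eq_zero_of_forall_pow_sum_mul_pow_eq_zero
      (f := fun a : Fin l => ((a : ℕ) : ℝ)) ?_ ?_
    · intro a a' h
      exact Fin.ext (Nat.cast_injective (R := ℝ) h)
    · intro i
      have hcoef := congrArg (fun P => Polynomial.coeff P (l - 1 - i)) hP
      simp only [Polynomial.finsetSum_coeff, Polynomial.coeff_C_mul,
        Polynomial.coeff_X_add_C_pow, Polynomial.coeff_zero] at hcoef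
      have hi : l - 1 - (l - 1 - (i : ℕ)) = i := by omega
      rw [hi] at hcoef
      have hch : ((l - 1).choose (l - 1 - i) : ℝ) ≠ 0 := by
        exact_mod_cast (Nat.choose_pos (by omega)).ne'
      have : (∑ j : Fin l, dd j * ((j : ℕ) : ℝ) ^ (i : ℕ)) * ((l - 1).choose (l - 1 - i) : ℝ) = 0 := by
        rw [← hcoef, Finset.sum_mul]
        exact Finset.sum_congr rfl fun j _ => by ring
      exact (mul_eq_zero.1 this).resolve_right hch
  by_contra hne
  have hs : (Finset.univ.filter fun i => b i ≠ 0).Nonempty := by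
    obtain ⟨i, hi⟩ := Function.ne_iff.1 hne
    exact ⟨i, by simpa using hi⟩
  -- At the largest index with `b i₀ ≠ 0`, triangularity leaves the single term `b i₀ * c 0` in `dd
  -- i₀`.
  set i₀ := (Finset.univ.filter fun i => b i ≠ 0).max' hs with hi₀
  have hb0 : b i₀ ≠ 0 := by simpa using Finset.max'_mem _ hs
  have hd := congrFun hd0 i₀
  simp only [hdd, Pi.zero_apply] at hd
  rw [Finset.sum_eq_single i₀] at hd
  · have hc0 : c 0 ≠ 0 := by
      simp only [hc, pow_zero, Nat.choose_zero_right, Nat.cast_one, mul_one]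
      exact inv_ne_zero (by exact_mod_cast (Nat.factorial_pos _).ne')
    simp [hb0, hc0] at hd
  · intro i _ hi
    split_ifs with h
    · have : i₀ < i := lt_of_le_of_ne h (Ne.symm hi)
      have hbi : b i = 0 := by
        by_contra hbi
        exact absurd (Finset.le_max' _ i (by simpa using hbi)) (not_le.2 this)
      simp [hbi]
    · rfl
  · simp

/-- The polynomial piece of a spline on a cell with coefficients `b`. -/
noncomputable def cellTensor {n : ℕ} (l : ℕ) (b : (Fin n → Fin l) → ℝ) (y : Fin n → ℝ) : ℝ :=
  ∑ i : Fin n → Fin l, b i * ∏ q, cellPoly l (i q) (y q)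

/-- Freeze all variables but the first and use the one-dimensional case, then the induction
hypothesis. -/
theorem cellTensor_linearIndependent {l : ℕ} (hl : 0 < l) : ∀ (n : ℕ) (b : (Fin n → Fin l) → ℝ),
    (∀ y : Fin n → ℝ, (∀ q, y q ∈ Set.Ioo (0 : ℝ) 1) → cellTensor l b y = 0) → b = 0 := by
  intro n
  induction n with
  | zero =>
    intro b hb
    have := hb 0 (fun q => q.elim0)
    funext i
    rw [cellTensor, Fintype.sum_subsingleton _ i] at this
    simpa using this
  | succ n ih =>
    intro b hb
    have key : ∀ i₀ : Fin l, (fun i : Fin n → Fin l => b (Fin.cons i₀ i)) = 0 := by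
      intro i₀
      refine ih _ fun y hy => ?_
      have h1 : (fun i₀ : Fin l => cellTensor l (fun i : Fin n → Fin l => b (Fin.cons i₀ i)) y) = 0 := by
        refine cellPoly_linearIndependent hl _ fun t ht => ?_
        rw [← hb (Fin.cons t y) (Fin.cases (by simpa using ht) (by simpa using hy))]
        rw [cellTensor, ← (Fin.consEquiv fun _ => Fin l).sum_comp, Fintype.sum_prod_type]
        refine Finset.sum_congr rfl fun i _ => ?_
        rw [cellTensor, Finset.sum_mul]
        refine Finset.sum_congr rfl fun i' _ => ?_
        rw [Fin.prod_univ_succ]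
        have e : (Fin.consEquiv fun _ => Fin l) (i, i') = Fin.cons i i' := rfl
        simp only [e, Fin.cons_zero, Fin.cons_succ]
        ring
      exact congrFun h1 i₀
    funext i
    have := congrFun (key (i 0)) (Fin.tail i)
    simpa using this

theorem continuous_cellTensor {n : ℕ} (l : ℕ) :
    Continuous (fun z : ((Fin n → Fin l) → ℝ) × (Fin n → ℝ) => cellTensor l z.1 z.2) := by
  unfold cellTensor
  refine continuous_finsetSum _ fun i _ => Continuous.mul (by fun_prop) ?_
  exact continuous_finsetProd _ fun q _ => (continuous_cellPoly l _).comp (by fun_prop)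

theorem openCube_eq_pi {ι : Type*} (c : ι → ℝ) (s : ℝ) :
    openCube c s = Set.univ.pi fun i => Set.Ioo (c i) (c i + s) := by
  ext x; simp [openCube]

theorem measurableSet_openCube {ι : Type*} [Countable ι] (c : ι → ℝ) (s : ℝ) :
    MeasurableSet (openCube c s) := by
  rw [openCube_eq_pi]
  exact MeasurableSet.univ_pi fun i => measurableSet_Ioo

theorem isOpen_openCube {ι : Type*} [Finite ι] (c : ι → ℝ) (s : ℝ) : IsOpen (openCube c s) := by
  rw [openCube_eq_pi]
  exact isOpen_set_pi Set.finite_univ fun i _ => isOpen_Ioo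

theorem volume_openCube {ι : Type*} [Fintype ι] (c : ι → ℝ) (s : ℝ) :
    volume (openCube c s) = ENNReal.ofReal s ^ Fintype.card ι := by
  rw [openCube_eq_pi, Real.volume_pi_Ioo]
  simp

/-- Compactness: the integral is continuous in `b`, homogeneous of degree `r`, and positive off zero
by linear independence, so it has a positive minimum on the unit sphere. No triangle inequality
enters, so `r < 1` is allowed. -/
theorem enorm_rpow_le_lintegral_cellTensor (n l : ℕ) (hl : 0 < l) (r : ℝ) (hr : 0 < r) :
    ∃ C : ℝ≥0, ∀ (b : (Fin n → Fin l) → ℝ) (i : Fin n → Fin l),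
      ‖b i‖ₑ ^ r ≤ C * ∫⁻ y in openCube (fun _ : Fin n => (0 : ℝ)) 1, ‖cellTensor l b y‖ₑ ^ r := by
  have : Nonempty (Fin l) := ⟨⟨0, hl⟩⟩
  set G : ((Fin n → Fin l) → ℝ) → ℝ := fun b => ∫ y in Set.Icc (fun _ => 0) (fun _ => 1),
    |cellTensor l b y| ^ r with hG
  have hcont : ∀ b : (Fin n → Fin l) → ℝ, Continuous (cellTensor l b) := fun b =>
    (continuous_cellTensor l).comp (by fun_prop : Continuous fun y : Fin n → ℝ => (b, y))
  have hcontr : ∀ b : (Fin n → Fin l) → ℝ, Continuous fun y => |cellTensor l b y| ^ r := fun b =>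
    (hcont b).abs.rpow_const fun _ => Or.inr hr.le
  have hGc : Continuous G := by
    refine continuous_parametric_integral_of_continuous (s := Set.Icc (fun _ => 0) (fun _ => 1))
      (f := fun b y => |cellTensor l b y| ^ r) ?_ isCompact_Icc
    exact (continuous_cellTensor l).abs.rpow_const fun _ => Or.inr hr.le
  have hInt : ∀ b, IntegrableOn (fun y => |cellTensor l b y| ^ r)
      (Set.Icc (fun _ : Fin n => (0 : ℝ)) (fun _ => 1)) volume := fun b =>
    (hcontr b).continuousOn.integrableOn_compact isCompact_Icc
  have hGpos : ∀ b, b ≠ 0 → 0 < G b := by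
    intro b hb
    refine lt_of_le_of_ne (integral_nonneg fun y => by positivity) fun h0 => hb ?_
    have h1 := (integral_eq_zero_iff_of_nonneg (fun y => by positivity) (hInt b)).1 h0.symm
    refine cellTensor_linearIndependent hl n b fun y hy => ?_
    have hsub : openCube (fun _ : Fin n => (0 : ℝ)) 1 ⊆ Set.Icc (fun _ => 0) (fun _ => 1) := by
      intro z hz
      refine ⟨fun q => (hz q).1.le, fun q => by simpa using (hz q).2.le⟩
    have h2 := Measure.eqOn_open_of_ae_eq (ae_restrict_of_ae_restrict_of_subset hsub h1)
      (isOpen_openCube _ _) (hcontr b).continuousOn continuousOn_const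
    have h3 : |cellTensor l b y| ^ r = 0 := h2 (show y ∈ openCube _ _ from fun q => by
      simpa using hy q)
    rw [Real.rpow_eq_zero (abs_nonneg _) hr.ne'] at h3
    exact abs_eq_zero.1 h3
  have hsph : (Metric.sphere (0 : (Fin n → Fin l) → ℝ) 1).Nonempty :=
    ⟨fun _ => 1, by simp [pi_norm_const]⟩
  obtain ⟨b₀, hb₀, hmin⟩ := (isCompact_sphere (0 : (Fin n → Fin l) → ℝ) 1).exists_isMinOn hsph
    hGc.continuousOn
  have hg0 : 0 < G b₀ := hGpos b₀ fun h => by simp [h] at hb₀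
  have hhom : ∀ (t : ℝ) b, G (t • b) = |t| ^ r * G b := by
    intro t b
    simp only [hG]
    rw [← integral_const_mul]
    refine integral_congr_ae (Filter.Eventually.of_forall fun y => ?_)
    have : cellTensor l (t • b) y = t * cellTensor l b y := by
      simp only [cellTensor, Finset.mul_sum, Pi.smul_apply, smul_eq_mul, mul_assoc]
    simp only [this, abs_mul]
    rw [Real.mul_rpow (abs_nonneg _) (abs_nonneg _)]
  have hlow : ∀ b : (Fin n → Fin l) → ℝ, ‖b‖ ^ r * G b₀ ≤ G b := by
    intro b
    rcases eq_or_ne b 0 with rfl | hb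
    · simp only [norm_zero, Real.zero_rpow hr.ne', zero_mul]
      exact integral_nonneg fun y => by positivity
    · have hnb : ‖b‖ ≠ 0 := norm_ne_zero_iff.2 hb
      have h1 : G b₀ ≤ G (‖b‖⁻¹ • b) := hmin (by simp [norm_smul, hnb])
      have h2 : G b = ‖b‖ ^ r * G (‖b‖⁻¹ • b) := by
        conv_lhs => rw [← smul_inv_smul₀ hnb b, hhom]
        simp
      rw [h2]
      gcongr
  refine ⟨(G b₀)⁻¹.toNNReal, fun b i => ?_⟩
  have hae : ∫⁻ y in openCube (fun _ : Fin n => (0 : ℝ)) 1, ‖cellTensor l b y‖ₑ ^ r =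
      ENNReal.ofReal (G b) := by
    rw [hG]
    simp only
    rw [ofReal_integral_eq_lintegral_ofReal (hInt b)
      (Filter.Eventually.of_forall fun y => by positivity)]
    have hset : (openCube (fun _ : Fin n => (0 : ℝ)) 1) =ᵐ[volume]
        (Set.Icc (fun _ => 0) (fun _ => 1) : Set (Fin n → ℝ)) := by
      rw [openCube_eq_pi]
      rw [volume_pi]
      simpa using Measure.univ_pi_Ioo_ae_eq_Icc (μ := fun _ : Fin n => (volume : Measure ℝ))
        (f := fun _ => 0) (g := fun _ => 1)
    rw [setLIntegral_congr hset]
    refine lintegral_congr fun y => ?_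
    rw [← ENNReal.ofReal_rpow_of_nonneg (abs_nonneg _) hr.le, ← Real.enorm_eq_ofReal_abs]
  rw [hae, ← ofReal_norm, ENNReal.ofReal_rpow_of_nonneg (norm_nonneg _) hr.le]
  change _ ≤ ENNReal.ofReal (G b₀)⁻¹ * _
  rw [← ENNReal.ofReal_mul (by positivity)]
  refine ENNReal.ofReal_le_ofReal ?_
  rw [inv_mul_eq_div, le_div_iff₀ hg0]
  refine le_trans ?_ (hlow b)
  gcongr
  exact norm_le_pi_norm b i

theorem setLIntegral_dyadicCube_comp {n : ℕ} (k : ℕ) (m : Fin n → ℤ) (f : (Fin n → ℝ) → ℝ≥0∞)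
    (hf : Measurable f) :
    ∫⁻ x in dyadicCube k m, f (fun q => 2 ^ k * x q - m q) =
      ((2 : ℝ≥0∞) ^ (k * n))⁻¹ * ∫⁻ y in openCube (fun _ : Fin n => (0 : ℝ)) 1, f y := by
  have hQ : MeasurableSet (dyadicCube k m) := measurableSet_openCube _ _
  have hQ0 := measurableSet_openCube (fun _ : Fin n => (0 : ℝ)) 1
  have h2 : (0 : ℝ) < 2 ^ k := by positivity
  set g : (Fin n → ℝ) → ℝ≥0∞ := (openCube (fun _ : Fin n => (0 : ℝ)) 1).indicator f with hg
  rw [← lintegral_indicator hQ, ← lintegral_indicator hQ0]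
  have h1 : (dyadicCube k m).indicator (fun x => f (fun q => 2 ^ k * x q - m q)) =
      fun x => g ((2 : ℝ) ^ k • x - fun q => (m q : ℝ)) := by
    funext x
    have hmem : x ∈ dyadicCube k m ↔
        ((2 : ℝ) ^ k • x - fun q => (m q : ℝ)) ∈ openCube (fun _ : Fin n => (0 : ℝ)) 1 := by
      simp only [dyadicCube, openCube, Set.mem_ofPred_eq]
      refine forall_congr' fun q => and_congr ?_ ?_
      · rw [div_lt_iff₀ h2]; simp; rw [mul_comm]
      · rw [← add_div, lt_div_iff₀ h2]; simp; rw [mul_comm, sub_lt_iff_lt_add, add_comm (m q : ℝ)]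
    by_cases hx : x ∈ dyadicCube k m
    · rw [Set.indicator_of_mem hx, hg, Set.indicator_of_mem (hmem.1 hx)]
      rfl
    · rw [Set.indicator_of_notMem hx, hg, Set.indicator_of_notMem (fun h => hx (hmem.2 h))]
  rw [h1]
  have h3 : ∫⁻ x, g ((2 : ℝ) ^ k • x - fun q => (m q : ℝ)) =
      ∫⁻ y, g (y - fun q => (m q : ℝ)) ∂(Measure.map ((2 : ℝ) ^ k • ·) volume) := by
    rw [lintegral_map (by fun_prop) (by fun_prop)]
  rw [h3, Measure.map_addHaar_smul _ h2.ne', lintegral_smul_measure, lintegral_sub_right_eq_self]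
  congr 1
  rw [Module.finrank_fin_fun, abs_of_pos (by positivity), ← pow_mul, ENNReal.ofReal_inv_of_pos
    (by positivity), ENNReal.ofReal_pow (by norm_num)]
  simp

/-- Since `N^{l-1}` vanishes outside `[0, l)`, only the indices `m - i` with `0 ≤ i_q < l` are
active on the cell `m`. -/
theorem spline_eq_cellTensor {n l : ℕ} (hl : 0 < l) (j : ℕ) (β : (Fin n → ℤ) → ℝ) (m : Fin n → ℤ)
    (x : Fin n → ℝ) (hx : ∀ q, (m q : ℝ) ≤ 2 ^ j * x q ∧ 2 ^ j * x q < m q + 1) :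
    ∑ᶠ m', β m' * bSplineN l j m' x =
      cellTensor l (fun i => β (fun q => m q - (i q : ℕ))) (fun q => 2 ^ j * x q - m q) := by
  let emb : (Fin n → Fin l) → (Fin n → ℤ) := fun i q => m q - (i q : ℕ)
  have hemb : Function.Injective emb := by
    intro i i' h
    funext q
    have := congrFun h q
    simp only [emb] at this
    exact Fin.ext (by omega)
  have h1 := finsum_mem_range hemb (f := fun m' => β m' * bSplineN l j m' x)
  rw [finsum_eq_sum_of_fintype (fun i => β (emb i) * bSplineN l j (emb i) x)] at h1
  have h2 : ∑ᶠ m', β m' * bSplineN l j m' x =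
      ∑ᶠ m' ∈ Set.range emb, β m' * bSplineN l j m' x := by
    rw [← finsum_mem_univ]
    refine finsum_mem_inter_support_eq' _ _ _ fun m' hm' => ⟨fun _ => ?_, fun _ => trivial⟩
    by_contra hcon
    apply hm'
    beta_reduce
    have : ∃ q, m' q < m q - (l - 1) ∨ m q < m' q := by
      by_contra hcon2
      push Not at hcon2
      refine hcon ⟨fun q => ⟨(m q - m' q).toNat, ?_⟩, ?_⟩
      · have := hcon2 q; omega
      · funext q
        have := hcon2 q
        simp only [emb]
        omega
    obtain ⟨q, hq⟩ := this
    rw [bSplineN_eq_zero hl q, mul_zero]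
    rcases hq with h | h
    · right
      have h' : (m' q : ℝ) + l ≤ m q := by
        have : m' q + l ≤ m q := by omega
        exact_mod_cast this
      linarith [(hx q).1]
    · left
      have h' : (m q : ℝ) + 1 ≤ m' q := by exact_mod_cast h
      linarith [(hx q).2]
  rw [h2, h1, cellTensor]
  refine Finset.sum_congr rfl fun i _ => ?_
  congr 1
  rw [bSplineN_eq]
  refine Finset.prod_congr rfl fun q _ => ?_
  rw [← bSpline_add_eq_cellPoly (i q).2 (by linarith [(hx q).1]) (by linarith [(hx q).2])]
  congr 1
  simp only [emb]
  push_cast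
  ring

theorem mem_dyadicCube {n k : ℕ} {m : Fin n → ℤ} {x : Fin n → ℝ} :
    x ∈ dyadicCube k m ↔ ∀ q, (m q : ℝ) < 2 ^ k * x q ∧ 2 ^ k * x q < m q + 1 := by
  have h2 : (0 : ℝ) < 2 ^ k := by positivity
  simp only [dyadicCube, openCube, Set.mem_ofPred_eq]
  refine forall_congr' fun q => and_congr ?_ ?_
  · rw [div_lt_iff₀ h2, mul_comm]
  · rw [← add_div, lt_div_iff₀ h2, mul_comm]

theorem lpNormOn_eq {ι : Type*} [Fintype ι] (f : (ι → ℝ) → ℝ) {p : ℝ} (hp : 0 < p)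
    (E : Set (ι → ℝ)) : lpNormOn f p E = (∫⁻ x in E, ‖f x‖ₑ ^ p) ^ (1 / p) := by
  rw [lpNormOn, eLpNorm_eq_lintegral_rpow_enorm_toReal (by simpa using hp) (by simp),
    ENNReal.toReal_ofReal hp.le]

/-- A B-spline coefficient is controlled by the local `L_r` quasi-norm of the spline. -/
theorem enorm_coeff_le (n l : ℕ) (hl : 0 < l) (r : ℝ) (hr : 0 < r) :
    ∃ C : ℝ≥0, ∀ (j : ℕ) (β : (Fin n → ℤ) → ℝ) (m : Fin n → ℤ),
      ‖β m‖ₑ ≤ C * ((2 : ℝ≥0∞) ^ ((j : ℝ) * n / r) *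
        lpNormOn (fun x => ∑ᶠ m', β m' * bSplineN l j m' x) r (dyadicCube j m)) := by
  obtain ⟨C, hC⟩ := enorm_rpow_le_lintegral_cellTensor n l hl r hr
  refine ⟨C ^ (1 / r), fun j β m => ?_⟩
  set b : (Fin n → Fin l) → ℝ := fun i => β (fun q => m q - (i q : ℕ)) with hb
  have hb0 : b (fun _ => ⟨0, hl⟩) = β m := by simp [hb]
  have h1 := hC b (fun _ => ⟨0, hl⟩)
  rw [hb0] at h1
  have hm : Measurable fun y => ‖cellTensor l b y‖ₑ ^ r := by
    have : Continuous (cellTensor l b) := (continuous_cellTensor l).comp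
      (by fun_prop : Continuous fun y : Fin n → ℝ => (b, y))
    exact this.measurable.enorm.pow_const r
  have h2 : ∫⁻ x in dyadicCube j m, ‖∑ᶠ m', β m' * bSplineN l j m' x‖ₑ ^ r =
      ((2 : ℝ≥0∞) ^ (j * n))⁻¹ *
        ∫⁻ y in openCube (fun _ : Fin n => (0 : ℝ)) 1, ‖cellTensor l b y‖ₑ ^ r := by
    rw [← setLIntegral_dyadicCube_comp j m _ hm]
    refine setLIntegral_congr_fun (measurableSet_openCube _ _) fun x hx => ?_
    rw [spline_eq_cellTensor hl j β m x fun q => ?_]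
    have := mem_dyadicCube.1 hx q
    exact ⟨this.1.le, this.2⟩
  have h2n : (2 : ℝ≥0∞) ^ (j * n) ≠ 0 := by positivity
  have h2t : (2 : ℝ≥0∞) ^ (j * n) ≠ ∞ := by simp
  have h3 : ∫⁻ y in openCube (fun _ : Fin n => (0 : ℝ)) 1, ‖cellTensor l b y‖ₑ ^ r =
      (2 : ℝ≥0∞) ^ (j * n) * ∫⁻ x in dyadicCube j m, ‖∑ᶠ m', β m' * bSplineN l j m' x‖ₑ ^ r := by
    rw [h2, ← mul_assoc, ENNReal.mul_inv_cancel h2n h2t, one_mul]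
  rw [h3] at h1
  have h4 := ENNReal.rpow_le_rpow h1 (by positivity : 0 ≤ 1 / r)
  rw [← ENNReal.rpow_mul, mul_one_div_cancel hr.ne', ENNReal.rpow_one,
    ENNReal.mul_rpow_of_nonneg _ _ (by positivity), ENNReal.mul_rpow_of_nonneg _ _ (by positivity)]
    at h4
  rw [lpNormOn_eq _ hr]
  refine h4.trans_eq ?_
  congr 1
  · rw [ENNReal.coe_rpow_of_nonneg _ (by positivity)]
  · congr 1
    rw [← ENNReal.rpow_natCast, ← ENNReal.rpow_mul]
    congr 1
    push_cast
    ring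

/-! ### Doubling properties of local Muckenhoupt weights -/

theorem openCube_subset_openCube {ι : Type*} {c c' : ι → ℝ} {s s' : ℝ} (h1 : ∀ i, c' i ≤ c i)
    (h2 : ∀ i, c i + s ≤ c' i + s') : openCube c s ⊆ openCube c' s' :=
  fun _ hx i => ⟨(h1 i).trans_lt (hx i).1, (hx i).2.trans_le (h2 i)⟩

theorem weightMass_mono {ι : Type*} [Fintype ι] (w : (ι → ℝ) → ℝ) {E F : Set (ι → ℝ)}
    (h : E ⊆ F) : weightMass w E ≤ weightMass w F :=
  lintegral_mono_set h

/-- Two cubes of side `s` displaced by at most `κ s` lie in a cube of side `(1 + κ) s`. For small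
`κ` each fills more than the fraction `α` of it, so the defining inequality applies. -/
theorem ALocInfty.exists_shift {ι : Type*} [Fintype ι] {w : (ι → ℝ) → ℝ} (hw : ALocInfty w) :
    ∃ κ a : ℝ, 0 < κ ∧ 0 < a ∧ ∃ C : ℝ≥0, ∀ (c c' : ι → ℝ) (s : ℝ), 0 < s → s ≤ a →
      (∀ i, |c i - c' i| ≤ κ * s) →
      weightMass w (openCube c' s) ≤ C * weightMass w (openCube c s) := by
  obtain ⟨-, a, ha, α, hα0, hα1, C, hC⟩ := hw
  have hev : ∀ᶠ κ : ℝ in nhdsWithin 0 (Set.Ioi 0), α * (1 + κ) ^ Fintype.card ι < 1 ∧ κ < 1 := by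
    have hc : Continuous fun κ : ℝ => α * (1 + κ) ^ Fintype.card ι := by fun_prop
    refine Filter.Eventually.and ?_ ?_
    · exact (hc.tendsto' 0 α (by simp)).mono_left nhdsWithin_le_nhds |>.eventually_lt_const hα1
    · exact nhdsWithin_le_nhds (eventually_lt_nhds zero_lt_one)
  obtain ⟨κ, ⟨hκ1, hκ2⟩, hκ0⟩ := (hev.and self_mem_nhdsWithin).exists
  have hκ0 : 0 < κ := hκ0
  refine ⟨κ, a / 2, hκ0, by positivity, C, fun c c' s hs hsa hcc => ?_⟩
  set c'' : ι → ℝ := fun i => min (c i) (c' i) with hc''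
  have hsub : ∀ b : ι → ℝ, (∀ i, c'' i ≤ b i) → (∀ i, b i ≤ c'' i + κ * s) →
      openCube b s ⊆ openCube c'' ((1 + κ) * s) := fun b h1 h2 =>
    openCube_subset_openCube h1 fun i => by linarith [h2 i]
  have hb1 : ∀ i, c i ≤ c'' i + κ * s := by
    intro i
    have := abs_le.1 (hcc i)
    rcases min_cases (c i) (c' i) with h | h <;> simp only [hc''] <;> rw [h.1] <;> nlinarith
  have hb2 : ∀ i, c' i ≤ c'' i + κ * s := by
    intro i
    have := abs_le.1 (hcc i)
    rcases min_cases (c i) (c' i) with h | h <;> simp only [hc''] <;> rw [h.1] <;> nlinarith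
  refine (weightMass_mono w (hsub c' (fun i => min_le_right _ _) hb2)).trans ?_
  refine hC c'' ((1 + κ) * s) (by positivity) (by nlinarith) _ (measurableSet_openCube c s)
    (hsub c (fun i => min_le_left _ _) hb1) ?_
  rw [volume_openCube, volume_openCube, ← ENNReal.ofReal_pow (by positivity),
    ← ENNReal.ofReal_pow hs.le, ← ENNReal.ofReal_mul hα0.le]
  refine ENNReal.ofReal_le_ofReal ?_
  rw [mul_pow, ← mul_assoc]
  exact mul_le_of_le_one_left (by positivity) hκ1.le

/-- `M` equal small shifts along the segment between the corners; the constant depends on the number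
of shifts but not on the scale. -/
theorem ALocInfty.exists_chain {ι : Type*} [Fintype ι] {w : (ι → ℝ) → ℝ} (hw : ALocInfty w) :
    ∃ κ a : ℝ, 0 < κ ∧ 0 < a ∧ ∃ C : ℝ≥0, ∀ (M : ℕ) (c c' : ι → ℝ) (s : ℝ), 0 < s → s ≤ a →
      (∀ i, |c i - c' i| ≤ M * (κ * s)) →
      weightMass w (openCube c' s) ≤ C ^ M * weightMass w (openCube c s) := by
  obtain ⟨κ, a, hκ, ha, C, hC⟩ := hw.exists_shift
  refine ⟨κ, a, hκ, ha, C, fun M => ?_⟩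
  induction M with
  | zero =>
    intro c c' s _ _ h
    have : c = c' := by
      funext i
      have := h i
      simp only [Nat.cast_zero, zero_mul, abs_nonpos_iff] at this
      linarith
    simp [this]
  | succ M ih =>
    intro c c' s hs hsa h
    have hM : (0 : ℝ) < M + 1 := by positivity
    set c'' : ι → ℝ := fun i => c i + (M / (M + 1) : ℝ) * (c' i - c i) with hc''
    have h1 : ∀ i, |c i - c'' i| ≤ M * (κ * s) := by
      intro i
      have e : c i - c'' i = (M / (M + 1) : ℝ) * (c i - c' i) := by simp only [hc'']; ring
      rw [e, abs_mul, abs_of_nonneg (by positivity)]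
      calc (M / (M + 1) : ℝ) * |c i - c' i| ≤ (M / (M + 1) : ℝ) * ((M + 1) * (κ * s)) := by
            gcongr; simpa using h i
        _ = M * (κ * s) := by field_simp
    have h2 : ∀ i, |c'' i - c' i| ≤ κ * s := by
      intro i
      have e : c'' i - c' i = (1 / (M + 1) : ℝ) * (c i - c' i) := by
        simp only [hc'']; field_simp; ring
      rw [e, abs_mul, abs_of_nonneg (by positivity)]
      calc (1 / (M + 1) : ℝ) * |c i - c' i| ≤ (1 / (M + 1) : ℝ) * ((M + 1) * (κ * s)) := by
            gcongr; simpa using h i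
        _ = κ * s := by field_simp
    calc weightMass w (openCube c' s) ≤ C * weightMass w (openCube c'' s) := hC c'' c' s hs hsa h2
      _ ≤ C * (C ^ M * weightMass w (openCube c s)) := by gcongr; exact ih c c'' s hs hsa h1
      _ = C ^ (M + 1) * weightMass w (openCube c s) := by ring

/-- A large cube is dominated by a small cube of proportional side length nearby, uniformly over
the scales `t ≤ 1`. -/
theorem ALocInfty.exists_large_le_small {ι : Type*} [Fintype ι] {w : (ι → ℝ) → ℝ}
    (hw : ALocInfty w) (L η₀ : ℝ) (hη₀ : 0 < η₀) :
    ∃ η : ℝ, 0 < η ∧ η ≤ η₀ ∧ ∃ C : ℝ≥0, ∀ (c c' : ι → ℝ) (t : ℝ), 0 < t → t ≤ 1 →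
      (∀ i, |c i - c' i| ≤ L * t) →
      weightMass w (openCube c' (L * t)) ≤ C * weightMass w (openCube c (η * t)) := by
  obtain ⟨κ, a, hκ, ha, C, hC⟩ := hw.exists_chain
  set η := min a η₀ with hη
  have hη0 : 0 < η := lt_min ha hη₀
  obtain ⟨K, hK⟩ := exists_nat_ge (2 * L / η)
  obtain ⟨M, hM⟩ := exists_nat_ge (2 * L / (κ * η))
  have hKL : 2 * L ≤ K * η := by rwa [div_le_iff₀ hη0] at hK
  have hML : 2 * L ≤ M * (κ * η) := by rwa [div_le_iff₀ (by positivity)] at hM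
  classical
  refine ⟨η, hη0, min_le_right _ _, (Fintype.card (ι → Fin K) : ℝ≥0) * C ^ M, ?_⟩
  intro c c' t ht ht1 hcc
  -- Cover the large cube by small ones on a lattice of half their side, so that the open cubes
  -- overlap. The restriction on `z` below keeps the corners within `2 * L * t` of `c`, hence
  -- reachable in `M` shifts.
  set corner : (ι → Fin K) → ι → ℝ := fun z i => c' i + (z i : ℕ) * (η * t / 2) with hcorner
  have hcov : openCube c' (L * t) ⊆ ⋃ z : {z : ι → Fin K // ∀ i, ((z i : ℕ) : ℝ) * (η * t / 2) ≤ L * t},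
      openCube (corner z) (η * t) := by
    intro x hx
    have hst : 0 < η * t / 2 := by positivity
    have hz : ∀ i, ∃ z : ℕ, z < K ∧ (z : ℝ) * (η * t / 2) < x i - c' i ∧
        x i - c' i < z * (η * t / 2) + η * t := by
      intro i
      -- The index is the ceiling minus one rather than the floor, since the lower inequality has to
      -- be strict.
      have hx0 : 0 < (x i - c' i) / (η * t / 2) := div_pos (by linarith [(hx i).1]) hst
      have hcp : 0 < ⌈(x i - c' i) / (η * t / 2)⌉₊ := Nat.ceil_pos.2 hx0
      have hl1 := Nat.le_ceil ((x i - c' i) / (η * t / 2))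
      have hl2 := Nat.ceil_lt_add_one hx0.le
      obtain ⟨z, hzz⟩ : ∃ z, ⌈(x i - c' i) / (η * t / 2)⌉₊ = z + 1 :=
        ⟨_, (Nat.succ_pred_eq_of_pos hcp).symm⟩
      rw [hzz] at hl1 hl2
      push_cast at hl1 hl2
      have hl3 : (z : ℝ) < (x i - c' i) / (η * t / 2) := by linarith
      rw [lt_div_iff₀ hst] at hl3
      rw [div_le_iff₀ hst] at hl1
      refine ⟨z, ?_, hl3, by nlinarith⟩
      have : (z : ℝ) * (η * t / 2) < K * (η * t / 2) := by
        refine hl3.trans (lt_of_lt_of_le (by linarith [(hx i).2] : x i - c' i < L * t) ?_)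
        nlinarith
      exact_mod_cast lt_of_mul_lt_mul_right this hst.le
    choose z hz1 hz2 hz3 using hz
    refine Set.mem_iUnion.2 ⟨⟨fun i => ⟨z i, hz1 i⟩, fun i => ?_⟩, fun i => ?_⟩
    · have := hz2 i
      simp only
      linarith [(hx i).2]
    · simp only [hcorner]
      constructor <;> linarith [hz2 i, hz3 i]
  calc weightMass w (openCube c' (L * t))
      ≤ ∑' z : {z : ι → Fin K // ∀ i, ((z i : ℕ) : ℝ) * (η * t / 2) ≤ L * t},
          weightMass w (openCube (corner z) (η * t)) :=
        (weightMass_mono w hcov).trans (lintegral_iUnion_le _ _)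
    _ ≤ ∑' z : {z : ι → Fin K // ∀ i, ((z i : ℕ) : ℝ) * (η * t / 2) ≤ L * t},
          (C : ℝ≥0∞) ^ M * weightMass w (openCube c (η * t)) := by
        refine ENNReal.tsum_le_tsum fun z => hC M c _ _ (by positivity) ?_ fun i => ?_
        · exact (mul_le_of_le_one_right hη0.le ht1).trans (min_le_left _ _)
        · have h1 := z.2 i
          have h0 : 0 ≤ ((z.1 i : ℕ) : ℝ) * (η * t / 2) := by positivity
          have h2 := abs_le.1 (hcc i)
          simp only [hcorner]
          rw [abs_le]
          constructor <;> nlinarith [h2.1, h2.2]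
    _ ≤ ∑' z : (ι → Fin K), (C : ℝ≥0∞) ^ M * weightMass w (openCube c (η * t)) :=
        ENNReal.tsum_comp_le_tsum_of_injective Subtype.val_injective
          (fun _ => (C : ℝ≥0∞) ^ M * weightMass w (openCube c (η * t)))
    _ = _ := by
        rw [tsum_fintype, Finset.sum_const, nsmul_eq_mul, Finset.card_univ]
        push_cast
        ring

/-! ### The multiple sequence generated by the weight -/

theorem gammaHat_rpow {n d : ℕ} {γ : (Fin n ⊕ Fin d → ℝ) → ℝ} (hγ : IsWeight γ) {p : ℝ}
    (hp : 0 < p) (k : ℕ) (m : Fin n → ℤ) :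
    gammaHat γ p k m ^ p = weightMass (fun z => γ z ^ p) (shellBox d k m) := by
  rw [gammaHat, lpNormOn_eq _ hp, ← ENNReal.rpow_mul, one_div_mul_cancel hp.ne', ENNReal.rpow_one,
    weightMass]
  refine lintegral_congr fun z => ?_
  rw [Real.enorm_of_nonneg (hγ.2 z).le, ENNReal.ofReal_rpow_of_nonneg (hγ.2 z).le hp.le]

/-- A cube containing the shells over all subcubes of `Q_{k,m}`. -/
noncomputable def shellHull {n : ℕ} (d k : ℕ) (m : Fin n → ℤ) : Set (Fin n ⊕ Fin d → ℝ) :=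
  openCube (Sum.elim (fun i => (m i : ℝ) / 2 ^ k) (fun _ => -(1 / 2 ^ k))) (2 * (1 / 2 ^ k))

theorem shellBox_subset_shellHull {n d j k : ℕ} (hjk : j ≤ k) {m m' : Fin n → ℤ}
    (h : dyadicCube k m ⊆ dyadicCube j m') : shellBox d k m ⊆ shellHull d j m' := by
  rintro z ⟨hz1, -, hz3⟩
  have hp : (0 : ℝ) < 1 / 2 ^ j := by positivity
  have hle : (1 : ℝ) / 2 ^ k ≤ 1 / 2 ^ j := by
    gcongr
    norm_num
  intro i
  rcases i with i | i
  · have := h hz1 i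
    simp only [Sum.elim_inl]
    constructor <;> linarith [this.1, this.2]
  · have h1 := (PiLp.norm_apply_le (WithLp.toLp 2 fun i : Fin d => z (Sum.inr i)) i).trans_lt hz3
    simp only [Real.norm_eq_abs] at h1
    have h2 := abs_lt.1 h1
    simp only [Sum.elim_inr]
    constructor <;> linarith [h2.1, h2.2]

/-- The cube sits on the inner sphere at the point `2^{-k-1}` of the first transversal axis. Its
first transversal coordinate lies between `1/2` and `5/8` in units of `2^{-k}`, and the others
contribute at most `d η² ≤ 1/32` to the squared norm. -/
theorem openCube_subset_shellBox {n d : ℕ} (hd : 0 < d) (k : ℕ) (m : Fin n → ℤ) {η : ℝ}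
    (hη0 : 0 < η) (hη : η ≤ 1 / (4 * (d + 1))) :
    openCube (Sum.elim (fun i => (m i : ℝ) / 2 ^ k)
      (fun i : Fin d => if i = ⟨0, hd⟩ then 1 / 2 ^ (k + 1) else 0)) (η * (1 / 2 ^ k)) ⊆
      shellBox d k m := by
  intro z hz
  set t : ℝ := 1 / 2 ^ k with ht
  have ht0 : 0 < t := by positivity
  have hhalf : (1 : ℝ) / 2 ^ (k + 1) = t / 2 := by rw [ht, pow_succ]; field_simp
  have hd1 : (1 : ℝ) ≤ d := by exact_mod_cast hd
  have hη' : η * (4 * (d + 1)) ≤ 1 := by rwa [le_div_iff₀ (by positivity)] at hη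
  have hη1 : η ≤ 1 / 8 := by nlinarith
  have hηd : d * η ≤ 1 / 4 := by nlinarith
  refine ⟨fun i => ?_, ?_, ?_⟩
  · have := hz (Sum.inl i)
    simp only [Sum.elim_inl] at this
    refine ⟨this.1, this.2.trans_le ?_⟩
    nlinarith
  · have := hz (Sum.inr ⟨0, hd⟩)
    simp only [Sum.elim_inr, if_true] at this
    refine this.1.le.trans ((le_abs_self _).trans ?_)
    exact PiLp.norm_apply_le (WithLp.toLp 2 fun i : Fin d => z (Sum.inr i)) ⟨0, hd⟩
  · have hsq : ‖WithLp.toLp 2 fun i : Fin d => z (Sum.inr i)‖ ^ 2 < t ^ 2 := by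
      rw [EuclideanSpace.real_norm_sq_eq]
      have hb : ∀ i : Fin d, z (Sum.inr i) ^ 2 ≤
          (if i = ⟨0, hd⟩ then (25 / 64) * t ^ 2 else 0) + η ^ 2 * t ^ 2 := by
        intro i
        have := hz (Sum.inr i)
        simp only [Sum.elim_inr] at this
        split_ifs with hi
        · simp only [hi, if_true, hhalf] at this
          have h1 : z (Sum.inr i) ≤ 5 / 8 * t := by rw [hi]; nlinarith [this.2]
          have h0 : 0 ≤ z (Sum.inr i) := by rw [hi]; linarith [this.1]
          nlinarith [sq_nonneg (η * t)]
        · simp only [hi, if_false] at this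
          have h1 : z (Sum.inr i) ≤ η * t := by linarith [this.2]
          have h0 : 0 ≤ z (Sum.inr i) := by linarith [this.1]
          nlinarith
      refine (Finset.sum_le_sum fun i _ => hb i).trans_lt ?_
      rw [Finset.sum_add_distrib, Finset.sum_ite_eq' Finset.univ (⟨0, hd⟩ : Fin d)]
      simp only [Finset.mem_univ, if_true, Finset.sum_const, Finset.card_univ, Fintype.card_fin,
        nsmul_eq_mul]
      have : d * η ^ 2 ≤ 1 / 32 := by nlinarith
      nlinarith [sq_pos_of_pos ht0]
    exact lt_of_pow_lt_pow_left₀ 2 ht0.le hsq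

/-- The source of all doubling statements for `γ`: a hull is dominated by a small cube inside the
neighbouring shell. The factor `L + 2` bounds the side `2`, the horizontal displacement `L` and the
transversal one `3/2`, in units of `2^{-k}`. -/
theorem weightMass_shellHull_le {n d : ℕ} (hd : 0 < d) {w : (Fin n ⊕ Fin d → ℝ) → ℝ}
    (hw : ALocInfty w) (L : ℕ) : ∃ C : ℝ≥0, ∀ (k : ℕ) (m m' : Fin n → ℤ),
      (∀ i, |m i - m' i| ≤ L) →
      weightMass w (shellHull d k m) ≤ C * weightMass w (shellBox d k m') := by
  obtain ⟨η, hη0, hη, C, hC⟩ := hw.exists_large_le_small (L + 2) (1 / (4 * (d + 1)))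
    (by positivity)
  refine ⟨C, fun k m m' hmm => ?_⟩
  have ht0 : (0 : ℝ) < 1 / 2 ^ k := by positivity
  have ht1 : (1 : ℝ) / 2 ^ k ≤ 1 := by
    rw [div_le_one (by positivity)]
    exact one_le_pow₀ (by norm_num)
  have hhalf : (1 : ℝ) / 2 ^ (k + 1) = 1 / 2 ^ k / 2 := by rw [pow_succ]; field_simp
  calc weightMass w (shellHull d k m)
      ≤ weightMass w (openCube (Sum.elim (fun i => (m i : ℝ) / 2 ^ k) (fun _ => -(1 / 2 ^ k)))
          ((L + 2) * (1 / 2 ^ k))) := by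
        refine weightMass_mono w (openCube_subset_openCube (fun i => le_rfl) fun i => ?_)
        gcongr
        linarith [Nat.cast_nonneg (α := ℝ) L]
    _ ≤ C * weightMass w (openCube (Sum.elim (fun i => (m' i : ℝ) / 2 ^ k)
          (fun i : Fin d => if i = ⟨0, hd⟩ then 1 / 2 ^ (k + 1) else 0)) (η * (1 / 2 ^ k))) := by
        refine hC _ _ _ ht0 ht1 fun i => ?_
        rcases i with i | i
        · simp only [Sum.elim_inl]
          rw [← sub_div, abs_div, abs_of_pos (by positivity : (0 : ℝ) < 2 ^ k),
            div_eq_mul_one_div]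
          gcongr
          have : |(m i : ℝ) - m' i| ≤ L := by exact_mod_cast hmm i
          rw [abs_sub_comm]
          linarith
        · simp only [Sum.elim_inr]
          rw [hhalf]
          have := Nat.cast_nonneg (α := ℝ) L
          split_ifs <;> rw [abs_of_nonneg (by linarith)] <;> nlinarith
    _ ≤ C * weightMass w (shellBox d k m') := by
        gcongr
        exact weightMass_mono w (openCube_subset_shellBox hd k m' hη0 hη)

/-! ### Dyadic subcubes -/

theorem mem_subcubes_iff {n j k : ℕ} (hjk : j ≤ k) {m m' : Fin n → ℤ} :
    m ∈ subcubes j m' k ↔ ∀ q, m q / 2 ^ (k - j) = m' q := by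
  obtain ⟨i, rfl⟩ := Nat.exists_eq_add_of_le hjk
  have hi : j + i - j = i := by omega
  have hw : (0 : ℝ) < 2 ^ i := by positivity
  have hj : (0 : ℝ) < 2 ^ j := by positivity
  simp only [hi, Int.ediv_eq_iff_of_pos (show (0 : ℤ) < 2 ^ i by positivity)]
  constructor
  · intro h q
    -- Testing the inclusion at the centre suffices, because the integer inequalities leave room for
    -- the half.
    have hc : (fun q => ((m q : ℝ) + 1 / 2) / 2 ^ (j + i)) ∈ dyadicCube (j + i) m := by
      rw [mem_dyadicCube]
      intro q
      rw [mul_div_cancel₀ _ (by positivity)]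
      constructor <;> linarith
    have h1 := mem_dyadicCube.1 (h hc) q
    have e : (2 : ℝ) ^ j * (((m q : ℝ) + 1 / 2) / 2 ^ (j + i)) = ((m q : ℝ) + 1 / 2) / 2 ^ i := by
      rw [pow_add]; field_simp
    rw [e, lt_div_iff₀ hw, div_lt_iff₀ hw] at h1
    constructor
    · have : ((m' q * 2 ^ i : ℤ) : ℝ) < ((m q + 1 : ℤ) : ℝ) := by push_cast; linarith [h1.1]
      have := Int.cast_lt.1 this
      omega
    · have : ((m q : ℤ) : ℝ) < ((m' q * 2 ^ i + 2 ^ i : ℤ) : ℝ) := by push_cast; linarith [h1.2]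
      exact Int.cast_lt.1 this
  · intro h x hx
    rw [mem_dyadicCube] at hx ⊢
    intro q
    have h1 : ((m' q : ℝ) * 2 ^ i) ≤ m q := by exact_mod_cast (h q).1
    have h2 : (m q : ℝ) + 1 ≤ m' q * 2 ^ i + 2 ^ i := by
      have := (h q).2
      exact_mod_cast this
    have h3 := hx q
    rw [pow_add] at h3
    constructor
    · refine lt_of_mul_lt_mul_right ?_ hw.le
      nlinarith [h3.1]
    · refine lt_of_mul_lt_mul_right ?_ hw.le
      nlinarith [h3.2]

theorem tsum_subcubes {n j k : ℕ} (hjk : j ≤ k) (f : (Fin n → ℤ) → ℝ≥0∞) :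
    ∑' m' : Fin n → ℤ, ∑' m : subcubes j m' k, f m = ∑' m, f m := by
  rw [← ENNReal.tsum_fiberwise f (fun m q => m q / 2 ^ (k - j))]
  refine tsum_congr fun m' => ?_
  have : subcubes j m' k = (fun (m : Fin n → ℤ) q => m q / 2 ^ (k - j)) ⁻¹' {m'} := by
    ext m
    simp only [mem_subcubes_iff hjk, Set.mem_preimage, Set.mem_singleton_iff, funext_iff]
  rw [this]

theorem dyadicCube_disjoint {n k : ℕ} {m m' : Fin n → ℤ} (h : m ≠ m') :
    Disjoint (dyadicCube k m) (dyadicCube k m') := by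
  rw [Set.disjoint_left]
  intro x hx hx'
  apply h
  funext q
  have h1 := mem_dyadicCube.1 hx q
  have h2 := mem_dyadicCube.1 hx' q
  have a1 : (m q : ℝ) < ((m' q + 1 : ℤ) : ℝ) := by push_cast; linarith [h1.1, h2.2]
  have a2 : (m' q : ℝ) < ((m q + 1 : ℤ) : ℝ) := by push_cast; linarith [h2.1, h1.2]
  have := Int.cast_lt.1 a1
  have := Int.cast_lt.1 a2
  omega

theorem measurableSet_shellBox {n : ℕ} (d k : ℕ) (m : Fin n → ℤ) :
    MeasurableSet (shellBox d k m) := by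
  have h1 : Measurable fun z : Fin n ⊕ Fin d → ℝ => (fun i => z (Sum.inl i)) := by fun_prop
  have h2 : Measurable fun z : Fin n ⊕ Fin d → ℝ =>
      ‖WithLp.toLp 2 (fun i : Fin d => z (Sum.inr i))‖ := by fun_prop
  exact (h1 (measurableSet_openCube _ _)).inter
    ((measurableSet_le measurable_const h2).inter (measurableSet_lt h2 measurable_const))

theorem one_le_two_rpow {x : ℝ} (hx : 0 ≤ x) : 1 ≤ (2 : ℝ≥0∞) ^ x := by
  simpa using ENNReal.rpow_le_rpow_of_exponent_le (by norm_num : (1 : ℝ≥0∞) ≤ 2) hx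

/-! ### Sums of the multiple sequence over subcubes and over boundary layers. -/

section Gamma

variable {n d : ℕ} {γ : (Fin n ⊕ Fin d → ℝ) → ℝ} {p : ℝ}

theorem gammaHat_neighbour_le (hd : 0 < d) (hp : 0 < p) (hγ : IsWeight γ)
    (hγp : ALocInfty (fun z => γ z ^ p)) (L : ℕ) : ∃ C : ℝ≥0, ∀ (k : ℕ) (m m' : Fin n → ℤ),
      (∀ i, |m i - m' i| ≤ L) → gammaHat γ p k m ^ p ≤ C * gammaHat γ p k m' ^ p := by
  obtain ⟨C, hC⟩ := weightMass_shellHull_le hd hγp L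
  refine ⟨C, fun k m m' h => ?_⟩
  rw [gammaHat_rpow hγ hp, gammaHat_rpow hγ hp]
  exact (weightMass_mono _ (shellBox_subset_shellHull le_rfl subset_rfl)).trans (hC k m m' h)

/-- Shells over distinct subcubes of the same generation have disjoint bases, and all lie in one
hull. This is the estimate without decay, used when `δ₁ - ε ≤ 0` and for passing to a child cube. -/
theorem tsum_gammaHat_subcubes_le (hd : 0 < d) (hp : 0 < p) (hγ : IsWeight γ)
    (hγp : ALocInfty (fun z => γ z ^ p)) : ∃ C : ℝ≥0, ∀ (j k : ℕ), j ≤ k → ∀ m' : Fin n → ℤ,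
      ∑' m : subcubes j m' k, gammaHat γ p k m ^ p ≤ C * gammaHat γ p j m' ^ p := by
  obtain ⟨C, hC⟩ := weightMass_shellHull_le hd hγp 0
  refine ⟨C, fun j k hjk m' => ?_⟩
  simp only [gammaHat_rpow hγ hp]
  refine le_trans ?_ (hC j m' m' (by simp))
  unfold weightMass
  rw [← lintegral_iUnion (fun m : subcubes j m' k => measurableSet_shellBox d k m.1)]
  · exact lintegral_mono_set (Set.iUnion_subset fun m => shellBox_subset_shellHull hjk m.2)
  · intro m₁ m₂ h
    rw [Function.onFun, Set.disjoint_left]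
    intro z hz hz'
    exact Set.disjoint_left.1 (dyadicCube_disjoint fun h' => h (Subtype.ext h')) hz.1 hz'.1

/-- If `δ₁ - ε > 0`, an admissible exponent exceeds it. Otherwise the power of two is at least one
and the estimate without decay suffices; this includes the value `sSup = 0` of an empty or unbounded
set. -/
theorem tsum_gammaHat_le_delta1 (hd : 0 < d) (hp : 0 < p) (hγ : IsWeight γ)
    (hγp : ALocInfty (fun z => γ z ^ p)) {ε : ℝ} (hε : 0 < ε) :
    ∃ C : ℝ≥0, ∀ (j k : ℕ), j ≤ k → ∀ m' : Fin n → ℤ,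
      ∑' m : subcubes j m' k, gammaHat γ p k m ^ p ≤
        C * (2 : ℝ≥0∞) ^ (((j : ℝ) - k) * d * (delta1 γ p - ε)) * gammaHat γ p j m' ^ p := by
  have hneg : ∀ j k : ℕ, j ≤ k → ((j : ℝ) - k) * d ≤ 0 := by
    intro j k hjk
    have : (j : ℝ) ≤ k := by exact_mod_cast hjk
    exact mul_nonpos_of_nonpos_of_nonneg (by linarith) (by positivity)
  by_cases h : 0 < delta1 γ p - ε
  · have hlt : delta1 γ p - ε < delta1 γ p := by linarith
    have hne : Set.Nonempty {δ : ℝ | 0 < δ ∧ ∃ C : ℝ≥0, ∀ (k j : ℕ), k ≤ j → ∀ m : Fin n → ℤ,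
        ∑' m' : subcubes k m j, gammaHat γ p j m' ^ p ≤
          C * (2 : ℝ≥0∞) ^ (((k : ℝ) - j) * d * δ) * gammaHat γ p k m ^ p} := by
      by_contra hcon
      rw [Set.not_nonempty_iff_eq_empty] at hcon
      have : delta1 γ p = 0 := by rw [delta1, hcon, Real.sSup_empty]
      linarith
    obtain ⟨δ, ⟨-, C, hC⟩, hδ⟩ := exists_lt_of_lt_csSup hne hlt
    refine ⟨C, fun j k hjk m' => (hC j k hjk m').trans ?_⟩
    gcongr ?_ * ?_ * ?_
    · exact le_rfl
    · exact ENNReal.rpow_le_rpow_of_exponent_le (by norm_num)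
        (mul_le_mul_of_nonpos_left hδ.le (hneg j k hjk))
    · exact le_rfl
  · obtain ⟨C, hC⟩ := tsum_gammaHat_subcubes_le hd hp hγ hγp
    refine ⟨C, fun j k hjk m' => (hC j k hjk m').trans ?_⟩
    gcongr
    refine le_mul_of_one_le_right (by positivity) (one_le_two_rpow ?_)
    exact mul_nonneg_of_nonpos_of_nonpos (hneg j k hjk) (not_lt.1 h)

/-- `Q_{k,m}` has distance at least `l 2^{-k}` to the boundaries of the cubes of generation `j`. -/
def IsInner {n : ℕ} (l j k : ℕ) (m : Fin n → ℤ) : Prop :=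
  ∀ q, (l : ℤ) ≤ m q % 2 ^ (k - j) ∧ m q % 2 ^ (k - j) + l + 1 ≤ 2 ^ (k - j)

/-- The cubes in question are covered by `2 n` slabs of thickness `l 2^{-k}`, one along each face of
`Q_{j,m'}`. -/
theorem volume_boundary_le {n : ℕ} (l : ℕ) {j k : ℕ} (hjk : j ≤ k) (m' : Fin n → ℤ) :
    volume (⋃ m ∈ {m ∈ subcubes j m' k | ¬ IsInner l j k m}, dyadicCube k m) ≤
      ENNReal.ofReal (2 * l * n * (2 ^ j / 2 ^ k)) * volume (dyadicCube j m') := by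
  obtain ⟨i, rfl⟩ := Nat.exists_eq_add_of_le hjk
  have hi : j + i - j = i := by omega
  have hw : (0 : ℝ) < 2 ^ i := by positivity
  have hj : (0 : ℝ) < 2 ^ j := by positivity
  have hjw : (2 : ℝ) ^ (j + i) = 2 ^ j * 2 ^ i := pow_add _ _ _
  set lo : Fin n → ℝ := fun q => (m' q : ℝ) / 2 ^ j with hlo
  set c : ℝ := l / 2 ^ (j + i) with hc
  let slab : (Fin n → ℝ) → Fin n → Set (Fin n → ℝ) := fun a q =>
    Set.univ.pi fun q' => if q' = q then Set.Icc (a q) (a q + c)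
      else Set.Icc (lo q') (lo q' + 1 / 2 ^ j)
  have hcov : (⋃ m ∈ {m ∈ subcubes j m' (j + i) | ¬ IsInner l j (j + i) m}, dyadicCube (j + i) m) ⊆
      ⋃ q, (slab lo q ∪ slab (fun q => lo q + 1 / 2 ^ j - c) q) := by
    intro x hx
    simp only [Set.mem_iUnion, exists_prop] at hx
    obtain ⟨m, ⟨hm, hmi⟩, hx⟩ := hx
    have hxj : x ∈ dyadicCube j m' := hm hx
    have hm' := (mem_subcubes_iff hjk).1 hm
    rw [hi] at hm'
    have hIcc : ∀ q', x q' ∈ Set.Icc (lo q') (lo q' + 1 / 2 ^ j) := fun q' =>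
      ⟨(hxj q').1.le, (hxj q').2.le⟩
    have : ∃ q, m q % 2 ^ i < l ∨ 2 ^ i < m q % 2 ^ i + l + 1 := by
      by_contra hcon
      push Not at hcon
      exact hmi fun q => by rw [hi]; exact hcon q
    obtain ⟨q, hq⟩ := this
    refine Set.mem_iUnion.2 ⟨q, ?_⟩
    have hdm := Int.mul_ediv_add_emod (m q) (2 ^ i)
    rw [hm' q] at hdm
    have hxk := mem_dyadicCube.1 hx q
    rcases hq with h | h
    · left
      intro q' _
      by_cases hqq : q' = q
      · subst hqq
        simp only [if_true]
        refine ⟨(hIcc q').1, ?_⟩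
        have h1 : m q' + 1 ≤ 2 ^ i * m' q' + l := by linarith
        have h2 : (m q' : ℝ) + 1 ≤ 2 ^ i * m' q' + l := by exact_mod_cast h1
        have e : lo q' + c = (2 ^ i * m' q' + l) / 2 ^ (j + i) := by
          simp only [hlo, hc, hjw]; field_simp
        rw [e, le_div_iff₀ (by positivity)]
        linarith [hxk.2]
      · simp only [hqq, if_false]
        exact hIcc q'
    · right
      intro q' _
      by_cases hqq : q' = q
      · subst hqq
        simp only [if_true]
        refine ⟨?_, by linarith [(hIcc q').2]⟩
        have h1 : 2 ^ i * m' q' + 2 ^ i - l ≤ m q' := by linarith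
        have h2 : (2 : ℝ) ^ i * m' q' + 2 ^ i - l ≤ m q' := by exact_mod_cast h1
        have e : lo q' + 1 / 2 ^ j - c = (2 ^ i * m' q' + 2 ^ i - l) / 2 ^ (j + i) := by
          simp only [hlo, hc, hjw]; field_simp
        rw [e, div_le_iff₀ (by positivity)]
        linarith [hxk.1]
      · simp only [hqq, if_false]
        exact hIcc q'
  have hvol : ∀ a q, volume (slab a q) ≤ ENNReal.ofReal (l * (2 ^ j / 2 ^ (j + i))) *
      volume (dyadicCube j m') := by
    intro a q
    simp only [slab]
    rw [volume_pi_pi, dyadicCube, volume_openCube, ← Finset.card_univ, ← Finset.prod_const]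
    have : ∀ q' : Fin n, volume (if q' = q then Set.Icc (a q) (a q + c)
        else Set.Icc (lo q') (lo q' + 1 / 2 ^ j)) =
        (if q' = q then ENNReal.ofReal (l * (2 ^ j / 2 ^ (j + i))) else 1) *
          ENNReal.ofReal (1 / 2 ^ j) := by
      intro q'
      split_ifs
      · rw [Real.volume_Icc, ← ENNReal.ofReal_mul (by positivity)]
        congr 1
        simp only [hc]
        field_simp
        ring
      · rw [Real.volume_Icc, one_mul]
        congr 1
        ring
    simp only [this]
    rw [Finset.prod_mul_distrib, Finset.prod_ite_eq']
    simp
  refine (measure_mono hcov).trans ((measure_iUnion_le _).trans ?_)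
  rw [tsum_fintype]
  calc ∑ q, volume (slab lo q ∪ slab (fun q => lo q + 1 / 2 ^ j - c) q)
      ≤ ∑ _q : Fin n, (2 * (ENNReal.ofReal (l * (2 ^ j / 2 ^ (j + i))) *
          volume (dyadicCube j m'))) := by
        refine Finset.sum_le_sum fun q _ => (measure_union_le _ _).trans ?_
        rw [two_mul]
        exact add_le_add (hvol lo q) (hvol (fun q => lo q + 1 / 2 ^ j - c) q)
    _ = _ := by
        rw [Finset.sum_const, Finset.card_univ, Fintype.card_fin, nsmul_eq_mul, ← mul_assoc,
          ← mul_assoc]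
        congr 1
        rw [show (2 : ℝ) * l * n * (2 ^ j / 2 ^ (j + i)) = n * 2 * (l * (2 ^ j / 2 ^ (j + i))) by ring,
          ENNReal.ofReal_mul (by positivity), ENNReal.ofReal_mul (by positivity)]
        simp

theorem ofReal_two_pow_div (j k : ℕ) :
    ENNReal.ofReal (2 ^ j / 2 ^ k) = (2 : ℝ≥0∞) ^ ((j : ℝ) - k) := by
  rw [ENNReal.ofReal_div_of_pos (by positivity), ENNReal.ofReal_pow (by norm_num),
    ENNReal.ofReal_pow (by norm_num), ENNReal.rpow_sub _ _ (by norm_num) (by norm_num),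
    ENNReal.rpow_natCast, ENNReal.rpow_natCast]
  simp

/-- The defining inequality of `δ₂` is applied with `G` the boundary layer, whose volume fraction is
at most `2 l n 2^{j-k}`. If `δ₂ - ε ≤ 0`, a part of the sum is trivially at most the whole. -/
theorem tsum_gammaHat_boundary_le_delta2 (p : ℝ) (γ : (Fin n ⊕ Fin d → ℝ) → ℝ) (l : ℕ) {ε : ℝ}
    (hε : 0 < ε) :
    ∃ C : ℝ≥0, ∀ (j k : ℕ), j ≤ k → ∀ m' : Fin n → ℤ,
      ∑' m : {m ∈ subcubes j m' k | ¬ IsInner l j k m}, gammaHat γ p k m ^ p ≤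
        C * (2 : ℝ≥0∞) ^ (((j : ℝ) - k) * (delta2 γ p - ε)) *
          ∑' m : subcubes j m' k, gammaHat γ p k m ^ p := by
  have hneg : ∀ j k : ℕ, j ≤ k → ((j : ℝ) - k) ≤ 0 := by
    intro j k hjk
    have : (j : ℝ) ≤ k := by exact_mod_cast hjk
    linarith
  by_cases h : 0 < delta2 γ p - ε
  · have hlt : delta2 γ p - ε < delta2 γ p := by linarith
    have hne : Set.Nonempty {δ : ℝ | 0 < δ ∧ ∃ C : ℝ≥0, ∀ (k j : ℕ), k ≤ j → ∀ m : Fin n → ℤ,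
        ∀ G : Set (Fin n → ℤ), G ⊆ subcubes k m j →
          ∑' m' : G, gammaHat γ p j m' ^ p ≤
            C * (volume (⋃ m' ∈ G, dyadicCube j m') / volume (dyadicCube k m)) ^ δ *
              ∑' m' : subcubes k m j, gammaHat γ p j m' ^ p} := by
      by_contra hcon
      rw [Set.not_nonempty_iff_eq_empty] at hcon
      have : delta2 γ p = 0 := by rw [delta2, hcon, Real.sSup_empty]
      linarith
    obtain ⟨δ, ⟨hδ0, C, hC⟩, hδ⟩ := exists_lt_of_lt_csSup hne hlt
    refine ⟨C * (2 * l * n) ^ δ, fun j k hjk m' =>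
      (hC j k hjk m' _ (Set.sep_subset _ _)).trans ?_⟩
    refine mul_le_mul' ?_ le_rfl
    push_cast [ENNReal.coe_rpow_of_nonneg _ hδ0.le]
    rw [mul_assoc]
    refine mul_le_mul' le_rfl ?_
    have hratio : volume (⋃ m ∈ {m ∈ subcubes j m' k | ¬ IsInner l j k m}, dyadicCube k m) /
        volume (dyadicCube j m') ≤ (2 * l * n) * (2 : ℝ≥0∞) ^ ((j : ℝ) - k) := by
      refine ENNReal.div_le_of_le_mul ((volume_boundary_le l hjk m').trans_eq ?_)
      congr 1
      rw [ENNReal.ofReal_mul (by positivity), ofReal_two_pow_div,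
        ENNReal.ofReal_mul (by positivity), ENNReal.ofReal_mul (by positivity)]
      simp
    refine (ENNReal.rpow_le_rpow hratio hδ0.le).trans ?_
    rw [ENNReal.mul_rpow_of_nonneg _ _ hδ0.le, ← ENNReal.rpow_mul]
    refine mul_le_mul' le_rfl ?_
    exact ENNReal.rpow_le_rpow_of_exponent_le (by norm_num)
      (mul_le_mul_of_nonpos_left hδ.le (hneg j k hjk))
  · refine ⟨1, fun j k hjk m' => ?_⟩
    have h1 : (1 : ℝ≥0∞) ≤ (2 : ℝ≥0∞) ^ (((j : ℝ) - k) * (delta2 γ p - ε)) :=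
      one_le_two_rpow
        (mul_nonneg_of_nonpos_of_nonpos (hneg j k hjk) (not_lt.1 h))
    refine le_trans ?_ (le_mul_of_one_le_left (by positivity) (by simpa using h1))
    exact ENNReal.tsum_mono_subtype (fun m => gammaHat γ p k m ^ p) (Set.sep_subset _ _)

end Gamma

/-! ### The weight sequence -/

theorem norm_toLp_le {n : ℕ} (v : Fin n → ℝ) {b : ℝ} (hb : 0 ≤ b) (h : ∀ i, |v i| ≤ b) :
    ‖WithLp.toLp 2 v‖ ≤ n * b := by
  refine le_of_sq_le_sq ?_ (by positivity)
  rw [EuclideanSpace.real_norm_sq_eq]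
  calc ∑ i, v i ^ 2 ≤ ∑ _i : Fin n, b ^ 2 :=
        Finset.sum_le_sum fun i _ => sq_le_sq.2 (by rw [abs_of_nonneg hb]; exact h i)
    _ = n * b ^ 2 := by simp
    _ ≤ (n * b) ^ 2 := by
        rw [mul_pow]
        gcongr
        have : n ≤ n ^ 2 := Nat.le_self_pow (by norm_num) n
        exact_mod_cast this

section LocY

variable {n : ℕ} {α₁ α₂ α₃ C₁ : ℝ} {s : ℕ → (Fin n → ℝ) → ℝ}

theorem LocY.compare_chain (hs : LocY α₁ α₂ α₃ C₁ s) (k M : ℕ) : ∀ x y : Fin n → ℝ,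
    ‖WithLp.toLp 2 (x - y)‖ ≤ M * (1 / 2 ^ k) → s k x ≤ ((2 : ℝ) ^ α₃) ^ M * s k y := by
  induction M with
  | zero =>
    intro x y h
    have h0 : WithLp.toLp 2 (x - y) = 0 := by
      rw [← norm_le_zero_iff]
      simpa using h
    have : x - y = 0 := (WithLp.toLp_eq_zero 2).1 h0
    simp [sub_eq_zero.1 this]
  | succ M ih =>
    intro x y h
    have hM : (0 : ℝ) < M + 1 := by positivity
    set z : Fin n → ℝ := y + (1 / (M + 1) : ℝ) • (x - y) with hz
    have e1 : x - z = (M / (M + 1) : ℝ) • (x - y) := by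
      funext i
      simp only [hz, Pi.sub_apply, Pi.add_apply, Pi.smul_apply, smul_eq_mul]
      field_simp
      ring
    have e2 : z - y = (1 / (M + 1) : ℝ) • (x - y) := by simp [hz]
    have h1 : ‖WithLp.toLp 2 (x - z)‖ ≤ M * (1 / 2 ^ k) := by
      rw [e1, WithLp.toLp_smul, norm_smul, Real.norm_of_nonneg (by positivity)]
      calc (M / (M + 1) : ℝ) * ‖WithLp.toLp 2 (x - y)‖
          ≤ (M / (M + 1) : ℝ) * ((M + 1 : ℕ) * (1 / 2 ^ k)) := by gcongr
        _ = M * (1 / 2 ^ k) := by push_cast; field_simp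
    have h2 : dist (WithLp.toLp 2 z) (WithLp.toLp 2 y) ≤ 1 / 2 ^ k := by
      rw [dist_eq_norm, ← WithLp.toLp_sub, e2, WithLp.toLp_smul, norm_smul,
        Real.norm_of_nonneg (by positivity)]
      calc (1 / (M + 1) : ℝ) * ‖WithLp.toLp 2 (x - y)‖
          ≤ (1 / (M + 1) : ℝ) * ((M + 1 : ℕ) * (1 / 2 ^ k)) := by gcongr
        _ = 1 / 2 ^ k := by push_cast; field_simp
    calc s k x ≤ ((2 : ℝ) ^ α₃) ^ M * s k z := ih x z h1
      _ ≤ ((2 : ℝ) ^ α₃) ^ M * ((2 : ℝ) ^ α₃ * s k y) := by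
          gcongr
          exact hs.compare k z y h2
      _ = ((2 : ℝ) ^ α₃) ^ (M + 1) * s k y := by ring

/-- Coordinate distances of `M` cells give a Euclidean distance of at most `n * M` cells, hence `n *
M` comparisons at generation `j` after the growth condition has been used at `x`. -/
theorem LocY.le_of_close (hs : LocY α₁ α₂ α₃ C₁ s) {j k : ℕ} (hjk : j ≤ k) (M : ℕ)
    {x y : Fin n → ℝ} (h : ∀ i, |x i - y i| ≤ M * (1 / 2 ^ j)) :
    s k x ≤ (C₁ * ((2 : ℝ) ^ α₃) ^ (n * M)) * (2 : ℝ) ^ (α₂ * ((k : ℝ) - j)) * s j y := by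
  have hj := (hs.isWeight j).2 x
  have h1 := hs.upper j k hjk x
  rw [div_le_iff₀ hj] at h1
  have hC : 0 < C₁ * (2 : ℝ) ^ (α₂ * ((k : ℝ) - j)) := by
    refine lt_of_lt_of_le (div_pos ((hs.isWeight k).2 x) hj) (hs.upper j k hjk x)
  have h2 := hs.compare_chain j (n * M) x y (by
    refine (norm_toLp_le (x - y) (by positivity) h).trans_eq ?_
    push_cast; ring)
  calc s k x ≤ C₁ * (2 : ℝ) ^ (α₂ * ((k : ℝ) - j)) * s j x := h1
    _ ≤ C₁ * (2 : ℝ) ^ (α₂ * ((k : ℝ) - j)) * (((2 : ℝ) ^ α₃) ^ (n * M) * s j y) := by gcongr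
    _ = _ := by ring

/-- A pointwise comparison passes to mean values; multiplying out the volumes avoids divisions, and
no measurability of `f` or `g` is needed. -/
theorem volume_mul_setLIntegral_le {X : Type*} [MeasurableSpace X] {μ : Measure X} {A B : Set X}
    (hA : MeasurableSet A) (hB : MeasurableSet B) {f g : X → ℝ≥0∞} {K : ℝ≥0∞} (hK : K ≠ ∞)
    (hAt : μ A ≠ ∞) (h : ∀ x ∈ A, ∀ y ∈ B, f x ≤ K * g y) :
    μ B * ∫⁻ x in A, f x ∂μ ≤ K * (μ A * ∫⁻ y in B, g y ∂μ) := by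
  have h1 : ∀ y ∈ B, ∫⁻ x in A, f x ∂μ ≤ (K * μ A) * g y := by
    intro y hy
    calc ∫⁻ x in A, f x ∂μ ≤ ∫⁻ _x in A, K * g y ∂μ := setLIntegral_mono' hA fun x hx => h x hx y hy
      _ = (K * μ A) * g y := by rw [setLIntegral_const]; ring
  calc μ B * ∫⁻ x in A, f x ∂μ = ∫⁻ _y in B, (∫⁻ x in A, f x ∂μ) ∂μ := by
        rw [setLIntegral_const, mul_comm]
    _ ≤ ∫⁻ y in B, (K * μ A) * g y ∂μ := setLIntegral_mono' hB h1
    _ = _ := by rw [lintegral_const_mul' _ _ (ENNReal.mul_ne_top hK hAt), mul_assoc]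

theorem volume_dyadicCube {n : ℕ} (k : ℕ) (m : Fin n → ℤ) :
    volume (dyadicCube k m) = (2 : ℝ≥0∞) ^ (-((k : ℝ) * n)) := by
  rw [dyadicCube, volume_openCube, Fintype.card_fin, ENNReal.rpow_neg, one_div,
    ENNReal.ofReal_inv_of_pos (by positivity), ENNReal.ofReal_pow (by norm_num), ENNReal.rpow_mul,
    ENNReal.rpow_natCast, ENNReal.rpow_natCast, ← ENNReal.inv_pow]
  simp

/-- `2^{kn} ∫_{Q_{k,m}} s_k^p`, the mean value of `s_k^p` on `Q_{k,m}`. -/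
noncomputable def avgWeight {n : ℕ} (s : ℕ → (Fin n → ℝ) → ℝ) (p : ℝ) (k : ℕ) (m : Fin n → ℤ) :
    ℝ≥0∞ :=
  (2 : ℝ≥0∞) ^ ((k : ℝ) * n) * ∫⁻ x in dyadicCube k m, ‖s k x‖ₑ ^ p

/-- Decouples the two weights: the first factor varies pointwise in a controlled way, while the
second is controlled only through sums over cubes. -/
theorem tSeq_rpow {d : ℕ} (s : ℕ → (Fin n → ℝ) → ℝ) (γ : (Fin n ⊕ Fin d → ℝ) → ℝ) {p : ℝ}
    (hp : 0 < p) (k : ℕ) (m : Fin n → ℤ) :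
    tSeq s γ p k m ^ p = avgWeight s p k m * gammaHat γ p k m ^ p := by
  rw [tSeq, ENNReal.mul_rpow_of_nonneg _ _ hp.le, ENNReal.mul_rpow_of_nonneg _ _ hp.le,
    lpNormOn_eq _ hp, ← ENNReal.rpow_mul, ← ENNReal.rpow_mul, one_div_mul_cancel hp.ne',
    ENNReal.rpow_one, div_mul_cancel₀ _ hp.ne', avgWeight]

theorem LocY.avgWeight_le (hs : LocY α₁ α₂ α₃ C₁ s) {p : ℝ} (hp : 0 < p) {j k : ℕ} (hjk : j ≤ k)
    (M : ℕ) {m m' : Fin n → ℤ}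
    (h : ∀ x ∈ dyadicCube k m, ∀ y ∈ dyadicCube j m', ∀ i, |x i - y i| ≤ M * (1 / 2 ^ j)) :
    avgWeight s p k m ≤ ENNReal.ofReal (C₁ * ((2 : ℝ) ^ α₃) ^ (n * M)) ^ p *
      (2 : ℝ≥0∞) ^ (((k : ℝ) - j) * α₂ * p) * avgWeight s p j m' := by
  have hC : 0 ≤ C₁ := by
    have h1 := hs.upper 0 0 le_rfl 0
    have h2 := (hs.isWeight 0).2 0
    rw [div_self h2.ne'] at h1
    simp at h1
    linarith
  set K : ℝ≥0∞ := ENNReal.ofReal (C₁ * ((2 : ℝ) ^ α₃) ^ (n * M)) ^ p *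
      (2 : ℝ≥0∞) ^ (((k : ℝ) - j) * α₂ * p) with hK
  have hKt : K ≠ ∞ := by
    refine ENNReal.mul_ne_top (ENNReal.rpow_ne_top_of_nonneg hp.le ENNReal.ofReal_ne_top) ?_
    exact ENNReal.rpow_ne_top_of_ne_zero (by norm_num) (by norm_num)
  have hpt : ∀ x ∈ dyadicCube k m, ∀ y ∈ dyadicCube j m', ‖s k x‖ₑ ^ p ≤ K * ‖s j y‖ₑ ^ p := by
    intro x hx y hy
    have h1 := hs.le_of_close hjk M (h x hx y hy)
    rw [Real.enorm_of_nonneg ((hs.isWeight k).2 x).le, Real.enorm_of_nonneg ((hs.isWeight j).2 y).le]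
    have h2 := ENNReal.rpow_le_rpow (ENNReal.ofReal_le_ofReal h1) hp.le
    refine h2.trans_eq ?_
    rw [ENNReal.ofReal_mul (by positivity), ENNReal.ofReal_mul (by positivity),
      ENNReal.mul_rpow_of_nonneg _ _ hp.le, ENNReal.mul_rpow_of_nonneg _ _ hp.le, hK]
    congr 2
    rw [← ENNReal.ofReal_rpow_of_pos (by norm_num), ← ENNReal.rpow_mul]
    simp only [ENNReal.ofReal_ofNat]
    congr 1
    ring
  have h2 : ∀ x : ℝ, (2 : ℝ≥0∞) ^ (-x) ≠ ∞ := fun x =>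
    ENNReal.rpow_ne_top_of_ne_zero (by norm_num) (by norm_num)
  have hmeas : ∀ (i : ℕ) (m : Fin n → ℤ), MeasurableSet (dyadicCube i m) := fun _ _ =>
    measurableSet_openCube _ _
  have hmain := volume_mul_setLIntegral_le (μ := volume) (hmeas k m) (hmeas j m') hKt
    (by rw [volume_dyadicCube]; exact h2 _) hpt
  rw [volume_dyadicCube, volume_dyadicCube] at hmain
  have hcancel : ∀ x : ℝ, (2 : ℝ≥0∞) ^ x * (2 : ℝ≥0∞) ^ (-x) = 1 := by
    intro x
    rw [← ENNReal.rpow_add _ _ (by norm_num) (by norm_num)]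
    simp
  calc avgWeight s p k m
      = ((2 : ℝ≥0∞) ^ ((j : ℝ) * n) * (2 : ℝ≥0∞) ^ (-((j : ℝ) * n))) *
        ((2 : ℝ≥0∞) ^ ((k : ℝ) * n) * ∫⁻ x in dyadicCube k m, ‖s k x‖ₑ ^ p) := by
        rw [hcancel, one_mul, avgWeight]
    _ = ((2 : ℝ≥0∞) ^ ((j : ℝ) * n) * (2 : ℝ≥0∞) ^ ((k : ℝ) * n)) *
        ((2 : ℝ≥0∞) ^ (-((j : ℝ) * n)) * ∫⁻ x in dyadicCube k m, ‖s k x‖ₑ ^ p) := by ring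
    _ ≤ ((2 : ℝ≥0∞) ^ ((j : ℝ) * n) * (2 : ℝ≥0∞) ^ ((k : ℝ) * n)) *
        (K * ((2 : ℝ≥0∞) ^ (-((k : ℝ) * n)) * ∫⁻ y in dyadicCube j m', ‖s j y‖ₑ ^ p)) :=
        mul_le_mul' le_rfl hmain
    _ = ((2 : ℝ≥0∞) ^ ((k : ℝ) * n) * (2 : ℝ≥0∞) ^ (-((k : ℝ) * n))) *
        (K * ((2 : ℝ≥0∞) ^ ((j : ℝ) * n) * ∫⁻ y in dyadicCube j m', ‖s j y‖ₑ ^ p)) := by ring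
    _ = K * avgWeight s p j m' := by rw [hcancel, one_mul, avgWeight]

end LocY

/-! ### Comparison of the sequence `t_{k,m}` between cubes and generations. -/

section TSeq

variable {n d : ℕ} {γ : (Fin n ⊕ Fin d → ℝ) → ℝ} {p : ℝ}

theorem abs_sub_le_of_mem_dyadicCube {j : ℕ} {m m' : Fin n → ℤ} {L : ℕ}
    (h : ∀ i, |m i - m' i| ≤ L) {x y : Fin n → ℝ} (hx : x ∈ dyadicCube j m)
    (hy : y ∈ dyadicCube j m') (i : Fin n) : |x i - y i| ≤ (L + 1 : ℕ) * (1 / 2 ^ j) := by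
  have h1 := mem_dyadicCube.1 hx i
  have h2 := mem_dyadicCube.1 hy i
  have h3 : |(m i : ℝ) - m' i| ≤ L := by exact_mod_cast h i
  rw [abs_le] at h3
  have hj : (0 : ℝ) < 2 ^ j := by positivity
  rw [mul_one_div, abs_le, ← neg_div, div_le_iff₀ hj, le_div_iff₀ hj]
  push_cast
  constructor <;> linarith [h3.1, h3.2, h1.1, h1.2, h2.1, h2.2]

theorem tSeq_neighbour_le (hd : 0 < d) (hp : 0 < p) (hγ : IsWeight γ)
    (hγp : ALocInfty (fun z => γ z ^ p)) (α₁ α₂ α₃ C₁ : ℝ) (L : ℕ) :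
    ∃ C : ℝ≥0, ∀ s : ℕ → (Fin n → ℝ) → ℝ, LocY α₁ α₂ α₃ C₁ s → ∀ (k : ℕ) (m m' : Fin n → ℤ),
      (∀ i, |m i - m' i| ≤ L) → tSeq s γ p k m ^ p ≤ C * tSeq s γ p k m' ^ p := by
  obtain ⟨C, hC⟩ := gammaHat_neighbour_le (n := n) hd hp hγ hγp L
  refine ⟨(C₁ * ((2 : ℝ) ^ α₃) ^ (n * (L + 1))).toNNReal ^ p * C, fun s hs k m m' h => ?_⟩
  rw [tSeq_rpow s γ hp, tSeq_rpow s γ hp]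
  have h1 := hs.avgWeight_le hp (le_refl k) (L + 1) (m := m) (m' := m')
    (fun x hx y hy => abs_sub_le_of_mem_dyadicCube h hx hy)
  simp only [sub_self, zero_mul, ENNReal.rpow_zero, mul_one] at h1
  refine (mul_le_mul' h1 (hC k m m' h)).trans_eq ?_
  rw [ENNReal.coe_mul, ENNReal.coe_rpow_of_nonneg _ hp.le, ENNReal.ofReal]
  ring

open Classical in
/-- The exponential rates in the interior and in the boundary layer. -/
noncomputable def layerRate {n : ℕ} (l j k : ℕ) (m : Fin n → ℤ) : ℝ≥0∞ :=
  if IsInner l j k m then (2 : ℝ≥0∞) ^ (((j : ℝ) - k) * l) else 2 ^ (((j : ℝ) - k) * (l - 1))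

theorem two_rpow_add (x y : ℝ) : (2 : ℝ≥0∞) ^ (x + y) = 2 ^ x * 2 ^ y :=
  ENNReal.rpow_add _ _ (by norm_num) (by norm_num)

/-- Here the exponent `rate` arises. The means of `s_k^p` grow by at most `2^{(k-j) α₂ p}`; the sum
of `γ̂^p` over all subcubes decays through `δ₁`; the boundary layer has only the rate `l - 1` but
gains the factor given by `δ₂`. -/
theorem tsum_layerRate_tSeq_le (hd : 0 < d) (hp : 0 < p) (hγ : IsWeight γ)
    (hγp : ALocInfty (fun z => γ z ^ p)) (α₁ α₂ α₃ C₁ : ℝ) (l : ℕ) {ε : ℝ} (hε : 0 < ε) :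
    ∃ C : ℝ≥0, ∀ s : ℕ → (Fin n → ℝ) → ℝ, LocY α₁ α₂ α₃ C₁ s → ∀ (j k : ℕ), j ≤ k →
      ∀ m' : Fin n → ℤ,
      ∑' m : subcubes j m' k, layerRate l j k m.1 ^ p * tSeq s γ p k m ^ p ≤
        C * (2 : ℝ≥0∞) ^ (((j : ℝ) - k) * rate l p α₂ ε γ * p) * tSeq s γ p j m' ^ p := by
  obtain ⟨D₁, hD₁⟩ := tsum_gammaHat_le_delta1 (n := n) hd hp hγ hγp hε
  obtain ⟨D₂, hD₂⟩ := tsum_gammaHat_boundary_le_delta2 (n := n) p γ l hε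
  set K : ℝ≥0 := (C₁ * ((2 : ℝ) ^ α₃) ^ (n * 1)).toNNReal ^ p with hK
  refine ⟨K * ((1 + D₂) * D₁), fun s hs j k hjk m' => ?_⟩
  set A : ℝ≥0∞ := K * (2 : ℝ≥0∞) ^ (((k : ℝ) - j) * α₂ * p) * avgWeight s p j m' with hA
  have hjk' : (j : ℝ) - k ≤ 0 := by
    have : (j : ℝ) ≤ k := by exact_mod_cast hjk
    linarith
  have hAle : ∀ m ∈ subcubes j m' k, avgWeight s p k m ≤ A := by
    intro m hm
    refine (hs.avgWeight_le hp hjk 1 (m := m) (m' := m') fun x hx y hy i => ?_).trans_eq ?_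
    · exact abs_sub_le_of_mem_dyadicCube (L := 0) (by simp) (hm hx) hy i
    · rw [hA, hK, ENNReal.coe_rpow_of_nonneg _ hp.le, ENNReal.ofReal]
  set E₁ : ℝ≥0∞ := (2 : ℝ≥0∞) ^ (((j : ℝ) - k) * l * p) with hE₁
  set E₂ : ℝ≥0∞ := (2 : ℝ≥0∞) ^ (((j : ℝ) - k) * (l - 1) * p) with hE₂
  set sub := subcubes j m' k with hsub
  set bd := {m ∈ subcubes j m' k | ¬ IsInner l j k m} with hbd
  set g : (Fin n → ℤ) → ℝ≥0∞ := fun m => gammaHat γ p k m ^ p with hg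
  -- The interior rate is charged to every subcube and the boundary rate is added on the layer, so
  -- that both sums fit the available estimates.
  have hpt : ∀ m, sub.indicator (fun m => layerRate l j k m ^ p * tSeq s γ p k m ^ p) m ≤
      A * (E₁ * sub.indicator g m + E₂ * bd.indicator g m) := by
    intro m
    by_cases hm : m ∈ sub
    · rw [Set.indicator_of_mem hm, Set.indicator_of_mem hm, tSeq_rpow s γ hp]
      by_cases hi : IsInner l j k m
      · have hl : layerRate l j k m ^ p = E₁ := by
          rw [layerRate, if_pos hi, ← ENNReal.rpow_mul]
        rw [hl]
        calc E₁ * (avgWeight s p k m * gammaHat γ p k m ^ p)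
            ≤ E₁ * (A * g m) := by gcongr; exact hAle m hm
          _ = A * (E₁ * g m) := by ring
          _ ≤ _ := by gcongr; exact le_self_add
      · have hl : layerRate l j k m ^ p = E₂ := by
          rw [layerRate, if_neg hi, ← ENNReal.rpow_mul]
        have hmb : m ∈ bd := ⟨hm, hi⟩
        rw [hl, Set.indicator_of_mem hmb]
        calc E₂ * (avgWeight s p k m * gammaHat γ p k m ^ p)
            ≤ E₂ * (A * g m) := by gcongr; exact hAle m hm
          _ = A * (E₂ * g m) := by ring
          _ ≤ _ := by gcongr; exact le_add_self
    · rw [Set.indicator_of_notMem hm]; exact zero_le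
  rw [tsum_subtype sub (fun m => layerRate l j k m ^ p * tSeq s γ p k m ^ p)]
  -- Collects the exponents: `lam` is at most both competing rates, and `(j : ℝ) - k ≤ 0` reverses
  -- the comparison.
  have hΔ : (2 : ℝ≥0∞) ^ (((k : ℝ) - j) * α₂ * p) * ((E₁ + E₂ *
      (2 : ℝ≥0∞) ^ (((j : ℝ) - k) * (delta2 γ p - ε)) * D₂) *
        (2 : ℝ≥0∞) ^ (((j : ℝ) - k) * d * (delta1 γ p - ε))) ≤
      (1 + D₂) * (2 : ℝ≥0∞) ^ (((j : ℝ) - k) * rate l p α₂ ε γ * p) := by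
    set lam : ℝ := min (l : ℝ) ((l : ℝ) - 1 + (delta2 γ p - ε) / p) with hlam
    have e1 : E₁ ≤ (2 : ℝ≥0∞) ^ (((j : ℝ) - k) * (lam * p)) := by
      rw [hE₁, mul_assoc]
      refine ENNReal.rpow_le_rpow_of_exponent_le (by norm_num)
        (mul_le_mul_of_nonpos_left ?_ hjk')
      gcongr
      exact min_le_left _ _
    have e2 : E₂ * (2 : ℝ≥0∞) ^ (((j : ℝ) - k) * (delta2 γ p - ε)) ≤
        (2 : ℝ≥0∞) ^ (((j : ℝ) - k) * (lam * p)) := by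
      rw [hE₂, ← two_rpow_add, show ((j : ℝ) - k) * (l - 1) * p + ((j : ℝ) - k) * (delta2 γ p - ε) =
        ((j : ℝ) - k) * (((l : ℝ) - 1 + (delta2 γ p - ε) / p) * p) by field_simp]
      refine ENNReal.rpow_le_rpow_of_exponent_le (by norm_num)
        (mul_le_mul_of_nonpos_left ?_ hjk')
      gcongr
      exact min_le_right _ _
    calc _ ≤ (2 : ℝ≥0∞) ^ (((k : ℝ) - j) * α₂ * p) *
          (((2 : ℝ≥0∞) ^ (((j : ℝ) - k) * (lam * p)) +
            (2 : ℝ≥0∞) ^ (((j : ℝ) - k) * (lam * p)) * D₂) *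
        (2 : ℝ≥0∞) ^ (((j : ℝ) - k) * d * (delta1 γ p - ε))) := by gcongr
      _ = (1 + D₂) * ((2 : ℝ≥0∞) ^ (((k : ℝ) - j) * α₂ * p) *
            (2 : ℝ≥0∞) ^ (((j : ℝ) - k) * (lam * p)) *
            (2 : ℝ≥0∞) ^ (((j : ℝ) - k) * d * (delta1 γ p - ε))) := by ring
      _ = _ := by
        rw [← two_rpow_add, ← two_rpow_add]
        congr 2
        rw [rate, ← hlam]
        field_simp
        ring
  calc ∑' m, sub.indicator (fun m => layerRate l j k m ^ p * tSeq s γ p k m ^ p) m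
      ≤ ∑' m, A * (E₁ * sub.indicator g m + E₂ * bd.indicator g m) := ENNReal.tsum_le_tsum hpt
    _ = A * (E₁ * ∑' m : sub, g m + E₂ * ∑' m : bd, g m) := by
        rw [ENNReal.tsum_mul_left, ENNReal.tsum_add, ENNReal.tsum_mul_left, ENNReal.tsum_mul_left,
          tsum_subtype sub g, tsum_subtype bd g]
    _ ≤ A * (E₁ * ∑' m : sub, g m + E₂ *
          (D₂ * (2 : ℝ≥0∞) ^ (((j : ℝ) - k) * (delta2 γ p - ε)) * ∑' m : sub, g m)) := by
        gcongr
        exact hD₂ j k hjk m'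
    _ = A * ((E₁ + E₂ * (2 : ℝ≥0∞) ^ (((j : ℝ) - k) * (delta2 γ p - ε)) * D₂) *
          ∑' m : sub, g m) := by ring
    _ ≤ A * ((E₁ + E₂ * (2 : ℝ≥0∞) ^ (((j : ℝ) - k) * (delta2 γ p - ε)) * D₂) *
          (D₁ * (2 : ℝ≥0∞) ^ (((j : ℝ) - k) * d * (delta1 γ p - ε)) * gammaHat γ p j m' ^ p)) := by
        gcongr
        exact hD₁ j k hjk m'
    _ = K * D₁ * (avgWeight s p j m' * gammaHat γ p j m' ^ p) *
          ((2 : ℝ≥0∞) ^ (((k : ℝ) - j) * α₂ * p) * ((E₁ + E₂ *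
            (2 : ℝ≥0∞) ^ (((j : ℝ) - k) * (delta2 γ p - ε)) * D₂) *
              (2 : ℝ≥0∞) ^ (((j : ℝ) - k) * d * (delta1 γ p - ε)))) := by rw [hA]; ring
    _ ≤ K * D₁ * (avgWeight s p j m' * gammaHat γ p j m' ^ p) *
          ((1 + D₂) * (2 : ℝ≥0∞) ^ (((j : ℝ) - k) * rate l p α₂ ε γ * p)) := by gcongr
    _ = _ := by
        rw [tSeq_rpow s γ hp]
        push_cast
        ring

theorem tSeq_child_le (hd : 0 < d) (hp : 0 < p) (hγ : IsWeight γ)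
    (hγp : ALocInfty (fun z => γ z ^ p)) (α₁ α₂ α₃ C₁ : ℝ) :
    ∃ C : ℝ≥0, ∀ s : ℕ → (Fin n → ℝ) → ℝ, LocY α₁ α₂ α₃ C₁ s → ∀ (j : ℕ) (m m' : Fin n → ℤ),
      m ∈ subcubes j m' (j + 1) → tSeq s γ p (j + 1) m ^ p ≤ C * tSeq s γ p j m' ^ p := by
  obtain ⟨C, hC⟩ := tsum_gammaHat_subcubes_le (n := n) hd hp hγ hγp
  refine ⟨(C₁ * ((2 : ℝ) ^ α₃) ^ (n * 1)).toNNReal ^ p * (2 : ℝ≥0) ^ (α₂ * p) * C,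
    fun s hs j m m' h => ?_⟩
  rw [tSeq_rpow s γ hp, tSeq_rpow s γ hp]
  have h1 := hs.avgWeight_le hp (Nat.le_succ j) 1 (m := m) (m' := m')
    (fun x hx y hy => abs_sub_le_of_mem_dyadicCube (L := 0) (by simp) (h hx) hy)
  have h2 : gammaHat γ p (j + 1) m ^ p ≤ C * gammaHat γ p j m' ^ p :=
    (ENNReal.le_tsum (f := fun m : subcubes j m' (j + 1) => gammaHat γ p (j + 1) m ^ p)
      ⟨m, h⟩).trans (hC j (j + 1) (Nat.le_succ j) m')
  refine (mul_le_mul' h1 h2).trans_eq ?_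
  rw [ENNReal.coe_mul, ENNReal.coe_mul, ENNReal.coe_rpow_of_nonneg _ hp.le, ENNReal.ofReal,
    ENNReal.coe_rpow_of_ne_zero (by norm_num)]
  push_cast
  rw [show ((j : ℝ) + 1 - j) * α₂ * p = α₂ * p by ring]
  ring

end TSeq

/-! ### Averaged differences and cellwise quasi-norms -/

/-- Each term is at most `(∑ a i ^ p) ^ (1 / p)`. The constant is not sharp, but one form serves `p
< 1` and `p ≥ 1` alike. -/
theorem ENNReal_sum_rpow_le {ι : Type*} (s : Finset ι) (a : ι → ℝ≥0∞) {p : ℝ} (hp : 0 < p) :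
    (∑ i ∈ s, a i) ^ p ≤ (s.card : ℝ≥0∞) ^ p * ∑ i ∈ s, a i ^ p := by
  have h1 : ∀ i ∈ s, a i ≤ (∑ i ∈ s, a i ^ p) ^ (1 / p) := by
    intro i hi
    rw [one_div, ENNReal.le_rpow_inv_iff hp]
    exact Finset.single_le_sum (f := fun i => a i ^ p) (fun _ _ => zero_le) hi
  have h2 : ∑ i ∈ s, a i ≤ s.card * (∑ i ∈ s, a i ^ p) ^ (1 / p) := by
    refine (Finset.sum_le_sum h1).trans_eq ?_
    rw [Finset.sum_const, nsmul_eq_mul]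
  refine (ENNReal.rpow_le_rpow h2 hp.le).trans_eq ?_
  rw [ENNReal.mul_rpow_of_nonneg _ _ hp.le, ← ENNReal.rpow_mul, one_div_mul_cancel hp.ne',
    ENNReal.rpow_one]

theorem tsum_Lp_add_le {ι : Type*} (a b : ι → ℝ≥0∞) {q : ℝ} (hq : 1 ≤ q) :
    (∑' i, (a i + b i) ^ q) ^ (1 / q) ≤ (∑' i, a i ^ q) ^ (1 / q) + (∑' i, b i ^ q) ^ (1 / q) := by
  let _ : MeasurableSpace ι := ⊤
  have := ENNReal.lintegral_Lp_add_le (μ := Measure.count) (f := a) (g := b)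
    measurable_from_top.aemeasurable measurable_from_top.aemeasurable hq
  simpa only [lintegral_count, Pi.add_apply] using this

section Diff

variable {n : ℕ}

theorem measurable_fwdDiff_prod {f : (Fin n → ℝ) → ℝ} (hf : Measurable f) (l : ℕ) :
    Measurable fun z : (Fin n → ℝ) × (Fin n → ℝ) => (fwdDiff z.1)^[l] f z.2 := by
  simp only [fwdDiff_iter_eq_sum_shift, zsmul_eq_mul]
  refine Finset.measurable_sum _ fun i _ => Measurable.const_mul (hf.comp ?_) _
  fun_prop

/-- As `μ ≤ 1`, the `μ`-th power is subadditive pointwise; as `r / μ ≥ 1`, Minkowski's inequality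
applies to these powers on the product of the step and point spaces. -/
theorem dyadicDiff_add_rpow_le {f g : (Fin n → ℝ) → ℝ} (hf : Measurable f) (hg : Measurable g)
    (l : ℕ) {r μ : ℝ} (hμ : 0 < μ) (hμ1 : μ ≤ 1) (hμr : μ ≤ r) (k : ℕ) (m : Fin n → ℤ) :
    dyadicDiff l r k m (f + g) ^ μ ≤ dyadicDiff l r k m f ^ μ + dyadicDiff l r k m g ^ μ := by
  have hr : 0 < r := hμ.trans_le hμr
  set ν : Measure ((Fin n → ℝ) × (Fin n → ℝ)) :=
    (volume.restrict (openCube (fun _ : Fin n => -(1 / 2 ^ k : ℝ)) (2 * (1 / 2 ^ k)))).prod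
      (volume.restrict (openCube (fun i => (m i : ℝ) / 2 ^ k) (1 / 2 ^ k))) with hν
  set c : ℝ≥0∞ := (ENNReal.ofReal ((1 / 2 ^ k : ℝ) ^ (2 * n)))⁻¹ with hc
  have key : ∀ u : (Fin n → ℝ) → ℝ, Measurable u → dyadicDiff l r k m u ^ μ =
      c ^ (μ / r) * (∫⁻ z, (‖(fwdDiff z.1)^[l] u z.2‖ₑ ^ μ) ^ (r / μ) ∂ν) ^ (1 / (r / μ)) := by
    intro u hu
    have hm : Measurable fun z : (Fin n → ℝ) × (Fin n → ℝ) => ‖(fwdDiff z.1)^[l] u z.2‖ₑ ^ r :=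
      (measurable_fwdDiff_prod hu l).enorm.pow_const r
    simp only [← ENNReal.rpow_mul, mul_div_cancel₀ r hμ.ne']
    rw [hν, lintegral_prod _ hm.aemeasurable, dyadicDiff, localDiff, ← ENNReal.rpow_mul,
      ENNReal.mul_rpow_of_nonneg _ _ (by positivity), ← hc]
    congr 2
    · ring
    · field_simp
  rw [key _ (hf.add hg), key f hf, key g hg, ← mul_add]
  refine mul_le_mul' le_rfl ?_
  have hq : 1 ≤ r / μ := by rwa [one_le_div hμ]
  refine le_trans ?_ (ENNReal.lintegral_Lp_add_le
    ((measurable_fwdDiff_prod hf l).enorm.pow_const μ).aemeasurable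
    ((measurable_fwdDiff_prod hg l).enorm.pow_const μ).aemeasurable hq)
  refine ENNReal.rpow_le_rpow (lintegral_mono fun z => ?_) (by positivity)
  refine ENNReal.rpow_le_rpow ?_ (by positivity)
  rw [fwdDiff_iter_add, Pi.add_apply, Pi.add_apply]
  exact (ENNReal.rpow_le_rpow (enorm_add_le _ _) hμ.le).trans
    (ENNReal.rpow_add_le_add_rpow _ _ hμ.le hμ1)

theorem dyadicDiff_congr {f g : (Fin n → ℝ) → ℝ} (h : f =ᵐ[volume] g) (l : ℕ) (r : ℝ) (k : ℕ)
    (m : Fin n → ℤ) : dyadicDiff l r k m f = dyadicDiff l r k m g := by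
  unfold dyadicDiff localDiff
  congr 2
  refine lintegral_congr fun v => lintegral_congr_ae (ae_restrict_of_ae ?_)
  have h1 : ∀ i : ℕ, ∀ᵐ x : Fin n → ℝ, f (x + i • v) = g (x + i • v) := fun i =>
    (measurePreserving_add_right volume (i • v)).quasiMeasurePreserving.ae h
  filter_upwards [ae_all_iff.2 h1] with x hx
  simp only [fwdDiff_iter_eq_sum_shift, hx]

/-- The factor `2^{n/r}` appears because the steps fill a cube of twice the side length of
`Q_{k,m}`, while the normalization uses the single side length. -/
theorem dyadicDiff_le_of_bound (l : ℕ) {r : ℝ} (hr : 0 < r) (k : ℕ) (m : Fin n → ℤ)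
    (f : (Fin n → ℝ) → ℝ) (b : ℝ≥0∞)
    (h : ∀ v x : Fin n → ℝ, (∀ q, |2 ^ k * v q| ≤ 1) → x ∈ dyadicCube k m →
      ‖(fwdDiff v)^[l] f x‖ₑ ≤ b) :
    dyadicDiff l r k m f ≤ (2 : ℝ≥0∞) ^ ((n : ℝ) / r) * b := by
  have hs : (0 : ℝ) < 1 / 2 ^ k := by positivity
  set t : ℝ≥0∞ := ENNReal.ofReal (1 / 2 ^ k) with ht
  have ht0 : t ≠ 0 := by simp [ht]
  have htt : t ≠ ∞ := ENNReal.ofReal_ne_top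
  have hv : ∀ v ∈ openCube (fun _ : Fin n => -(1 / 2 ^ k : ℝ)) (2 * (1 / 2 ^ k)), ∀ q,
      |2 ^ k * v q| ≤ 1 := by
    intro v hv q
    have h1 := hv q
    have h2 : (0 : ℝ) < 2 ^ k := by positivity
    have hvv : |v q| ≤ 1 / 2 ^ k := by
      rw [abs_le]
      constructor <;> linarith [h1.1, h1.2]
    rw [abs_mul, abs_of_pos h2]
    rwa [le_div_iff₀ h2, mul_comm] at hvv
  unfold dyadicDiff localDiff
  calc ((ENNReal.ofReal ((1 / 2 ^ k : ℝ) ^ (2 * n)))⁻¹ *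
        ∫⁻ v in openCube (fun _ : Fin n => -(1 / 2 ^ k : ℝ)) (2 * (1 / 2 ^ k)),
          ∫⁻ x in openCube (fun i => (m i : ℝ) / 2 ^ k) (1 / 2 ^ k),
            ‖(fwdDiff v)^[l] f x‖ₑ ^ r) ^ (1 / r)
      ≤ ((ENNReal.ofReal ((1 / 2 ^ k : ℝ) ^ (2 * n)))⁻¹ *
        ∫⁻ _v in openCube (fun _ : Fin n => -(1 / 2 ^ k : ℝ)) (2 * (1 / 2 ^ k)),
          ∫⁻ _x in openCube (fun i => (m i : ℝ) / 2 ^ k) (1 / 2 ^ k), b ^ r) ^ (1 / r) := by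
        refine ENNReal.rpow_le_rpow (mul_le_mul' le_rfl ?_) (by positivity)
        refine setLIntegral_mono' (measurableSet_openCube _ _) fun v hv' => ?_
        refine setLIntegral_mono' (measurableSet_openCube _ _) fun x hx => ?_
        exact ENNReal.rpow_le_rpow (h v x (hv v hv') hx) hr.le
    _ = ((2 : ℝ≥0∞) ^ (n : ℝ) * b ^ r) ^ (1 / r) := by
        congr 1
        rw [setLIntegral_const, setLIntegral_const, volume_openCube, volume_openCube,
          Fintype.card_fin, ENNReal.ofReal_mul (by norm_num), ENNReal.ofReal_pow hs.le, ← ht,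
          ENNReal.rpow_natCast, mul_pow, ENNReal.ofReal_ofNat]
        have : t ^ (2 * n) = t ^ n * t ^ n := by rw [two_mul, pow_add]
        rw [this]
        have hn0 : t ^ n * t ^ n ≠ 0 := mul_ne_zero (pow_ne_zero _ ht0) (pow_ne_zero _ ht0)
        have hnt : t ^ n * t ^ n ≠ ∞ :=
          ENNReal.mul_ne_top (ENNReal.pow_ne_top htt) (ENNReal.pow_ne_top htt)
        calc (t ^ n * t ^ n)⁻¹ * (b ^ r * t ^ n * (2 ^ n * t ^ n))
            = ((t ^ n * t ^ n)⁻¹ * (t ^ n * t ^ n)) * (2 ^ n * b ^ r) := by ring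
          _ = 2 ^ n * b ^ r := by rw [ENNReal.inv_mul_cancel hn0 hnt, one_mul]
    _ = _ := by
        rw [ENNReal.mul_rpow_of_nonneg _ _ (by positivity), ← ENNReal.rpow_mul, ← ENNReal.rpow_mul,
          mul_one_div_cancel hr.ne', ENNReal.rpow_one, mul_one_div]

/-- The half-open dyadic cube. -/
def halfCube (k : ℕ) (m : Fin n → ℤ) : Set (Fin n → ℝ) := {x | ∀ q, ⌊2 ^ k * x q⌋ = m q}

theorem halfCube_ae_eq (k : ℕ) (m : Fin n → ℤ) : halfCube k m =ᵐ[volume] dyadicCube k m := by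
  have h2 : (0 : ℝ) < 2 ^ k := by positivity
  have h1 : halfCube k m =
      Set.univ.pi fun i => Set.Ico ((m i : ℝ) / 2 ^ k) ((m i : ℝ) / 2 ^ k + 1 / 2 ^ k) := by
    ext x
    simp only [halfCube, Set.mem_ofPred_eq, Set.mem_univ_pi, Set.mem_Ico, Int.floor_eq_iff]
    refine forall_congr' fun q => and_congr ?_ ?_
    · rw [div_le_iff₀ h2, mul_comm]
    · rw [← add_div, lt_div_iff₀ h2, mul_comm]
  rw [h1, dyadicCube, openCube_eq_pi, volume_pi]
  exact Measure.univ_pi_Ico_ae_eq_Icc.trans Measure.univ_pi_Ioo_ae_eq_Icc.symm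

/-- The translated cube is covered by neighbouring half-open cubes, which tile the space without a
null set left out; they are exchanged for open cubes at the end. -/
theorem setLIntegral_translate_le (g : (Fin n → ℝ) → ℝ≥0∞) (k L : ℕ) (m : Fin n → ℤ)
    (v : Fin n → ℝ) (hv : ∀ q, |2 ^ k * v q| ≤ L) :
    ∫⁻ x in dyadicCube k m, g (x + v) ≤
      ∑ e ∈ offsets n L, ∫⁻ x in dyadicCube k (m + e), g x := by
  have hmeas : MeasurableSet (dyadicCube k m) := measurableSet_openCube _ _
  have hmh : ∀ m : Fin n → ℤ, MeasurableSet (halfCube k m) := by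
    intro m
    have : halfCube k m = ⋂ q, {x : Fin n → ℝ | ⌊2 ^ k * x q⌋ = m q} := by
      ext x; simp [halfCube]
    rw [this]
    refine MeasurableSet.iInter fun q => ?_
    have : Measurable fun x : Fin n → ℝ => ⌊2 ^ k * x q⌋ := by fun_prop
    exact this (measurableSet_singleton _)
  set T : Set (Fin n → ℝ) := ⋃ e ∈ offsets n L, halfCube k (m + e) with hT
  have hTm : MeasurableSet T := Finset.measurableSet_biUnion _ fun e _ => hmh _
  calc ∫⁻ x in dyadicCube k m, g (x + v)
      = ∫⁻ x, (dyadicCube k m).indicator (fun x => g (x + v)) x := (lintegral_indicator hmeas _).symm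
    _ ≤ ∫⁻ x, T.indicator g (x + v) := by
        refine lintegral_mono fun x => ?_
        by_cases hx : x ∈ dyadicCube k m
        · have hxT : x + v ∈ T := by
            refine Set.mem_iUnion₂.2 ⟨fun q => ⌊2 ^ k * (x + v) q⌋ - m q, mem_offsets.2 fun q => ?_,
              fun q => by simp⟩
            have h1 := mem_dyadicCube.1 hx q
            have h2 := abs_le.1 (hv q)
            have e1 : (2 : ℝ) ^ k * (x + v) q = 2 ^ k * x q + 2 ^ k * v q := by
              simp [mul_add]
            rw [e1, abs_le]
            constructor
            · have : m q - L ≤ ⌊2 ^ k * x q + 2 ^ k * v q⌋ := by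
                rw [Int.le_floor]
                push_cast
                linarith [h1.1, h2.1]
              linarith
            · have : ⌊2 ^ k * x q + 2 ^ k * v q⌋ < m q + L + 1 := by
                rw [Int.floor_lt]
                push_cast
                linarith [h1.2, h2.2]
              linarith
          rw [Set.indicator_of_mem hx, Set.indicator_of_mem hxT]
        · rw [Set.indicator_of_notMem hx]; exact zero_le
    _ = ∫⁻ x in T, g x := by rw [lintegral_add_right_eq_self, lintegral_indicator hTm]
    _ ≤ ∑ e ∈ offsets n L, ∫⁻ x in halfCube k (m + e), g x := by
        rw [hT]
        have : (⋃ e ∈ offsets n L, halfCube k (m + e)) =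
            ⋃ e : offsets n L, halfCube k (m + e.1) := by
          ext x; simp
        rw [this]
        refine (lintegral_iUnion_le _ _).trans_eq ?_
        rw [tsum_fintype]
        exact Finset.sum_coe_sort (offsets n L) (fun e => ∫⁻ x in halfCube k (m + e), g x)
    _ = _ := Finset.sum_congr rfl fun e _ => setLIntegral_congr (halfCube_ae_eq k (m + e))

theorem enorm_fwdDiff_iter_le (l : ℕ) (f : (Fin n → ℝ) → ℝ) (v x : Fin n → ℝ) :
    ‖(fwdDiff v)^[l] f x‖ₑ ≤ 2 ^ l * ∑ i ∈ Finset.range (l + 1), ‖f (x + i • v)‖ₑ := by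
  rw [fwdDiff_iter_eq_sum_shift, Finset.mul_sum]
  refine (enorm_sum_le _ _).trans (Finset.sum_le_sum fun i hi => ?_)
  rw [zsmul_eq_mul, enorm_mul]
  refine mul_le_mul' ?_ le_rfl
  have h1 : ‖(((-1 : ℤ) ^ (l - i) * (l.choose i : ℤ) : ℤ) : ℝ)‖ = l.choose i := by
    push_cast
    rw [norm_mul, norm_pow, norm_neg, norm_one, one_pow, one_mul, Real.norm_natCast]
  rw [← ofReal_norm, h1, ENNReal.ofReal_natCast]
  have h2 : l.choose i ≤ 2 ^ l := Nat.choose_le_two_pow l i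
  exact_mod_cast h2

theorem dyadicDiff_le_sum_lpNormOn (n l : ℕ) {r : ℝ} (hr : 0 < r) : ∃ C : ℝ≥0,
    ∀ (f : (Fin n → ℝ) → ℝ), Measurable f → ∀ (k : ℕ) (m : Fin n → ℤ),
      dyadicDiff l r k m f ≤ C * ∑ e ∈ offsets n l,
        (2 : ℝ≥0∞) ^ ((k : ℝ) * n / r) * lpNormOn f r (dyadicCube k (m + e)) := by
  set c : ℝ≥0 := ((2 : ℝ≥0) ^ l) ^ r * ((l + 1 : ℕ) : ℝ≥0) ^ r * (l + 1 : ℕ) with hc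
  set N : ℝ≥0 := ((offsets n l).card : ℝ≥0) with hN
  refine ⟨((2 : ℝ≥0) ^ n * c) ^ (1 / r) * N ^ (1 / r), fun f hf k m => ?_⟩
  have hs : (0 : ℝ) < 1 / 2 ^ k := by positivity
  set t : ℝ≥0∞ := ENNReal.ofReal (1 / 2 ^ k) with ht
  have ht0 : t ≠ 0 := by simp [ht]
  have htt : t ≠ ∞ := ENNReal.ofReal_ne_top
  have hti : t⁻¹ = 2 ^ k := by
    rw [ht, one_div, ENNReal.ofReal_inv_of_pos (by positivity), inv_inv,
      ENNReal.ofReal_pow (by norm_num), ENNReal.ofReal_ofNat]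
  set J : ℝ≥0∞ := ∑ e ∈ offsets n l, ∫⁻ x in dyadicCube k (m + e), ‖f x‖ₑ ^ r with hJ
  have hgm : Measurable fun x => ‖f x‖ₑ ^ r := hf.enorm.pow_const r
  have hinner : ∀ v ∈ openCube (fun _ : Fin n => -(1 / 2 ^ k : ℝ)) (2 * (1 / 2 ^ k)),
      ∫⁻ x in openCube (fun i => (m i : ℝ) / 2 ^ k) (1 / 2 ^ k), ‖(fwdDiff v)^[l] f x‖ₑ ^ r ≤
        c * J := by
    intro v hv
    have hvq : ∀ i ∈ Finset.range (l + 1), ∀ q, |2 ^ k * (i • v) q| ≤ l := by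
      intro i hi q
      have h1 := hv q
      have h2 : (0 : ℝ) < 2 ^ k := by positivity
      have hil : (i : ℝ) ≤ l := by
        have : i ≤ l := by simp at hi; omega
        exact_mod_cast this
      have hvv : |v q| ≤ 1 / 2 ^ k := by
        rw [abs_le]
        constructor <;> linarith [h1.1, h1.2]
      have e : (2 : ℝ) ^ k * (i • v) q = i * (2 ^ k * v q) := by simp; ring
      rw [e, abs_mul, abs_mul, Nat.abs_cast, abs_of_pos h2]
      calc (i : ℝ) * (2 ^ k * |v q|) ≤ l * (2 ^ k * (1 / 2 ^ k)) := by gcongr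
        _ = l := by field_simp
    have hpt : ∀ x, ‖(fwdDiff v)^[l] f x‖ₑ ^ r ≤ (((2 : ℝ≥0∞) ^ l) ^ r *
        ((l + 1 : ℕ) : ℝ≥0∞) ^ r) * ∑ i ∈ Finset.range (l + 1), ‖f (x + i • v)‖ₑ ^ r := by
      intro x
      refine (ENNReal.rpow_le_rpow (enorm_fwdDiff_iter_le l f v x) hr.le).trans ?_
      rw [ENNReal.mul_rpow_of_nonneg _ _ hr.le, mul_assoc]
      refine mul_le_mul' le_rfl ?_
      simpa using ENNReal_sum_rpow_le (Finset.range (l + 1)) (fun i => ‖f (x + i • v)‖ₑ) hr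
    refine (lintegral_mono hpt).trans ?_
    rw [lintegral_const_mul _ (by fun_prop), lintegral_finsetSum _ (fun i _ => by fun_prop)]
    calc _ ≤ (((2 : ℝ≥0∞) ^ l) ^ r * ((l + 1 : ℕ) : ℝ≥0∞) ^ r) *
          ∑ i ∈ Finset.range (l + 1), J := by
          refine mul_le_mul' le_rfl (Finset.sum_le_sum fun i hi => ?_)
          exact setLIntegral_translate_le (fun x => ‖f x‖ₑ ^ r) k l m (i • v) (hvq i hi)
      _ = c * J := by
          rw [Finset.sum_const, Finset.card_range, nsmul_eq_mul, hc]
          push_cast [ENNReal.coe_rpow_of_nonneg _ hr.le]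
          ring
  have hroot : J ^ (1 / r) ≤ (N : ℝ≥0∞) ^ (1 / r) *
      ∑ e ∈ offsets n l, lpNormOn f r (dyadicCube k (m + e)) := by
    have := ENNReal_sum_rpow_le (offsets n l)
      (fun e => ∫⁻ x in dyadicCube k (m + e), ‖f x‖ₑ ^ r) (p := 1 / r) (by positivity)
    refine this.trans_eq ?_
    simp only [lpNormOn_eq _ hr, hN]
    push_cast
    rfl
  have hfac : (t ^ (2 * n))⁻¹ * (c * J * (2 ^ n * t ^ n)) = (2 ^ n * c) * (((2 : ℝ≥0∞) ^ k) ^ n * J) := by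
    have h2 : t ^ (2 * n) = t ^ n * t ^ n := by rw [two_mul, pow_add]
    rw [h2, ENNReal.mul_inv (Or.inl (pow_ne_zero _ ht0)) (Or.inl (ENNReal.pow_ne_top htt)),
      ← hti, ← ENNReal.inv_pow]
    calc (t ^ n)⁻¹ * (t ^ n)⁻¹ * (c * J * (2 ^ n * t ^ n))
        = ((t ^ n)⁻¹ * t ^ n) * ((2 ^ n * c) * ((t ^ n)⁻¹ * J)) := by ring
      _ = _ := by
        rw [ENNReal.inv_mul_cancel (pow_ne_zero _ ht0) (ENNReal.pow_ne_top htt), one_mul]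
  unfold dyadicDiff localDiff
  calc _ ≤ ((ENNReal.ofReal ((1 / 2 ^ k : ℝ) ^ (2 * n)))⁻¹ *
        ∫⁻ _v in openCube (fun _ : Fin n => -(1 / 2 ^ k : ℝ)) (2 * (1 / 2 ^ k)), c * J) ^ (1 / r) := by
        refine ENNReal.rpow_le_rpow (mul_le_mul' le_rfl ?_) (by positivity)
        exact setLIntegral_mono' (measurableSet_openCube _ _) hinner
    _ = ((2 ^ n * c) * (((2 : ℝ≥0∞) ^ k) ^ n * J)) ^ (1 / r) := by
        rw [setLIntegral_const, volume_openCube, Fintype.card_fin, ENNReal.ofReal_mul (by norm_num),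
          ENNReal.ofReal_pow hs.le, ← ht, mul_pow, ENNReal.ofReal_ofNat, hfac]
    _ = (2 ^ n * c) ^ (1 / r) * ((2 : ℝ≥0∞) ^ ((k : ℝ) * n / r) * J ^ (1 / r)) := by
        rw [ENNReal.mul_rpow_of_nonneg _ _ (by positivity),
          ENNReal.mul_rpow_of_nonneg (((2 : ℝ≥0∞) ^ k) ^ n) _ (by positivity)]
        congr 2
        rw [← pow_mul, ← ENNReal.rpow_natCast, ← ENNReal.rpow_mul]
        congr 1
        push_cast
        ring
    _ ≤ (2 ^ n * c) ^ (1 / r) * ((2 : ℝ≥0∞) ^ ((k : ℝ) * n / r) * ((N : ℝ≥0∞) ^ (1 / r) *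
          ∑ e ∈ offsets n l, lpNormOn f r (dyadicCube k (m + e)))) := by gcongr
    _ = _ := by
        rw [← Finset.mul_sum]
        push_cast [ENNReal.coe_rpow_of_nonneg _ (show 0 ≤ 1 / r by positivity)]
        ring

end Diff

/-! ### Weighted sums over all cells of one generation. -/

section Sums

variable {n : ℕ}

/-- `∑_m t_{k,m}^p [δ^l_r(Q_{k,m}) f]^p`. -/
noncomputable def diffSum (l : ℕ) (r p : ℝ) (t : ℕ → (Fin n → ℤ) → ℝ≥0∞) (k : ℕ)
    (f : (Fin n → ℝ) → ℝ) : ℝ≥0∞ :=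
  ∑' m, t k m ^ p * dyadicDiff l r k m f ^ p

/-- `∑_m t_{k,m}^p 2^{knp/r} ‖f | L_r(Q_{k,m})‖^p`. -/
noncomputable def cellSum (r p : ℝ) (t : ℕ → (Fin n → ℤ) → ℝ≥0∞) (k : ℕ)
    (f : (Fin n → ℝ) → ℝ) : ℝ≥0∞ :=
  ∑' m, t k m ^ p * ((2 : ℝ≥0∞) ^ ((k : ℝ) * n / r) * lpNormOn f r (dyadicCube k m)) ^ p

/-- Moving the weight to the neighbouring cell makes each offset contribute a translate of the same
sum. -/
theorem tsum_mul_sum_offsets_rpow_le (n L : ℕ) {p : ℝ} (hp : 0 < p) (C₀ : ℝ≥0) :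
    ∃ C : ℝ≥0, ∀ (T a : (Fin n → ℤ) → ℝ≥0∞),
      (∀ m m' : Fin n → ℤ, (∀ i, |m i - m' i| ≤ L) → T m ≤ C₀ * T m') →
      ∑' m, T m * (∑ e ∈ offsets n L, a (m + e)) ^ p ≤ C * ∑' m, T m * a m ^ p := by
  set N : ℝ≥0 := ((offsets n L).card : ℝ≥0) with hN
  refine ⟨N ^ p * C₀ * N, fun T a hT => ?_⟩
  calc ∑' m, T m * (∑ e ∈ offsets n L, a (m + e)) ^ p
      ≤ ∑' m, ((N : ℝ≥0∞) ^ p * C₀) * ∑ e ∈ offsets n L, T (m + e) * a (m + e) ^ p := by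
        refine ENNReal.tsum_le_tsum fun m => ?_
        have h1 := ENNReal_sum_rpow_le (offsets n L) (fun e => a (m + e)) hp
        refine (mul_le_mul' le_rfl h1).trans ?_
        rw [Finset.mul_sum, Finset.mul_sum, Finset.mul_sum]
        refine Finset.sum_le_sum fun e he => ?_
        have h2 : T m ≤ C₀ * T (m + e) := hT m (m + e) fun i => by
          simpa using mem_offsets.1 he i
        calc T m * (((offsets n L).card : ℝ≥0∞) ^ p * a (m + e) ^ p)
            ≤ (C₀ * T (m + e)) * (((offsets n L).card : ℝ≥0∞) ^ p * a (m + e) ^ p) := by gcongr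
          _ = _ := by rw [hN]; push_cast; ring
    _ = ((N : ℝ≥0∞) ^ p * C₀) * ∑ e ∈ offsets n L, ∑' m, T (m + e) * a (m + e) ^ p := by
        rw [ENNReal.tsum_mul_left, Summable.tsum_finsetSum fun e _ => ENNReal.summable]
    _ = ((N : ℝ≥0∞) ^ p * C₀) * ∑ e ∈ offsets n L, ∑' m, T m * a m ^ p := by
        congr 1
        refine Finset.sum_congr rfl fun e _ => ?_
        exact (Equiv.addRight e).tsum_eq (fun m => T m * a m ^ p)
    _ = _ := by
        rw [Finset.sum_const, nsmul_eq_mul, hN]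
        push_cast [ENNReal.coe_rpow_of_nonneg _ hp.le]
        ring

theorem diffSum_add_rpow_le {f g : (Fin n → ℝ) → ℝ} (hf : Measurable f) (hg : Measurable g)
    (l : ℕ) {r p μ : ℝ} (hμ : 0 < μ) (hμ1 : μ ≤ 1) (hμr : μ ≤ r) (hμp : μ ≤ p)
    (t : ℕ → (Fin n → ℤ) → ℝ≥0∞) (k : ℕ) :
    diffSum l r p t k (f + g) ^ (μ / p) ≤
      diffSum l r p t k f ^ (μ / p) + diffSum l r p t k g ^ (μ / p) := by
  have hp : 0 < p := hμ.trans_le hμp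
  have key : ∀ u, diffSum l r p t k u ^ (μ / p) =
      (∑' m, ((t k m ^ μ * dyadicDiff l r k m u ^ μ)) ^ (p / μ)) ^ (1 / (p / μ)) := by
    intro u
    rw [one_div_div, diffSum]
    congr 1
    refine tsum_congr fun m => ?_
    rw [ENNReal.mul_rpow_of_nonneg _ _ (by positivity), ← ENNReal.rpow_mul, ← ENNReal.rpow_mul,
      mul_div_cancel₀ p hμ.ne']
  rw [key, key f, key g]
  refine le_trans ?_ (tsum_Lp_add_le _ _ (by rwa [one_le_div hμ]))
  refine ENNReal.rpow_le_rpow (ENNReal.tsum_le_tsum fun m => ?_) (by positivity)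
  refine ENNReal.rpow_le_rpow ?_ (by positivity)
  rw [← mul_add]
  exact mul_le_mul' le_rfl (dyadicDiff_add_rpow_le hf hg l hμ hμ1 hμr k m)

theorem cellSum_add_le (n : ℕ) {r p : ℝ} (hp : 0 < p) : ∃ C : ℝ≥0,
    ∀ (t : ℕ → (Fin n → ℤ) → ℝ≥0∞) (k : ℕ) (f g : (Fin n → ℝ) → ℝ), Measurable f → Measurable g →
      cellSum r p t k (f + g) ≤ C * (cellSum r p t k f + cellSum r p t k g) := by
  set D : ℝ≥0 := (ENNReal.LpAddConst (ENNReal.ofReal r)).toNNReal with hD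
  have hDe : (D : ℝ≥0∞) = ENNReal.LpAddConst (ENNReal.ofReal r) :=
    ENNReal.coe_toNNReal (ENNReal.LpAddConst_lt_top _).ne
  refine ⟨D ^ p * 2 ^ p, fun t k f g hf hg => ?_⟩
  rw [cellSum, cellSum, cellSum, ← ENNReal.tsum_add, ← ENNReal.tsum_mul_left]
  refine ENNReal.tsum_le_tsum fun m => ?_
  set a := (2 : ℝ≥0∞) ^ ((k : ℝ) * n / r)
  have h1 : lpNormOn (f + g) r (dyadicCube k m) ≤
      D * (lpNormOn f r (dyadicCube k m) + lpNormOn g r (dyadicCube k m)) := by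
    rw [hDe]
    exact eLpNorm_add_le' hf.aestronglyMeasurable hg.aestronglyMeasurable _
  have h2 : ∀ x y : ℝ≥0∞, (x + y) ^ p ≤ 2 ^ p * (x ^ p + y ^ p) := by
    intro x y
    simpa using ENNReal_sum_rpow_le (Finset.univ : Finset Bool) (fun b => if b then x else y) hp
  calc t k m ^ p * (a * lpNormOn (f + g) r (dyadicCube k m)) ^ p
      ≤ t k m ^ p * (D * (a * lpNormOn f r (dyadicCube k m) +
          a * lpNormOn g r (dyadicCube k m))) ^ p := by
        refine mul_le_mul' le_rfl (ENNReal.rpow_le_rpow ?_ hp.le)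
        refine (mul_le_mul' le_rfl h1).trans_eq ?_
        ring
    _ ≤ t k m ^ p * (D ^ p * (2 ^ p * ((a * lpNormOn f r (dyadicCube k m)) ^ p +
          (a * lpNormOn g r (dyadicCube k m)) ^ p))) := by
        rw [ENNReal.mul_rpow_of_nonneg _ _ hp.le]
        gcongr
        exact h2 _ _
    _ = _ := by
        push_cast [ENNReal.coe_rpow_of_nonneg _ hp.le]
        ring

/-- On each half-open cell the spline is a polynomial whose coefficients depend on `x` only through
the floors, that is, through a countable index set. -/
theorem measurable_of_mem_splineSpace {l j : ℕ} (hl : 0 < l) {S : (Fin n → ℝ) → ℝ}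
    (hS : S ∈ splineSpace n l j) : Measurable S := by
  obtain ⟨β, hβ⟩ := hS
  have h1 : S = fun x => ∑ i : Fin n → Fin l,
      β (fun q => ⌊2 ^ j * x q⌋ - (i q : ℕ)) *
        ∏ q, cellPoly l (i q) (2 ^ j * x q - (⌊2 ^ j * x q⌋ : ℤ)) := by
    funext x
    rw [hβ x, spline_eq_cellTensor hl j β (fun q => ⌊2 ^ j * x q⌋) x
      fun q => ⟨Int.floor_le _, Int.lt_floor_add_one _⟩]
    rfl
  rw [h1]
  refine Finset.measurable_sum _ fun i _ => Measurable.mul ?_ ?_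
  · exact (measurable_of_countable β).comp (measurable_pi_lambda _ fun q =>
      (measurable_of_countable fun z : ℤ => z - (i q : ℕ)).comp
        (Int.measurable_floor.comp (by fun_prop)))
  · refine Finset.measurable_prod _ fun q _ => (continuous_cellPoly l _).measurable.comp ?_
    refine Measurable.sub (by fun_prop) ?_
    exact (measurable_of_countable fun z : ℤ => (z : ℝ)).comp
      (Int.measurable_floor.comp (by fun_prop))

/-- Additivity of `finsum` needs finite supports, so all three sums are first localized near the
cell of `x`. -/
theorem sub_mem_splineSpace {l j : ℕ} (hl : 0 < l) {S T : (Fin n → ℝ) → ℝ}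
    (hS : S ∈ splineSpace n l j) (hT : T ∈ splineSpace n l j) : S - T ∈ splineSpace n l j := by
  obtain ⟨β, hβ⟩ := hS
  obtain ⟨β', hβ'⟩ := hT
  refine ⟨β - β', fun x => ?_⟩
  have hx : ∀ q, ((⌊2 ^ j * x q⌋ : ℤ) : ℝ) - l ≤ 2 ^ j * x q ∧
      2 ^ j * x q ≤ ((⌊2 ^ j * x q⌋ : ℤ) : ℝ) + 1 + l := fun q => by
    have := Nat.cast_nonneg (α := ℝ) l
    constructor <;> linarith [Int.floor_le (2 ^ j * x q), Int.lt_floor_add_one (2 ^ j * x q)]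
  rw [Pi.sub_apply, hβ, hβ', spline_eq_sum hl j β (fun q => ⌊2 ^ j * x q⌋) x hx,
    spline_eq_sum hl j β' (fun q => ⌊2 ^ j * x q⌋) x hx,
    spline_eq_sum hl j (β - β') (fun q => ⌊2 ^ j * x q⌋) x hx, ← Finset.sum_sub_distrib]
  refine Finset.sum_congr rfl fun e _ => ?_
  rw [Pi.sub_apply]
  ring

/-- Relative to the mesh `2^{-j}` the steps have size at most `θ = 2^{j-k}`. For an inner cube the
points `x + i v`, `i ≤ l`, move by at most `l 2^{-k}` and stay in the cell `m'`, which gives order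
`l`; otherwise one order is lost. -/
theorem dyadicDiff_spline_le (n l : ℕ) (hl : 0 < l) {r : ℝ} (hr : 0 < r) : ∃ C : ℝ≥0,
    ∀ (j k : ℕ), j ≤ k → ∀ (β : (Fin n → ℤ) → ℝ) (m' m : Fin n → ℤ), m ∈ subcubes j m' k →
      dyadicDiff l r k m (fun x => ∑ᶠ i, β i * bSplineN l j i x) ≤
        C * layerRate l j k m * ∑ e ∈ offsets n (2 * l), ‖β (m' + e)‖ₑ := by
  obtain ⟨B, hB, H⟩ := abs_fwdDiff_spline_le n l hl
  refine ⟨(2 : ℝ≥0) ^ ((n : ℝ) / r) * B.toNNReal, fun j k hjk β m' m hm => ?_⟩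
  set θ : ℝ := 2 ^ j / 2 ^ k with hθ
  have h2j : (0 : ℝ) < 2 ^ j := by positivity
  have h2k : (0 : ℝ) < 2 ^ k := by positivity
  have hθ0 : 0 ≤ θ := by positivity
  have hθ1 : θ ≤ 1 := by
    rw [hθ, div_le_one h2k]
    exact pow_le_pow_right₀ (by norm_num) hjk
  have hθe : ∀ a : ℕ, ENNReal.ofReal (θ ^ a) = (2 : ℝ≥0∞) ^ (((j : ℝ) - k) * a) := by
    intro a
    rw [ENNReal.ofReal_pow hθ0, hθ, ofReal_two_pow_div, ← ENNReal.rpow_natCast, ← ENNReal.rpow_mul]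
  have hpt : ∀ v x : Fin n → ℝ, (∀ q, |2 ^ k * v q| ≤ 1) → x ∈ dyadicCube k m →
      ‖(fwdDiff v)^[l] (fun x => ∑ᶠ i, β i * bSplineN l j i x) x‖ₑ ≤
        ENNReal.ofReal B * layerRate l j k m * ∑ e ∈ offsets n (2 * l), ‖β (m' + e)‖ₑ := by
    intro v x hv hx
    have hvq : ∀ q, |2 ^ j * v q| ≤ θ := by
      intro q
      have e : 2 ^ j * v q = θ * (2 ^ k * v q) := by rw [hθ]; field_simp
      rw [e, abs_mul, abs_of_nonneg hθ0]
      exact mul_le_of_le_one_right hθ0 (hv q)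
    have hxj := mem_dyadicCube.1 (hm hx)
    obtain ⟨h1, h2⟩ := H j β m' x v θ hθ0 hθ1 hvq fun q => ⟨(hxj q).1.le, (hxj q).2.le⟩
    have hfin : ∀ a : ℕ, |(fwdDiff v)^[l] (fun x => ∑ᶠ i, β i * bSplineN l j i x) x| ≤
        B * θ ^ a * ∑ e ∈ offsets n (2 * l), |β (m' + e)| →
        ‖(fwdDiff v)^[l] (fun x => ∑ᶠ i, β i * bSplineN l j i x) x‖ₑ ≤
        ENNReal.ofReal B * (2 : ℝ≥0∞) ^ (((j : ℝ) - k) * a) *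
          ∑ e ∈ offsets n (2 * l), ‖β (m' + e)‖ₑ := by
      intro a ha
      rw [Real.enorm_eq_ofReal_abs]
      refine (ENNReal.ofReal_le_ofReal ha).trans_eq ?_
      rw [ENNReal.ofReal_mul (by positivity), ENNReal.ofReal_mul hB, hθe,
        ENNReal.ofReal_sum_of_nonneg fun _ _ => abs_nonneg _]
      simp only [Real.enorm_eq_ofReal_abs]
    by_cases hi : IsInner l j k m
    · rw [layerRate, if_pos hi]
      refine hfin l (h2 fun q => ⟨m' q, fun i hil => ?_⟩)
      obtain ⟨w, rfl⟩ := Nat.exists_eq_add_of_le hjk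
      have hw : j + w - j = w := by omega
      have hi' := hi q
      have hdm := Int.mul_ediv_add_emod (m q) (2 ^ w)
      have hm' := (mem_subcubes_iff hjk).1 hm q
      rw [hw] at hi' hm'
      rw [hm'] at hdm
      have a1 : 2 ^ w * m' q + l ≤ m q := by linarith [hi'.1]
      have a2 : m q + l + 1 ≤ 2 ^ w * m' q + 2 ^ w := by linarith [hi'.2]
      have b1 : (2 : ℝ) ^ w * m' q + l ≤ m q := by exact_mod_cast a1
      have b2 : (m q : ℝ) + l + 1 ≤ 2 ^ w * m' q + 2 ^ w := by exact_mod_cast a2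
      have hxk := mem_dyadicCube.1 hx q
      have hil' : (i : ℝ) ≤ l := by exact_mod_cast hil
      have hiv : |(i : ℝ) * (2 ^ (j + w) * v q)| ≤ l := by
        rw [abs_mul, Nat.abs_cast]
        calc (i : ℝ) * |2 ^ (j + w) * v q| ≤ l * 1 := by
              gcongr
              exact hv q
          _ = l := mul_one _
      rw [abs_le] at hiv
      have e : (2 : ℝ) ^ w * (2 ^ j * (x q + i * v q)) =
          2 ^ (j + w) * x q + i * (2 ^ (j + w) * v q) := by rw [pow_add]; ring
      have h2w : (0 : ℝ) < 2 ^ w := by positivity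
      constructor
      · refine le_of_mul_le_mul_left ?_ h2w
        rw [e]
        linarith [hxk.1, hiv.1]
      · refine lt_of_mul_lt_mul_left ?_ h2w.le
        rw [e]
        linarith [hxk.2, hiv.2]
    · rw [layerRate, if_neg hi]
      have := hfin (l - 1) h1
      rwa [Nat.cast_sub hl, Nat.cast_one] at this
  refine (dyadicDiff_le_of_bound l hr k m _ _ hpt).trans_eq ?_
  rw [ENNReal.coe_mul, ENNReal.coe_rpow_of_nonneg _ (by positivity)]
  simp only [ENNReal.ofReal, ENNReal.coe_ofNat]
  ring

end Sums

/-! ### Weighted estimates for general functions and for splines. -/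

section Weighted

variable {n d : ℕ} {γ : (Fin n ⊕ Fin d → ℝ) → ℝ} {p : ℝ}

theorem diffSum_le_cellSum (hd : 0 < d) (hp : 0 < p) (hγ : IsWeight γ)
    (hγp : ALocInfty (fun z => γ z ^ p)) (α₁ α₂ α₃ C₁ : ℝ) (l : ℕ) {r : ℝ} (hr : 0 < r) :
    ∃ C : ℝ≥0, ∀ s : ℕ → (Fin n → ℝ) → ℝ, LocY α₁ α₂ α₃ C₁ s → ∀ (k : ℕ) (f : (Fin n → ℝ) → ℝ),
      Measurable f → diffSum l r p (tSeq s γ p) k f ≤ C * cellSum r p (tSeq s γ p) k f := by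
  obtain ⟨C₀, hC₀⟩ := tSeq_neighbour_le (n := n) hd hp hγ hγp α₁ α₂ α₃ C₁ l
  obtain ⟨D, hD⟩ := dyadicDiff_le_sum_lpNormOn n l hr
  obtain ⟨E, hE⟩ := tsum_mul_sum_offsets_rpow_le n l hp C₀
  refine ⟨D ^ p * E, fun s hs k f hf => ?_⟩
  set a : (Fin n → ℤ) → ℝ≥0∞ := fun m =>
    (2 : ℝ≥0∞) ^ ((k : ℝ) * n / r) * lpNormOn f r (dyadicCube k m) with ha
  calc diffSum l r p (tSeq s γ p) k f
      ≤ ∑' m, (D : ℝ≥0∞) ^ p * (tSeq s γ p k m ^ p * (∑ e ∈ offsets n l, a (m + e)) ^ p) := by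
        refine ENNReal.tsum_le_tsum fun m => ?_
        refine (mul_le_mul' le_rfl (ENNReal.rpow_le_rpow (hD f hf k m) hp.le)).trans_eq ?_
        rw [ENNReal.mul_rpow_of_nonneg _ _ hp.le]
        ring
    _ ≤ (D : ℝ≥0∞) ^ p * (E * ∑' m, tSeq s γ p k m ^ p * a m ^ p) := by
        rw [ENNReal.tsum_mul_left]
        exact mul_le_mul' le_rfl (hE (fun m => tSeq s γ p k m ^ p) a (hC₀ s hs k))
    _ = _ := by
        rw [cellSum]
        push_cast [ENNReal.coe_rpow_of_nonneg _ hp.le]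
        ring

/-- The subcubes are grouped under their ancestors `m'`. The coefficients near `m'` factor out, the
inner sum yields the decay, and stability of the basis turns the coefficients into local
quasi-norms. -/
theorem diffSum_spline_le (hd : 0 < d) (hp : 0 < p) (hγ : IsWeight γ)
    (hγp : ALocInfty (fun z => γ z ^ p)) (α₁ α₂ α₃ C₁ : ℝ) {l : ℕ} (hl : 0 < l) {r : ℝ}
    (hr : 0 < r) {ε : ℝ} (hε : 0 < ε) :
    ∃ C : ℝ≥0, ∀ s : ℕ → (Fin n → ℝ) → ℝ, LocY α₁ α₂ α₃ C₁ s → ∀ (j k : ℕ), j ≤ k →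
      ∀ U ∈ splineSpace n l j, diffSum l r p (tSeq s γ p) k U ≤
        C * (2 : ℝ≥0∞) ^ (((j : ℝ) - k) * rate l p α₂ ε γ * p) *
          cellSum r p (tSeq s γ p) j U := by
  obtain ⟨C₀, hC₀⟩ := tSeq_neighbour_le (n := n) hd hp hγ hγp α₁ α₂ α₃ C₁ (2 * l)
  obtain ⟨D, hD⟩ := dyadicDiff_spline_le n l hl hr
  obtain ⟨E, hE⟩ := tsum_mul_sum_offsets_rpow_le n (2 * l) hp C₀
  obtain ⟨F, hF⟩ := tsum_layerRate_tSeq_le (n := n) hd hp hγ hγp α₁ α₂ α₃ C₁ l hε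
  obtain ⟨G, hG⟩ := enorm_coeff_le n l hl r hr
  refine ⟨D ^ p * F * E * G ^ p, fun s hs j k hjk U hU => ?_⟩
  obtain ⟨β, hβ⟩ := hU
  obtain rfl : U = fun x => ∑ᶠ i, β i * bSplineN l j i x := funext hβ
  set ρ : ℝ≥0∞ := (2 : ℝ≥0∞) ^ (((j : ℝ) - k) * rate l p α₂ ε γ * p) with hρ
  set b : (Fin n → ℤ) → ℝ≥0∞ := fun m => ‖β m‖ₑ with hb
  rw [diffSum, ← tsum_subcubes hjk]
  calc _ ≤ ∑' m', (D : ℝ≥0∞) ^ p * (∑ e ∈ offsets n (2 * l), b (m' + e)) ^ p *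
        ∑' m : subcubes j m' k, layerRate l j k m.1 ^ p * tSeq s γ p k m ^ p := by
        refine ENNReal.tsum_le_tsum fun m' => ?_
        rw [← ENNReal.tsum_mul_left]
        refine ENNReal.tsum_le_tsum fun m => ?_
        refine (mul_le_mul' le_rfl (ENNReal.rpow_le_rpow (hD j k hjk β m' m m.2) hp.le)).trans_eq ?_
        rw [ENNReal.mul_rpow_of_nonneg _ _ hp.le, ENNReal.mul_rpow_of_nonneg _ _ hp.le]
        ring
    _ ≤ ∑' m', (D : ℝ≥0∞) ^ p * (∑ e ∈ offsets n (2 * l), b (m' + e)) ^ p *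
        (F * ρ * tSeq s γ p j m' ^ p) := by
        refine ENNReal.tsum_le_tsum fun m' => mul_le_mul' le_rfl (hF s hs j k hjk m')
    _ = ((D : ℝ≥0∞) ^ p * F * ρ) *
          ∑' m', tSeq s γ p j m' ^ p * (∑ e ∈ offsets n (2 * l), b (m' + e)) ^ p := by
        rw [← ENNReal.tsum_mul_left]
        exact tsum_congr fun m' => by ring
    _ ≤ ((D : ℝ≥0∞) ^ p * F * ρ) * (E * ∑' m, tSeq s γ p j m ^ p * b m ^ p) := by
        gcongr
        exact hE (fun m => tSeq s γ p j m ^ p) b (hC₀ s hs j)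
    _ ≤ ((D : ℝ≥0∞) ^ p * F * ρ) * (E * ((G : ℝ≥0∞) ^ p *
          cellSum r p (tSeq s γ p) j (fun x => ∑ᶠ i, β i * bSplineN l j i x))) := by
        gcongr
        rw [cellSum, ← ENNReal.tsum_mul_left]
        refine ENNReal.tsum_le_tsum fun m => ?_
        refine (mul_le_mul' le_rfl (ENNReal.rpow_le_rpow (hG j β m) hp.le)).trans_eq ?_
        rw [ENNReal.mul_rpow_of_nonneg _ _ hp.le]
        ring
    _ = _ := by
        push_cast [ENNReal.coe_rpow_of_nonneg _ hp.le]
        ring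

/-- Only a bound independent of `j` and `m'` matters, so the children are embedded into the larger
set of offsets in `{-1, 0, 1}ⁿ`. -/
theorem encard_subcubes_succ_le (j : ℕ) (m' : Fin n → ℤ) :
    (subcubes j m' (j + 1)).encard ≤ ((offsets n 1).card : ℕ∞) := by
  classical
  have hsub : subcubes j m' (j + 1) ⊆
      (((offsets n 1).image fun e q => 2 * m' q + e q : Finset (Fin n → ℤ)) : Set (Fin n → ℤ)) := by
    intro m hm
    have h := (mem_subcubes_iff (Nat.le_succ j)).1 hm
    simp only [Finset.coe_image, Set.mem_image, Finset.mem_coe]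
    refine ⟨fun q => m q - 2 * m' q, mem_offsets.2 fun q => ?_, by funext q; simp⟩
    have hq := h q
    rw [show j + 1 - j = 1 by omega, pow_one] at hq
    rw [abs_le]
    omega
  refine (Set.encard_le_encard hsub).trans ?_
  rw [Set.encard_coe_eq_coe_finsetCard]
  exact_mod_cast Finset.card_image_le

/-- Allows the error of `S_j` to be measured one generation finer, as needed for `S_{j+1} - S_j`. -/
theorem cellSum_succ_le (hd : 0 < d) (hp : 0 < p) (hγ : IsWeight γ)
    (hγp : ALocInfty (fun z => γ z ^ p)) (α₁ α₂ α₃ C₁ : ℝ) {r : ℝ} (hr : 0 < r) :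
    ∃ C : ℝ≥0, ∀ s : ℕ → (Fin n → ℝ) → ℝ, LocY α₁ α₂ α₃ C₁ s → ∀ (j : ℕ) (f : (Fin n → ℝ) → ℝ),
      cellSum r p (tSeq s γ p) (j + 1) f ≤ C * cellSum r p (tSeq s γ p) j f := by
  obtain ⟨C₀, hC₀⟩ := tSeq_child_le (n := n) hd hp hγ hγp α₁ α₂ α₃ C₁
  set a : ℝ≥0 := (2 : ℝ≥0) ^ ((n : ℝ) / r) with ha
  set N : ℝ≥0 := ((offsets n 1).card : ℝ≥0) with hN
  refine ⟨N * (C₀ * a ^ p), fun s hs j f => ?_⟩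
  rw [cellSum, ← tsum_subcubes (Nat.le_succ j), cellSum, ← ENNReal.tsum_mul_left]
  refine ENNReal.tsum_le_tsum fun m' => ?_
  set X : ℝ≥0∞ := tSeq s γ p j m' ^ p *
    ((2 : ℝ≥0∞) ^ ((j : ℝ) * n / r) * lpNormOn f r (dyadicCube j m')) ^ p with hX
  calc _ ≤ ∑' _m : subcubes j m' (j + 1), (C₀ * (a : ℝ≥0∞) ^ p) * X := by
        refine ENNReal.tsum_le_tsum fun m => ?_
        have h1 : lpNormOn f r (dyadicCube (j + 1) m.1) ≤ lpNormOn f r (dyadicCube j m') :=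
          eLpNorm_mono_measure _ (Measure.restrict_mono_set _ m.2)
        have h2 : (2 : ℝ≥0∞) ^ (((j + 1 : ℕ) : ℝ) * n / r) =
            a * (2 : ℝ≥0∞) ^ ((j : ℝ) * n / r) := by
          rw [ha, ENNReal.coe_rpow_of_nonneg _ (by positivity), ENNReal.coe_ofNat, ← two_rpow_add]
          congr 1
          push_cast
          ring
        rw [h2]
        calc _ ≤ (C₀ * tSeq s γ p j m' ^ p) * (a * (2 : ℝ≥0∞) ^ ((j : ℝ) * n / r) *
              lpNormOn f r (dyadicCube j m')) ^ p := by
              gcongr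
              exact hC₀ s hs j m m' m.2
          _ = _ := by
              rw [mul_assoc (a : ℝ≥0∞), ENNReal.mul_rpow_of_nonneg _ _ hp.le, hX]
              ring
    _ ≤ N * ((C₀ * (a : ℝ≥0∞) ^ p) * X) := by
        rw [ENNReal.tsum_const]
        refine mul_le_mul' ?_ le_rfl
        have h := encard_subcubes_succ_le j m'
        have h' : ((ENat.card (subcubes j m' (j + 1)) : ℕ∞) : ℝ≥0∞) ≤
            (((offsets n 1).card : ℕ∞) : ℝ≥0∞) := ENat.toENNReal_le.2 h
        simpa [hN] using h'
    _ = _ := by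
        push_cast [ENNReal.coe_rpow_of_nonneg _ hp.le]
        ring

end Weighted

/-! ### The main estimate -/

theorem sum_rpow_le_rpow_sum {ι : Type*} (s : Finset ι) (a : ι → ℝ≥0∞) {q : ℝ} (hq : 1 ≤ q) :
    ∑ i ∈ s, a i ^ q ≤ (∑ i ∈ s, a i) ^ q := by
  classical
  induction s using Finset.induction_on with
  | empty => simp
  | insert i s hi ih =>
    rw [Finset.sum_insert hi, Finset.sum_insert hi]
    exact (add_le_add le_rfl ih).trans (ENNReal.add_rpow_le_rpow_add _ _ hq)

/-- The embedding `ℓ_μ ⊆ ℓ_ν` for `μ ≤ ν` with constant one; the separate term `x` plays the role of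
the index `-1`. -/
theorem add_sum_rpow_root_anti {ι : Type*} (s : Finset ι) (x : ℝ≥0∞) (a : ι → ℝ≥0∞) {μ ν : ℝ}
    (hμ : 0 < μ) (hμν : μ ≤ ν) :
    (x ^ ν + ∑ i ∈ s, a i ^ ν) ^ (1 / ν) ≤ (x ^ μ + ∑ i ∈ s, a i ^ μ) ^ (1 / μ) := by
  have hν : 0 < ν := hμ.trans_le hμν
  have hq : 1 ≤ ν / μ := by rwa [one_le_div hμ]
  have e : ∀ y : ℝ≥0∞, y ^ ν = (y ^ μ) ^ (ν / μ) := fun y => by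
    rw [← ENNReal.rpow_mul, mul_div_cancel₀ ν hμ.ne']
  have h1 : x ^ ν + ∑ i ∈ s, a i ^ ν ≤ (x ^ μ + ∑ i ∈ s, a i ^ μ) ^ (ν / μ) := by
    simp only [e]
    exact (add_le_add le_rfl (sum_rpow_le_rpow_sum s _ hq)).trans
      (ENNReal.add_rpow_le_rpow_add _ _ hq)
  refine (ENNReal.rpow_le_rpow h1 (by positivity)).trans_eq ?_
  rw [← ENNReal.rpow_mul]
  congr 1
  field_simp

theorem cellSum_sub_comm {n : ℕ} (r p : ℝ) (t : ℕ → (Fin n → ℤ) → ℝ≥0∞) (k : ℕ)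
    (f g : (Fin n → ℝ) → ℝ) : cellSum r p t k (f - g) = cellSum r p t k (g - f) := by
  simp only [cellSum, lpNormOn]
  refine tsum_congr fun m => ?_
  rw [eLpNorm_sub_comm]

section Main

variable {n d : ℕ} {γ : (Fin n ⊕ Fin d → ℝ) → ℝ} {p : ℝ}

/-- Telescoping with arbitrary splines `S j`. Measured at generation `j`, each increment is
controlled by two consecutive errors, and the decay in `j - k` turns their sum into the weighted
right side. -/
theorem diffSum_rpow_le_of_splines (hd : 0 < d) (hp : 0 < p) (hγ : IsWeight γ)
    (hγp : ALocInfty (fun z => γ z ^ p)) (α₁ α₂ α₃ C₁ : ℝ) {l : ℕ} (hl : 0 < l) {r : ℝ}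
    (hr : 0 < r) {ε : ℝ} (hε : 0 < ε) {μ : ℝ} (hμ : 0 < μ) (hμ1 : μ ≤ 1) (hμr : μ ≤ r)
    (hμp : μ ≤ p) :
    ∃ C : ℝ≥0, ∀ s : ℕ → (Fin n → ℝ) → ℝ, LocY α₁ α₂ α₃ C₁ s → ∀ φ : (Fin n → ℝ) → ℝ,
      Measurable φ → ∀ S : ℕ → (Fin n → ℝ) → ℝ, (∀ j, S j ∈ splineSpace n l j) → ∀ k : ℕ,
      diffSum l r p (tSeq s γ p) k φ ^ (μ / p) ≤
        C * (2 : ℝ≥0∞) ^ (-(k : ℝ) * μ * rate l p α₂ ε γ) *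
          ((2 : ℝ≥0∞) ^ (-1 * μ * rate l p α₂ ε γ) * cellSum r p (tSeq s γ p) 0 φ ^ (μ / p) +
            ∑ j ∈ Finset.range (k + 1), (2 : ℝ≥0∞) ^ ((j : ℝ) * μ * rate l p α₂ ε γ) *
              cellSum r p (tSeq s γ p) j (φ - S j) ^ (μ / p)) := by
  obtain ⟨A, hA⟩ := diffSum_le_cellSum (n := n) hd hp hγ hγp α₁ α₂ α₃ C₁ l hr
  obtain ⟨B, hB⟩ := diffSum_spline_le (n := n) hd hp hγ hγp α₁ α₂ α₃ C₁ hl hr hε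
  obtain ⟨D, hD⟩ := cellSum_add_le n (r := r) hp
  obtain ⟨E, hE⟩ := cellSum_succ_le (n := n) hd hp hγ hγp α₁ α₂ α₃ C₁ hr
  set ρ := rate l p α₂ ε γ with hρ
  have hq : 0 ≤ μ / p := by positivity
  have hq1 : μ / p ≤ 1 := by rwa [div_le_one hp]
  set K₁ : ℝ≥0 := A ^ (μ / p) with hK₁
  set K₂ : ℝ≥0 := (B * (D * (1 + E))) ^ (μ / p) with hK₂
  refine ⟨K₁ + K₂ * (1 + (2 : ℝ≥0) ^ (μ * ρ)), fun s hs φ hφ S hS k => ?_⟩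
  set t := tSeq s γ p with ht
  have hSm : ∀ j, Measurable (S j) := fun j => measurable_of_mem_splineSpace hl (hS j)
  let U : ℕ → (Fin n → ℝ) → ℝ := fun j => Nat.casesOn j (S 0) (fun i => S (i + 1) - S i)
  -- The index is shifted by one: `Y 0` is the term of index `-1`, where `φ` itself is the error,
  -- and `Y (j + 1)` belongs to `S j`.
  let Y : ℕ → ℝ≥0∞ := fun j =>
    Nat.casesOn j (cellSum r p t 0 φ ^ (μ / p)) (fun i => cellSum r p t i (φ - S i) ^ (μ / p))
  have hUm : ∀ j, Measurable (U j) := by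
    intro j
    cases j with
    | zero => exact hSm 0
    | succ i => exact (hSm (i + 1)).sub (hSm i)
  have hUs : ∀ j, U j ∈ splineSpace n l j := by
    intro j
    cases j with
    | zero => exact hS 0
    | succ i => exact sub_mem_splineSpace hl (hS (i + 1)) (splineSpace_mono_succ hl i (hS i))
  have hcell : ∀ j, cellSum r p t j (U j) ^ (μ / p) ≤
      ((D * (1 + E) : ℝ≥0) : ℝ≥0∞) ^ (μ / p) * (Y (j + 1) + Y j) := by
    intro j
    have hroot : ∀ X Z W : ℝ≥0∞, X ≤ ((D * (1 + E) : ℝ≥0) : ℝ≥0∞) * (Z + W) → X ^ (μ / p) ≤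
        ((D * (1 + E) : ℝ≥0) : ℝ≥0∞) ^ (μ / p) * (Z ^ (μ / p) + W ^ (μ / p)) := by
      intro X Z W h
      refine (ENNReal.rpow_le_rpow h hq).trans ?_
      rw [ENNReal.mul_rpow_of_nonneg _ _ hq]
      exact mul_le_mul' le_rfl (ENNReal.rpow_add_le_add_rpow _ _ hq hq1)
    have h1E : (1 : ℝ≥0∞) ≤ 1 + E := le_self_add
    cases j with
    | zero =>
      refine hroot _ (cellSum r p t 0 (φ - S 0)) (cellSum r p t 0 φ) ?_
      have e : U 0 = (S 0 - φ) + φ := by simp [U]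
      rw [e]
      refine (hD t 0 _ _ ((hSm 0).sub hφ) hφ).trans ?_
      rw [cellSum_sub_comm, ENNReal.coe_mul, ENNReal.coe_add, ENNReal.coe_one]
      gcongr
      exact le_mul_of_one_le_right zero_le h1E
    | succ i =>
      refine hroot _ (cellSum r p t (i + 1) (φ - S (i + 1))) (cellSum r p t i (φ - S i)) ?_
      have e : U (i + 1) = (S (i + 1) - φ) + (φ - S i) := by simp [U]
      rw [e]
      refine (hD t (i + 1) _ _ ((hSm _).sub hφ) (hφ.sub (hSm i))).trans ?_
      rw [cellSum_sub_comm r p t (i + 1) (S (i + 1)) φ, ENNReal.coe_mul, ENNReal.coe_add,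
        ENNReal.coe_one, mul_assoc]
      refine mul_le_mul' le_rfl ?_
      rw [mul_add]
      refine add_le_add (le_mul_of_one_le_left zero_le h1E) ((hE s hs i _).trans ?_)
      gcongr
      exact le_add_self
  have hterm : ∀ j ≤ k, diffSum l r p t k (U j) ^ (μ / p) ≤
      K₂ * (2 : ℝ≥0∞) ^ (((j : ℝ) - k) * ρ * μ) * (Y (j + 1) + Y j) := by
    intro j hjk
    refine (ENNReal.rpow_le_rpow (hB s hs j k hjk (U j) (hUs j)) hq).trans ?_
    rw [ENNReal.mul_rpow_of_nonneg _ _ hq, ENNReal.mul_rpow_of_nonneg _ _ hq, ← ENNReal.rpow_mul]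
    refine (mul_le_mul' le_rfl (hcell j)).trans_eq ?_
    have hK₂e : (K₂ : ℝ≥0∞) =
        (B : ℝ≥0∞) ^ (μ / p) * ((D * (1 + E) : ℝ≥0) : ℝ≥0∞) ^ (μ / p) := by
      rw [hK₂, ENNReal.coe_rpow_of_nonneg _ hq, ENNReal.coe_mul,
        ENNReal.mul_rpow_of_nonneg _ _ hq]
    rw [hK₂e,
      show ((j : ℝ) - k) * ρ * p * (μ / p) = ((j : ℝ) - k) * ρ * μ by field_simp]
    ring
  have htel : ∀ i, diffSum l r p t k (S i) ^ (μ / p) ≤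
      ∑ j ∈ Finset.range (i + 1), diffSum l r p t k (U j) ^ (μ / p) := by
    intro i
    induction i with
    | zero => simp [U]
    | succ i ih =>
      rw [Finset.sum_range_succ]
      have e : S (i + 1) = S i + U (i + 1) := by simp [U]
      rw [e]
      exact (diffSum_add_rpow_le (hSm i) (hUm (i + 1)) l hμ hμ1 hμr hμp t k).trans
        (add_le_add ih le_rfl)
  have hfirst : diffSum l r p t k (φ - S k) ^ (μ / p) ≤ K₁ * Y (k + 1) := by
    refine (ENNReal.rpow_le_rpow (hA s hs k _ (hφ.sub (hSm k))) hq).trans_eq ?_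
    rw [ENNReal.mul_rpow_of_nonneg _ _ hq, hK₁, ENNReal.coe_rpow_of_nonneg _ hq]
  have hsplit : diffSum l r p t k φ ^ (μ / p) ≤
      diffSum l r p t k (φ - S k) ^ (μ / p) + diffSum l r p t k (S k) ^ (μ / p) := by
    have := diffSum_add_rpow_le (hφ.sub (hSm k)) (hSm k) l hμ hμ1 hμr hμp t k
    rwa [sub_add_cancel] at this
  set c : ℝ≥0∞ := (2 : ℝ≥0∞) ^ (-(k : ℝ) * μ * ρ) with hc
  set Z₁ : ℝ≥0∞ := ∑ j ∈ Finset.range (k + 1), (2 : ℝ≥0∞) ^ ((j : ℝ) * μ * ρ) * Y (j + 1) with hZ₁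
  set Z : ℝ≥0∞ := (2 : ℝ≥0∞) ^ (-1 * μ * ρ) * Y 0 + Z₁ with hZ
  have hk : Y (k + 1) ≤ c * Z := by
    have h1 : (2 : ℝ≥0∞) ^ ((k : ℝ) * μ * ρ) * Y (k + 1) ≤ Z :=
      (Finset.single_le_sum (f := fun j : ℕ => (2 : ℝ≥0∞) ^ ((j : ℝ) * μ * ρ) * Y (j + 1))
        (fun _ _ => zero_le) (by simp : k ∈ Finset.range (k + 1))).trans le_add_self
    refine le_trans (le_of_eq ?_) (mul_le_mul' le_rfl h1)
    rw [hc, ← mul_assoc, ← two_rpow_add]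
    simp
  -- The terms of index `j - 1` occur with the weight of index `j`; correcting this costs the factor
  -- `2^{μρ}`.
  have hY : ∑ j ∈ Finset.range (k + 1), (2 : ℝ≥0∞) ^ ((j : ℝ) * μ * ρ) * Y j ≤
      (2 : ℝ≥0∞) ^ (μ * ρ) * Z := by
    rw [Finset.sum_range_succ', hZ, mul_add, add_comm]
    refine add_le_add (le_of_eq ?_) ?_
    · rw [← mul_assoc, ← two_rpow_add]
      simp
    · rw [hZ₁, Finset.sum_range_succ, mul_add, Finset.mul_sum]
      refine le_trans (Finset.sum_le_sum fun j _ => le_of_eq ?_) le_self_add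
      rw [← mul_assoc, ← two_rpow_add]
      congr 2
      push_cast
      ring
  calc diffSum l r p t k φ ^ (μ / p)
      ≤ K₁ * Y (k + 1) + ∑ j ∈ Finset.range (k + 1),
          K₂ * (2 : ℝ≥0∞) ^ (((j : ℝ) - k) * ρ * μ) * (Y (j + 1) + Y j) := by
        refine hsplit.trans (add_le_add hfirst ((htel k).trans (Finset.sum_le_sum fun j hj => ?_)))
        exact hterm j (by simp at hj; omega)
    _ = K₁ * Y (k + 1) + K₂ * (c * (Z₁ +
          ∑ j ∈ Finset.range (k + 1), (2 : ℝ≥0∞) ^ ((j : ℝ) * μ * ρ) * Y j)) := by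
        congr 1
        rw [hZ₁, ← Finset.sum_add_distrib, Finset.mul_sum, Finset.mul_sum]
        refine Finset.sum_congr rfl fun j _ => ?_
        rw [show ((j : ℝ) - k) * ρ * μ = -(k : ℝ) * μ * ρ + (j : ℝ) * μ * ρ by ring, two_rpow_add]
        ring
    _ ≤ K₁ * (c * Z) + K₂ * (c * (Z + (2 : ℝ≥0∞) ^ (μ * ρ) * Z)) := by
        gcongr
        exact le_add_self
    _ = _ := by
        have h2 : (((2 : ℝ≥0) ^ (μ * ρ) : ℝ≥0) : ℝ≥0∞) = (2 : ℝ≥0∞) ^ (μ * ρ) := by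
          rw [ENNReal.coe_rpow_of_ne_zero (by norm_num), ENNReal.coe_ofNat]
        rw [ENNReal.coe_add, ENNReal.coe_mul, ENNReal.coe_add, ENNReal.coe_one, h2]
        exact Eq.trans (b := ((K₁ : ℝ≥0∞) + K₂ * (1 + (2 : ℝ≥0∞) ^ (μ * ρ))) * c * Z) (by ring) rfl

theorem zero_mem_splineSpace (n l j : ℕ) : (0 : (Fin n → ℝ) → ℝ) ∈ splineSpace n l j :=
  ⟨0, fun x => by simp⟩

/-- The infima need not be attained, so splines within `η > 0` of them are used, and `η → 0` by
continuity of the right side in `ℝ≥0∞`. -/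
theorem diffSum_root_le (hd : 0 < d) (hp : 0 < p) (hγ : IsWeight γ)
    (hγp : ALocInfty (fun z => γ z ^ p)) (α₁ α₂ α₃ C₁ : ℝ) {l : ℕ} (hl : 0 < l) {r : ℝ}
    (hr : 0 < r) {ε : ℝ} (hε : 0 < ε) {μ : ℝ} (hμ : 0 < μ) (hμ1 : μ ≤ 1) (hμr : μ ≤ r)
    (hμp : μ ≤ p) :
    ∃ C : ℝ≥0, ∀ s : ℕ → (Fin n → ℝ) → ℝ, LocY α₁ α₂ α₃ C₁ s → ∀ φ : (Fin n → ℝ) → ℝ,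
      Measurable φ → ∀ k : ℕ,
      diffSum l r p (tSeq s γ p) k φ ^ (1 / p) ≤
        C * (2 : ℝ≥0∞) ^ (-(k : ℝ) * rate l p α₂ ε γ) *
          ((2 : ℝ≥0∞) ^ (-1 * μ * rate l p α₂ ε γ) *
              splineErrorInit r p (tSeq s γ p) φ ^ μ +
            ∑ j ∈ Finset.range (k + 1), (2 : ℝ≥0∞) ^ ((j : ℝ) * μ * rate l p α₂ ε γ) *
              splineError l r p (tSeq s γ p) φ j ^ μ) ^ (1 / μ) := by
  obtain ⟨C, hC⟩ := diffSum_rpow_le_of_splines (n := n) hd hp hγ hγp α₁ α₂ α₃ C₁ hl hr hε hμ hμ1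
    hμr hμp
  refine ⟨C ^ (1 / μ), fun s hs φ hφ k => ?_⟩
  set t := tSeq s γ p with ht
  set ρ := rate l p α₂ ε γ with hρ
  have hinit : splineErrorInit r p t φ ^ μ = cellSum r p t 0 φ ^ (μ / p) := by
    rw [splineErrorInit, ← ENNReal.rpow_mul, one_div_mul_eq_div, cellSum]
    simp
  have h2t : ∀ x : ℝ, (2 : ℝ≥0∞) ^ x ≠ ∞ := fun x =>
    ENNReal.rpow_ne_top_of_ne_zero (by norm_num) (by norm_num)
  let F : ℝ≥0∞ → ℝ≥0∞ := fun η => ((C ^ (1 / μ) : ℝ≥0) : ℝ≥0∞) * (2 : ℝ≥0∞) ^ (-(k : ℝ) * ρ) *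
    ((2 : ℝ≥0∞) ^ (-1 * μ * ρ) * splineErrorInit r p t φ ^ μ +
      ∑ j ∈ Finset.range (k + 1), (2 : ℝ≥0∞) ^ ((j : ℝ) * μ * ρ) *
        (splineError l r p t φ j + η) ^ μ) ^ (1 / μ)
  have hFc : Continuous F := by
    refine (ENNReal.continuous_const_mul (ENNReal.mul_ne_top ENNReal.coe_ne_top (h2t _))).comp ?_
    refine ENNReal.continuous_rpow_const.comp (continuous_const.add ?_)
    refine continuous_finsetSum _ fun j _ => ?_
    refine (ENNReal.continuous_const_mul (h2t _)).comp ?_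
    exact ENNReal.continuous_rpow_const.comp (continuous_const.add continuous_id)
  have hF : ∀ η : ℝ≥0∞, 0 < η → diffSum l r p t k φ ^ (1 / p) ≤ F η := by
    intro η hη
    have hex : ∀ j, ∃ S ∈ splineSpace n l j,
        cellSum r p t j (φ - S) ^ (1 / p) ≤ splineError l r p t φ j + η := by
      intro j
      by_cases htop : splineError l r p t φ j = ∞
      -- With an infinite error any spline will do.
      · exact ⟨0, zero_mem_splineSpace n l j, by simp [htop]⟩
      · have hlt : splineError l r p t φ j < splineError l r p t φ j + η :=
          ENNReal.lt_add_right htop hη.ne'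
        conv_lhs at hlt => rw [splineError]
        simp only [iInf_lt_iff] at hlt
        obtain ⟨S, hS, h⟩ := hlt
        exact ⟨S, hS, h.le⟩
    choose S hS hSe using hex
    have h1 := ENNReal.rpow_le_rpow (hC s hs φ hφ S hS k) (by positivity : 0 ≤ 1 / μ)
    rw [← ENNReal.rpow_mul, show μ / p * (1 / μ) = 1 / p by field_simp] at h1
    refine h1.trans ?_
    rw [ENNReal.mul_rpow_of_nonneg _ _ (by positivity), ENNReal.mul_rpow_of_nonneg _ _
      (by positivity), ← ENNReal.rpow_mul,
      show -(k : ℝ) * μ * ρ * (1 / μ) = -(k : ℝ) * ρ by field_simp,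
      ← ENNReal.coe_rpow_of_nonneg _ (by positivity), ← hinit]
    refine mul_le_mul' le_rfl (ENNReal.rpow_le_rpow ?_ (by positivity))
    gcongr with j _
    rw [show μ / p = 1 / p * μ by ring, ENNReal.rpow_mul]
    exact ENNReal.rpow_le_rpow (hSe j) hμ.le
  have hF0 : F 0 = ((C ^ (1 / μ) : ℝ≥0) : ℝ≥0∞) * (2 : ℝ≥0∞) ^ (-(k : ℝ) * ρ) *
      ((2 : ℝ≥0∞) ^ (-1 * μ * ρ) * splineErrorInit r p t φ ^ μ +
        ∑ j ∈ Finset.range (k + 1), (2 : ℝ≥0∞) ^ ((j : ℝ) * μ * ρ) *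
          splineError l r p t φ j ^ μ) ^ (1 / μ) := by simp [F]
  rw [← hF0]
  have hlim : Filter.Tendsto F (nhdsWithin 0 (Set.Ioi 0)) (nhds (F 0)) :=
    hFc.continuousAt.tendsto.mono_left nhdsWithin_le_nhds
  exact ge_of_tendsto hlim (Filter.eventually_of_mem self_mem_nhdsWithin hF)

theorem MemLpLoc.aemeasurable {φ : (Fin n → ℝ) → ℝ} {r : ℝ} (h : MemLpLoc φ r) :
    AEMeasurable φ volume := by
  have hU : (⋃ N : ℕ, Metric.closedBall (0 : Fin n → ℝ) N) = Set.univ :=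
    Metric.iUnion_closedBall_nat 0
  have h1 := (aemeasurable_iUnion_iff (μ := volume) (f := φ)
    (s := fun N : ℕ => Metric.closedBall (0 : Fin n → ℝ) N)).2 fun N =>
      (h _ (isCompact_closedBall _ _)).1.aemeasurable
  rwa [hU, Measure.restrict_univ] at h1

end Main

end VarSmooth

theorem theorem4p1 (n d l : ℕ) (hn : 0 < n) (hd : 0 < d) (hl : 0 < l)
    (p r : ℝ) (hp : 0 < p) (hr : 0 < r)
    (α₁ α₂ α₃ : ℝ) (hα₁ : 0 < α₁) (hα₁₂ : α₁ ≤ α₂) (hα₃ : 0 ≤ α₃)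
    (γ : (Fin n ⊕ Fin d → ℝ) → ℝ) (hγ : VarSmooth.IsWeight γ)
    (hγp : VarSmooth.ALocInfty (fun z => γ z ^ p))
    (ε : ℝ) (hε : 0 < ε) (C₁ : ℝ) (hC₁ : 0 < C₁) :
    ∃ C : NNReal, 0 < C ∧
      ∀ s : ℕ → (Fin n → ℝ) → ℝ, VarSmooth.LocY α₁ α₂ α₃ C₁ s →
      ∀ μ : ℝ, 0 < μ → μ ≤ min 1 (min r p) →
      ∀ φ : (Fin n → ℝ) → ℝ, VarSmooth.MemLpLoc φ r →
      ∀ k : ℕ,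
        (∑' m : Fin n → ℤ,
            VarSmooth.tSeq s γ p k m ^ p * VarSmooth.dyadicDiff l r k m φ ^ p) ^ (1 / p) ≤
          (C : ENNReal) * (2 : ENNReal) ^ (-(k : ℝ) * VarSmooth.rate l p α₂ ε γ) *
            ((2 : ENNReal) ^ (-1 * μ * VarSmooth.rate l p α₂ ε γ) *
                VarSmooth.splineErrorInit r p (VarSmooth.tSeq s γ p) φ ^ μ +
              ∑ j ∈ Finset.range (k + 1),
                (2 : ENNReal) ^ ((j : ℝ) * μ * VarSmooth.rate l p α₂ ε γ) *
                  VarSmooth.splineError l r p (VarSmooth.tSeq s γ p) φ j ^ μ) ^ (1 / μ) := by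
  -- The constant is fixed at the largest admissible exponent, before `μ` is given.
  have hμ₀ : 0 < min 1 (min r p) := lt_min one_pos (lt_min hr hp)
  obtain ⟨C, hC⟩ := VarSmooth.diffSum_root_le (n := n) hd hp hγ hγp α₁ α₂ α₃ C₁ hl hr hε hμ₀
    (min_le_left _ _) ((min_le_right _ _).trans (min_le_left _ _))
    ((min_le_right _ _).trans (min_le_right _ _))
  -- Adding one only ensures positivity of the constant.
  refine ⟨C + 1, by positivity, fun s hs μ hμ hμle φ hφ k => ?_⟩
  -- All quantities depend only on the almost everywhere class of `φ`, so a Borel representative may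
  -- be used; the product integrals above need one.
  obtain ⟨ψ, hψ, hφψ⟩ := hφ.aemeasurable
  have hdiff : ∀ m, VarSmooth.dyadicDiff l r k m φ = VarSmooth.dyadicDiff l r k m ψ :=
    fun m => VarSmooth.dyadicDiff_congr hφψ l r k m
  have hinit : VarSmooth.splineErrorInit r p (VarSmooth.tSeq s γ p) φ =
      VarSmooth.splineErrorInit r p (VarSmooth.tSeq s γ p) ψ := by
    simp only [VarSmooth.splineErrorInit, VarSmooth.lpNormOn]
    congr 1
    refine tsum_congr fun m => ?_
    rw [eLpNorm_congr_ae (ae_restrict_of_ae hφψ)]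
  have herr : ∀ j, VarSmooth.splineError l r p (VarSmooth.tSeq s γ p) φ j =
      VarSmooth.splineError l r p (VarSmooth.tSeq s γ p) ψ j := by
    intro j
    simp only [VarSmooth.splineError, VarSmooth.lpNormOn]
    refine iInf_congr fun S => iInf_congr fun _ => ?_
    congr 1
    refine tsum_congr fun m => ?_
    rw [eLpNorm_congr_ae (ae_restrict_of_ae (hφψ.sub (Filter.EventuallyEq.refl _ S)))]
  simp only [hdiff, hinit, herr]
  refine (hC s hs ψ hψ k).trans (mul_le_mul' (mul_le_mul' ?_ le_rfl) ?_)
  · push_cast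
    exact le_self_add
  · have h := VarSmooth.add_sum_rpow_root_anti (Finset.range (k + 1))
      ((2 : ENNReal) ^ (-1 * VarSmooth.rate l p α₂ ε γ) *
        VarSmooth.splineErrorInit r p (VarSmooth.tSeq s γ p) ψ)
      (fun j => (2 : ENNReal) ^ ((j : ℝ) * VarSmooth.rate l p α₂ ε γ) *
        VarSmooth.splineError l r p (VarSmooth.tSeq s γ p) ψ j) hμ hμle
    have e : ∀ (x ν : ℝ) (y : ENNReal), 0 < ν →
        ((2 : ENNReal) ^ (x * VarSmooth.rate l p α₂ ε γ) * y) ^ ν =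
          (2 : ENNReal) ^ (x * ν * VarSmooth.rate l p α₂ ε γ) * y ^ ν := by
      intro x ν y hν
      rw [ENNReal.mul_rpow_of_nonneg _ _ hν.le, ← ENNReal.rpow_mul, mul_right_comm]
    simp only [e _ _ _ hμ, e _ _ _ hμ₀] at h
    exact h
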